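/- Let $d\ge 2$ and let $\mathcal H$ be a smooth $d$-dimensional manifold with null metric hypersurface data $(\gamma,\ell,\ell^{(2)})$: $\gamma$ is a smooth symmetric $(0,2)$-tensor field (of any signature), $\ell$ a smooth one-form, $\ell^{(2)}$ a smooth function, the symmetric form $\mathcal A_p((W,a),(V,b))=\gamma(W,V)+a\,\ell(V)+b\,\ell(W)+ab\,\ell^{(2)}$ on $T_p\mathcal H\times\mathbb R$ is non-degenerate at every $p$, and, writing its inverse as $\mathcal A^\sharp((\alpha,a),(\beta,b))=P(\alpha,\beta)+a\,\beta(n)+b\,\alpha(n)+ab\,n^{(2)}$, which defines a symmetric $(2,0)$-tensor $P$, a vector field $n$ and a function $n^{(2)}$, one has $n^{(2)}=0$. Put $U=\tfrac12\mathcal L_n\gamma$, $F=\tfrac12 d\ell$, $s=F(n,\cdot)$ and $\operatorname{tr}_PT=P^{ab}T_{ab}$. Let $\nabla$ be the unique torsion-free connection on $\mathcal H$ with $\nabla_a\gamma_{bc}=-\ell_cU_{ab}-\ell_bU_{ac}$ and $\nabla_a\ell_b=F_{ab}-\ell^{(2)}U_{ab}$, and let $R_{ab}$ be its Ricci tensor.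 For a smooth symmetric $(0,2)$-tensor field $Y$ on $\mathcal H$ put $r=Y(n,\cdot)$, $\kappa_n=-Y(n,n)$, and define the constraint tensor $$\mathcal R_{ab}=R_{(ab)}-2\mathcal L_nY_{ab}-(2\kappa_n+\operatorname{tr}_PU)Y_{ab}+\nabla_{(a}(s_{b)}+2r_{b)})-2r_ar_b+4r_{(a}s_{b)}-s_as_b-(\operatorname{tr}_PY)U_{ab}+2P^{cd}U_{d(a}(2Y_{b)c}+F_{b)c}).$$ Let $\iota:\mathcal S\hookrightarrow\mathcal H$ be a cross-section, i.e. an embedded hypersurface which every maximal integral curve of $n$ meets exactly once (at exactly one parameter value), and suppose that $h=\iota^\star\gamma$ is a metric, i.e. non-degenerate at every point of $\mathcal S$. Let $f$ be a smooth function on $\mathcal H$ with $$-n(\operatorname{tr}_PU)+(\operatorname{tr}_PU)\,f-P^{ab}P^{cd}U_{ac}U_{bd}=0 .$$ Let $\lambda\in\mathbb R$, and let $\chi$, $\beta$ and $S$ be, respectively, a smooth function, a smooth one-form and a smooth symmetric $(0,2)$-tensor field on $\mathcal S$ with $S$ trace-free with respect to $h$. Then there exists a unique smooth symmetric $(0,2)$-tensor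 field $Y$ on $\mathcal H$ such that $\operatorname{tr}_PY=\chi$ on $\mathcal S$, $\kappa_n=f$ on $\mathcal H$, $\iota^\star r=\beta$, the trace-free part of $\iota^\star Y$ with respect to $h$ equals $S$, and $\mathcal R=\lambda\gamma$ on $\mathcal H$. -/

import Mathlib

open scoped Manifold ContDiff

noncomputable section

namespace NullData

/-! ### Tensor fields on a manifold -/

section Tensors

variable {d : ℕ} {M : Type*} [TopologicalSpace M] [ChartedSpace (EuclideanSpace ℝ (Fin d)) M]

/-- Smooth one-forms on `M`. -/
abbrev OneForm (d : ℕ) (M : Type*) [TopologicalSpace M]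
    [ChartedSpace (EuclideanSpace ℝ (Fin d)) M] [IsManifold (𝓡 d) ∞ M] : Type _ :=
  ContMDiffSection (𝓡 d) (EuclideanSpace ℝ (Fin d) →L[ℝ] ℝ) ∞
    (fun p : M ↦ TangentSpace (𝓡 d) p →L[ℝ] ℝ)

/-- Smooth `(0,2)` tensor fields on `M`. -/
abbrev TwoTensor (d : ℕ) (M : Type*) [TopologicalSpace M]
    [ChartedSpace (EuclideanSpace ℝ (Fin d)) M] [IsManifold (𝓡 d) ∞ M] : Type _ :=
  ContMDiffSection (𝓡 d) (EuclideanSpace ℝ (Fin d) →L[ℝ] EuclideanSpace ℝ (Fin d) →L[ℝ] ℝ) ∞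
    (fun p : M ↦ TangentSpace (𝓡 d) p →L[ℝ] TangentSpace (𝓡 d) p →L[ℝ] ℝ)

/-- The standard basis of a tangent space. -/
def frame (p : M) : Module.Basis (Fin d) ℝ (TangentSpace (𝓡 d) p) :=
  (EuclideanSpace.basisFun (Fin d) ℝ).toBasis

instance finiteDimensional_tangentSpace (p : M) :
    FiniteDimensional ℝ (TangentSpace (𝓡 d) p) :=
  inferInstanceAs (FiniteDimensional ℝ (EuclideanSpace ℝ (Fin d)))

instance t2Space_tangentSpace (p : M) : T2Space (TangentSpace (𝓡 d) p) :=
  inferInstanceAs (T2Space (EuclideanSpace ℝ (Fin d)))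

/-- The derivative `v(u)` of a function `u` along a tangent vector `v`. -/
def dirDeriv (u : M → ℝ) (p : M) (v : TangentSpace (𝓡 d) p) : ℝ :=
  mvfderiv (𝓡 d) u p v

variable [IsManifold (𝓡 d) ∞ M]

/-- A vector field, smooth near `p`, with value `v` at `p`. -/
def ext {p : M} (v : TangentSpace (𝓡 d) p) (q : M) : TangentSpace (𝓡 d) q :=
  FiberBundle.extend (EuclideanSpace ℝ (Fin d)) v q

/-- Differentiability of a vector field at a point. -/
abbrev DiffAt (X : Π p : M, TangentSpace (𝓡 d) p) (p : M) : Prop :=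
  MDifferentiableAt (𝓡 d) ((𝓡 d).prod 𝓘(ℝ, EuclideanSpace ℝ (Fin d)))
    (fun q ↦ Bundle.TotalSpace.mk' (EuclideanSpace ℝ (Fin d)) q (X q)) p

/-- The Lie bracket of two vector fields. -/
def bracket (X Y : Π p : M, TangentSpace (𝓡 d) p) (p : M) : TangentSpace (𝓡 d) p :=
  VectorField.mlieBracket (𝓡 d) X Y p

/-- The Lie derivative of a `(0,2)` tensor field:
`(L_X T)(V, W) = X (T(V, W)) - T([X, V], W) - T(V, [X, W])`. -/
def lieDeriv (X : Π p : M, TangentSpace (𝓡 d) p)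
    (T : Π p : M, TangentSpace (𝓡 d) p → TangentSpace (𝓡 d) p → ℝ) (p : M)
    (v w : TangentSpace (𝓡 d) p) : ℝ :=
  dirDeriv (fun q ↦ T q (ext v q) (ext w q)) p (X p)
    - T p (bracket X (ext v) p) w - T p v (bracket X (ext w) p)

/-- The exterior derivative of a one-form:
`dθ(V, W) = V (θ(W)) - W (θ(V)) - θ([V, W])`. -/
def extDeriv (θ : Π p : M, TangentSpace (𝓡 d) p → ℝ) (p : M)
    (v w : TangentSpace (𝓡 d) p) : ℝ :=
  dirDeriv (fun q ↦ θ q (ext w q)) p v - dirDeriv (fun q ↦ θ q (ext v q)) p w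
    - θ p (bracket (ext v) (ext w) p)

/-- The covariant derivative of a one-form:
`(∇_V θ)(W) = V (θ(W)) - θ(∇_V W)`. -/
def covDeriv (cov : CovariantDerivative (𝓡 d) (EuclideanSpace ℝ (Fin d))
      (fun p : M ↦ TangentSpace (𝓡 d) p))
    (θ : Π p : M, TangentSpace (𝓡 d) p → ℝ) (p : M) (v w : TangentSpace (𝓡 d) p) : ℝ :=
  dirDeriv (fun q ↦ θ q (ext w q)) p v - θ p (cov (ext w) p v)

/-- The curvature `R(X, Y) Z = ∇_X ∇_Y Z - ∇_Y ∇_X Z - ∇_[X, Y] Z` of a connection. -/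
def curvature (cov : CovariantDerivative (𝓡 d) (EuclideanSpace ℝ (Fin d))
      (fun p : M ↦ TangentSpace (𝓡 d) p))
    (X Y Z : Π p : M, TangentSpace (𝓡 d) p) (p : M) : TangentSpace (𝓡 d) p :=
  cov (fun q ↦ cov Z q (Y q)) p (X p) - cov (fun q ↦ cov Z q (X q)) p (Y p)
    - cov Z p (bracket X Y p)

/-- The Ricci tensor `R_{ab} = R^c_{acb}` of a connection: `Ric(v, w)` is the trace of
`u ↦ R(u, w) v`. -/
def ricci (cov : CovariantDerivative (𝓡 d) (EuclideanSpace ℝ (Fin d))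
      (fun p : M ↦ TangentSpace (𝓡 d) p))
    (p : M) (v w : TangentSpace (𝓡 d) p) : ℝ :=
  ∑ c, (frame p).coord c (curvature cov (ext (frame p c)) (ext w) (ext v) p)

/-- The trace of a `(0,2)` tensor with respect to a (nondegenerate) metric, at a point. -/
def metricTrace {p : M} (h T : TangentSpace (𝓡 d) p → TangentSpace (𝓡 d) p → ℝ) : ℝ :=
  ∑ a, ∑ b, ((Matrix.of fun i j ↦ h (frame p i) (frame p j))⁻¹ : Matrix (Fin d) (Fin d) ℝ) a b
    * T (frame p a) (frame p b)

/-- The trace-free part of a `(0,2)` tensor with respect to a metric, at a point. -/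
def traceFree {p : M} (h T : TangentSpace (𝓡 d) p → TangentSpace (𝓡 d) p → ℝ)
    (v w : TangentSpace (𝓡 d) p) : ℝ :=
  T v w - metricTrace h T / d * h v w

end Tensors

/-! ### Metric hypersurface data -/

section Data

variable {d : ℕ} {M : Type*} [TopologicalSpace M] [ChartedSpace (EuclideanSpace ℝ (Fin d)) M]
  [IsManifold (𝓡 d) ∞ M]

/-- The symmetric bilinear form
`A((V, a), (W, b)) = γ(V, W) + a ℓ(W) + b ℓ(V) + a b ℓ²` on `T_p M × ℝ`. -/
def ambientForm {p : M} (γ : TangentSpace (𝓡 d) p →L[ℝ] TangentSpace (𝓡 d) p →L[ℝ] ℝ)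
    (ℓ : TangentSpace (𝓡 d) p →L[ℝ] ℝ) (ℓ2 : ℝ) :
    LinearMap.BilinForm ℝ (TangentSpace (𝓡 d) p × ℝ) :=
  LinearMap.mk₂ ℝ (fun x y ↦ γ x.1 y.1 + x.2 * ℓ y.1 + y.2 * ℓ x.1 + x.2 * y.2 * ℓ2)
    (fun x x' y ↦ by simp; ring) (fun c x y ↦ by simp; ring)
    (fun x y y' ↦ by simp; ring) (fun c x y ↦ by simp; ring)

/-- Metric hypersurface data `{M, γ, ℓ, ℓ⁽²⁾}`. -/
structure MetricHypersurfaceData (d : ℕ) (M : Type*) [TopologicalSpace M]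
    [ChartedSpace (EuclideanSpace ℝ (Fin d)) M] [IsManifold (𝓡 d) ∞ M] where
  γ : TwoTensor d M
  ℓ : OneForm d M
  ℓ2 : ContMDiffMap (𝓡 d) 𝓘(ℝ, ℝ) M ℝ ∞
  symm : ∀ (p : M) (v w : TangentSpace (𝓡 d) p), γ p v w = γ p w v
  nondegenerate : ∀ p : M, (ambientForm (γ p) (ℓ p) (ℓ2 p)).Nondegenerate

namespace MetricHypersurfaceData

variable (D : MetricHypersurfaceData d M)

/-- The index-raising map `(T_p M × ℝ)* → T_p M × ℝ` of the nondegenerate form `A`. -/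
def sharp (p : M) : Module.Dual ℝ (TangentSpace (𝓡 d) p × ℝ) ≃ₗ[ℝ] TangentSpace (𝓡 d) p × ℝ :=
  ((ambientForm (D.γ p) (D.ℓ p) (D.ℓ2 p)).toDual (D.nondegenerate p)).symm

/-- The covector `(α, a)` on `T_p M × ℝ`, which maps `(V, b)` to `α(V) + a b`. -/
def covector {p : M} (α : TangentSpace (𝓡 d) p →ₗ[ℝ] ℝ) (a : ℝ) :
    Module.Dual ℝ (TangentSpace (𝓡 d) p × ℝ) :=
  α.coprod (a • LinearMap.id)

/-- The contravariant tensor `P`: `P(α, β) = A♯((α, 0), (β, 0))`. -/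
def P (p : M) (α β : TangentSpace (𝓡 d) p →ₗ[ℝ] ℝ) : ℝ := covector β 0 (D.sharp p (covector α 0))

/-- The vector field `n`: `n(β) = A♯((0, 1), (β, 0))`. -/
def n (p : M) : TangentSpace (𝓡 d) p := (D.sharp p (covector 0 1)).1

/-- The scalar `n⁽²⁾ = A♯((0, 1), (0, 1))`. -/
def n2 (p : M) : ℝ := (D.sharp p (covector 0 1)).2

/-- Null metric hypersurface data: `n⁽²⁾ = 0`. -/
def IsNull : Prop := ∀ p, D.n2 p = 0

/-- The components `P^{ab}`. -/
def Pc (p : M) (a b : Fin d) : ℝ := D.P p ((frame p).coord a) ((frame p).coord b)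

/-- The trace `tr_P T = P^{ab} T_{ab}`. -/
def trP (T : Π p : M, TangentSpace (𝓡 d) p → TangentSpace (𝓡 d) p → ℝ) (p : M) : ℝ :=
  ∑ a, ∑ b, D.Pc p a b * T p (frame p a) (frame p b)

/-- `U = (1/2) L_n γ`. -/
def U (p : M) (v w : TangentSpace (𝓡 d) p) : ℝ :=
  1 / 2 * lieDeriv D.n (fun q x y ↦ D.γ q x y) p v w

/-- `F = (1/2) dℓ`. -/
def F (p : M) (v w : TangentSpace (𝓡 d) p) : ℝ :=
  1 / 2 * extDeriv (fun q x ↦ D.ℓ q x) p v w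

/-- `s = F(n, ·)`. -/
def s (p : M) (v : TangentSpace (𝓡 d) p) : ℝ := D.F p (D.n p) v

/-- `r = Y(n, ·)`. -/
def r (Y : TwoTensor d M) (p : M) (v : TangentSpace (𝓡 d) p) : ℝ := Y p (D.n p) v

/-- `κ_n = -Y(n, n)`. -/
def κ (Y : TwoTensor d M) (p : M) : ℝ := -Y p (D.n p) (D.n p)

/-! ### The metric connection of the data -/

/-- `(1/2) (X γ(Y, Z) + Y γ(X, Z) - Z γ(X, Y) + γ([X, Y], Z) - γ([X, Z], Y) - γ([Y, Z], X))`. -/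
def koszul (X Y Z : Π p : M, TangentSpace (𝓡 d) p) (p : M) : ℝ :=
  1 / 2 * (dirDeriv (fun q ↦ D.γ q (Y q) (Z q)) p (X p)
    + dirDeriv (fun q ↦ D.γ q (X q) (Z q)) p (Y p)
    - dirDeriv (fun q ↦ D.γ q (X q) (Y q)) p (Z p)
    + D.γ p (bracket X Y p) (Z p) - D.γ p (bracket X Z p) (Y p) - D.γ p (bracket Y Z p) (X p))

/-- `(1/2) (X ℓ(Y) + Y ℓ(X) + ℓ([X, Y]))`. -/
def koszulScalar (X Y : Π p : M, TangentSpace (𝓡 d) p) (p : M) : ℝ :=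
  1 / 2 * (dirDeriv (fun q ↦ D.ℓ q (Y q)) p (X p) + dirDeriv (fun q ↦ D.ℓ q (X q)) p (Y p)
    + D.ℓ p (bracket X Y p))

theorem mdifferentiableAt_γ {p : M} {X Y : Π p : M, TangentSpace (𝓡 d) p}
    (hX : DiffAt X p) (hY : DiffAt Y p) :
    MDifferentiableAt (𝓡 d) 𝓘(ℝ, ℝ) (fun q ↦ D.γ q (X q) (Y q)) p := by
  have : MDifferentiableAt (𝓡 d) ((𝓡 d).prod 𝓘(ℝ, ℝ))
      (fun m ↦ Bundle.TotalSpace.mk' ℝ (E := Bundle.Trivial M ℝ) m (D.γ m (X m) (Y m))) p := by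
    apply MDifferentiableAt.clm_bundle_apply₂ (F₁ := EuclideanSpace ℝ (Fin d))
      (F₂ := EuclideanSpace ℝ (Fin d))
    · exact D.γ.contMDiff.mdifferentiableAt (by simp)
    · exact hX
    · exact hY
  simp only [mdifferentiableAt_totalSpace] at this
  exact this.2

theorem mdifferentiableAt_ℓ {p : M} {X : Π p : M, TangentSpace (𝓡 d) p}
    (hX : DiffAt X p) : MDifferentiableAt (𝓡 d) 𝓘(ℝ, ℝ) (fun q ↦ D.ℓ q (X q)) p := by
  have : MDifferentiableAt (𝓡 d) ((𝓡 d).prod 𝓘(ℝ, ℝ))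
      (fun m ↦ Bundle.TotalSpace.mk' ℝ (E := Bundle.Trivial M ℝ) m (D.ℓ m (X m))) p := by
    apply MDifferentiableAt.clm_bundle_apply (F₁ := EuclideanSpace ℝ (Fin d))
    · exact D.ℓ.contMDiff.mdifferentiableAt (by simp)
    · exact hX
  simp only [mdifferentiableAt_totalSpace] at this
  exact this.2

theorem koszul_tensorial₁ {p : M} {Y Z : Π p : M, TangentSpace (𝓡 d) p}
    (hY : DiffAt Y p) (hZ : DiffAt Z p) :
    TensorialAt (𝓡 d) (EuclideanSpace ℝ (Fin d)) (fun X ↦ D.koszul X Y Z p) p where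
  smul {f X} hf hX := by
    have h1 := mvfderiv_fun_mul hf (D.mdifferentiableAt_γ hX hZ)
    have h2 := mvfderiv_fun_mul hf (D.mdifferentiableAt_γ hX hY)
    simp [koszul, dirDeriv, bracket, h1, h2, VectorField.mlieBracket_smul_left hf hX]
    ring
  add {X X'} hX hX' := by
    have h1 := mvfderiv_fun_add (D.mdifferentiableAt_γ hX hZ) (D.mdifferentiableAt_γ hX' hZ)
    have h2 := mvfderiv_fun_add (D.mdifferentiableAt_γ hX hY) (D.mdifferentiableAt_γ hX' hY)
    simp [koszul, dirDeriv, bracket, h1, h2, VectorField.mlieBracket_add_left hX hX']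
    ring

theorem koszul_tensorial₂ {p : M} {X Y : Π p : M, TangentSpace (𝓡 d) p}
    (hX : DiffAt X p) (hY : DiffAt Y p) :
    TensorialAt (𝓡 d) (EuclideanSpace ℝ (Fin d)) (fun Z ↦ D.koszul X Y Z p) p where
  smul {f Z} hf hZ := by
    have h1 := mvfderiv_fun_mul hf (D.mdifferentiableAt_γ hY hZ)
    have h2 := mvfderiv_fun_mul hf (D.mdifferentiableAt_γ hX hZ)
    simp [koszul, dirDeriv, bracket, h1, h2, VectorField.mlieBracket_smul_right hf hZ]
    rw [D.symm p (Z p) (Y p), D.symm p (Z p) (X p)]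
    ring
  add {Z Z'} hZ hZ' := by
    have h1 := mvfderiv_fun_add (D.mdifferentiableAt_γ hY hZ) (D.mdifferentiableAt_γ hY hZ')
    have h2 := mvfderiv_fun_add (D.mdifferentiableAt_γ hX hZ) (D.mdifferentiableAt_γ hX hZ')
    simp [koszul, dirDeriv, bracket, h1, h2, VectorField.mlieBracket_add_right hZ hZ']
    ring

theorem koszulScalar_tensorial (p : M) (Y : Π p : M, TangentSpace (𝓡 d) p) :
    TensorialAt (𝓡 d) (EuclideanSpace ℝ (Fin d)) (fun X ↦ D.koszulScalar X Y p) p where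
  smul {f X} hf hX := by
    have h1 := mvfderiv_fun_mul hf (D.mdifferentiableAt_ℓ hX)
    simp [koszulScalar, dirDeriv, bracket, h1, VectorField.mlieBracket_smul_left hf hX]
    ring
  add {X X'} hX hX' := by
    have h1 := mvfderiv_fun_add (D.mdifferentiableAt_ℓ hX) (D.mdifferentiableAt_ℓ hX')
    simp [koszulScalar, dirDeriv, bracket, h1, VectorField.mlieBracket_add_left hX hX']
    ring

/-- The tensor `(X, Z) ↦ koszul X Y Z` at `p`, for a fixed vector field `Y`. -/
def koszulForm (Y : Π p : M, TangentSpace (𝓡 d) p) (p : M) (hY : DiffAt Y p) :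
    TangentSpace (𝓡 d) p →L[ℝ] TangentSpace (𝓡 d) p →L[ℝ] ℝ :=
  TensorialAt.mkHom₂ (fun X Z ↦ D.koszul X Y Z p) p
    (fun _ hZ ↦ D.koszul_tensorial₁ hY hZ) (fun _ hX ↦ D.koszul_tensorial₂ hX hY)

/-- The covector `X ↦ koszulScalar X Y` at `p`, for a fixed vector field `Y`. -/
def koszulCovector (Y : Π p : M, TangentSpace (𝓡 d) p) (p : M) :
    TangentSpace (𝓡 d) p →L[ℝ] ℝ :=
  TensorialAt.mkHom (fun X ↦ D.koszulScalar X Y p) p (D.koszulScalar_tensorial p Y)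

theorem koszulForm_apply {p : M} {X Y Z : Π p : M, TangentSpace (𝓡 d) p} (hX : DiffAt X p)
    (hY : DiffAt Y p) (hZ : DiffAt Z p) :
    D.koszulForm Y p hY (X p) (Z p) = D.koszul X Y Z p :=
  TensorialAt.mkHom₂_apply (fun _ hZ ↦ D.koszul_tensorial₁ hY hZ)
    (fun _ hX ↦ D.koszul_tensorial₂ hX hY) hX hZ

theorem koszulCovector_apply {p : M} {X : Π p : M, TangentSpace (𝓡 d) p}
    (Y : Π p : M, TangentSpace (𝓡 d) p) (hX : DiffAt X p) :
    D.koszulCovector Y p (X p) = D.koszulScalar X Y p :=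
  TensorialAt.mkHom_apply (D.koszulScalar_tensorial p Y) hX

/-- The linear map `X ↦ A♯(koszul X Y, koszulScalar X Y)`. -/
def koszulSharp (Y : Π p : M, TangentSpace (𝓡 d) p) (p : M) (hY : DiffAt Y p) :
    TangentSpace (𝓡 d) p →ₗ[ℝ] TangentSpace (𝓡 d) p × ℝ where
  toFun v := D.sharp p (covector (D.koszulForm Y p hY v).toLinearMap (D.koszulCovector Y p v))
  map_add' v w := by
    rw [← map_add]
    congr 1
    ext <;> simp [covector]
  map_smul' c v := by
    rw [RingHom.id_apply, ← map_smul]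
    congr 1
    ext <;> simp [covector]

theorem ambientForm_koszulSharp {p : M} {X Y Z : Π p : M, TangentSpace (𝓡 d) p}
    (hX : DiffAt X p) (hY : DiffAt Y p) (hZ : DiffAt Z p) (b : ℝ) :
    ambientForm (D.γ p) (D.ℓ p) (D.ℓ2 p) (D.koszulSharp Y p hY (X p)) (Z p, b)
      = D.koszul X Y Z p + b * D.koszulScalar X Y p := by
  refine (LinearMap.BilinForm.apply_toDual_symm_apply
    (hB := D.nondegenerate p) _ _).trans ?_
  simp [covector, D.koszulForm_apply hX hY hZ, D.koszulCovector_apply Y hX, mul_comm]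

theorem diffAt_ext {p : M} (v : TangentSpace (𝓡 d) p) : DiffAt (ext v) p :=
  FiberBundle.mdifferentiableAt_extend ..

theorem ext_self {p : M} (v : TangentSpace (𝓡 d) p) : ext v p = v := by
  simp [ext]

theorem ambientForm_koszulSharp' {p : M} {Y : Π p : M, TangentSpace (𝓡 d) p}
    (hY : DiffAt Y p) (v w : TangentSpace (𝓡 d) p) (b : ℝ) :
    ambientForm (D.γ p) (D.ℓ p) (D.ℓ2 p) (D.koszulSharp Y p hY v) (w, b)
      = D.koszul (ext v) Y (ext w) p + b * D.koszulScalar (ext v) Y p := by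
  have h := D.ambientForm_koszulSharp (diffAt_ext v) hY (diffAt_ext w) b
  rwa [ext_self, ext_self] at h

theorem ambientForm_injective {p : M} {x x' : TangentSpace (𝓡 d) p × ℝ}
    (h : ∀ w b, ambientForm (D.γ p) (D.ℓ p) (D.ℓ2 p) x (w, b)
      = ambientForm (D.γ p) (D.ℓ p) (D.ℓ2 p) x' (w, b)) : x = x' := by
  rw [← sub_eq_zero]
  refine (D.nondegenerate p).1 _ fun y ↦ ?_
  rw [map_sub, LinearMap.sub_apply, sub_eq_zero]
  exact h y.1 y.2

theorem koszulSharp_add {p : M} {Y Y' : Π p : M, TangentSpace (𝓡 d) p} (hY : DiffAt Y p)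
    (hY' : DiffAt Y' p) (hS : DiffAt (Y + Y') p) (v : TangentSpace (𝓡 d) p) :
    D.koszulSharp (Y + Y') p hS v = D.koszulSharp Y p hY v + D.koszulSharp Y' p hY' v := by
  refine D.ambientForm_injective fun w b ↦ ?_
  have hv := diffAt_ext v
  have hw := diffAt_ext w
  have h1 := mvfderiv_fun_add (D.mdifferentiableAt_γ hY hw) (D.mdifferentiableAt_γ hY' hw)
  have h2 := mvfderiv_fun_add (D.mdifferentiableAt_γ hv hY) (D.mdifferentiableAt_γ hv hY')
  have h3 := mvfderiv_fun_add (D.mdifferentiableAt_ℓ hY) (D.mdifferentiableAt_ℓ hY')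
  rw [map_add, LinearMap.add_apply, D.ambientForm_koszulSharp', D.ambientForm_koszulSharp',
    D.ambientForm_koszulSharp']
  simp [koszul, koszulScalar, dirDeriv, bracket, h1, h2, h3,
    VectorField.mlieBracket_add_left hY hY', VectorField.mlieBracket_add_right hY hY']
  ring

theorem koszulSharp_smul {p : M} {Y : Π p : M, TangentSpace (𝓡 d) p} {u : M → ℝ}
    (hY : DiffAt Y p) (hu : MDifferentiableAt (𝓡 d) 𝓘(ℝ, ℝ) u p) (hS : DiffAt (u • Y) p)
    (v : TangentSpace (𝓡 d) p) :
    D.koszulSharp (u • Y) p hS v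
      = u p • D.koszulSharp Y p hY v + dirDeriv u p v • (Y p, (0 : ℝ)) := by
  refine D.ambientForm_injective fun w b ↦ ?_
  have hv := diffAt_ext v
  have hw := diffAt_ext w
  have h1 := mvfderiv_fun_mul hu (D.mdifferentiableAt_γ hY hw)
  have h2 := mvfderiv_fun_mul hu (D.mdifferentiableAt_γ hv hY)
  have h3 := mvfderiv_fun_mul hu (D.mdifferentiableAt_ℓ hY)
  rw [map_add, LinearMap.add_apply, map_smul, map_smul, LinearMap.smul_apply, LinearMap.smul_apply,
    D.ambientForm_koszulSharp', D.ambientForm_koszulSharp']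
  simp [koszul, koszulScalar, dirDeriv, bracket, h1, h2, h3, ext_self, ambientForm,
    VectorField.mlieBracket_smul_left hu hY, VectorField.mlieBracket_smul_right hu hY]
  rw [D.symm p v (Y p)]
  ring

open Classical in
/-- The connection of the data, where `(∇_X Y, *) = A♯(koszul X Y, koszulScalar X Y)`. For null data
it is the unique torsion-free connection with `∇_a γ_{bc} = -ℓ_c U_{ab} - ℓ_b U_{ac}` and
`∇_a ℓ_b = F_{ab} - ℓ⁽²⁾ U_{ab}`. (On vector fields which are not differentiable at a point
it takes the value zero there.) -/
def connection : CovariantDerivative (𝓡 d) (EuclideanSpace ℝ (Fin d))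
    (fun p : M ↦ TangentSpace (𝓡 d) p) where
  toFun Y p := if hY : DiffAt Y p then
      (LinearMap.fst ℝ _ _ ∘ₗ D.koszulSharp Y p hY).toContinuousLinearMap
    else 0
  isCovariantDerivativeOnUniv :=
    { add := by
        intro Y Y' p hY hY' _
        have hS : DiffAt (Y + Y') p := mdifferentiableAt_add_section hY hY'
        rw [dif_pos hY, dif_pos hY', dif_pos hS]
        ext1 v
        exact congrArg Prod.fst (D.koszulSharp_add hY hY' hS v)
      leibniz := by
        intro Y u p hY hu _
        have hS : DiffAt (u • Y) p := hu.smul_section hY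
        rw [dif_pos hY, dif_pos hS]
        ext1 v
        exact congrArg Prod.fst (D.koszulSharp_smul hY hu hS v) }

theorem connection_apply {p : M} {Y : Π p : M, TangentSpace (𝓡 d) p} (hY : DiffAt Y p)
    (v : TangentSpace (𝓡 d) p) : D.connection Y p v = (D.koszulSharp Y p hY v).1 := by
  simp [connection, hY]

theorem γ_n (hD : D.IsNull) (p : M) (v : TangentSpace (𝓡 d) p) : D.γ p v (D.n p) = 0 := by
  have h : ambientForm (D.γ p) (D.ℓ p) (D.ℓ2 p) (D.sharp p (covector 0 1)) (v, 0)
      = covector (p := p) 0 1 (v, 0) :=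
    LinearMap.BilinForm.apply_toDual_symm_apply (hB := D.nondegenerate p) _ _
  have h2 : (D.sharp p (covector 0 1)).2 = 0 := hD p
  rw [D.symm]
  simp only [ambientForm, LinearMap.mk₂_apply, h2] at h
  simpa [covector, n] using h

theorem koszulSharp_snd (hD : D.IsNull) {p : M} (hn : DiffAt D.n p)
    (v w : TangentSpace (𝓡 d) p) :
    (D.koszulSharp (ext w) p (diffAt_ext w) v).2 = -D.U p v w := by
  have h := LinearMap.BilinForm.apply_toDual_symm_apply
    (hB := D.nondegenerate p) (covector 0 1) (D.koszulSharp (ext w) p (diffAt_ext w) v)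
  have hs : (D.sharp p (covector 0 1)).2 = 0 := hD p
  have h' := D.ambientForm_koszulSharp (diffAt_ext v) (diffAt_ext w) hn 0
  rw [ext_self] at h'
  have e : (D.koszulSharp (ext w) p (diffAt_ext w) v).2 = D.koszul (ext v) (ext w) D.n p := by
    have : ambientForm (D.γ p) (D.ℓ p) (D.ℓ2 p) (D.sharp p (covector 0 1))
        (D.koszulSharp (ext w) p (diffAt_ext w) v)
      = ambientForm (D.γ p) (D.ℓ p) (D.ℓ2 p) (D.koszulSharp (ext w) p (diffAt_ext w) v)
        (D.n p, 0) := by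
      simp only [ambientForm, LinearMap.mk₂_apply, n, hs]
      rw [D.symm]
      ring
    rw [h', zero_mul, add_zero] at this
    rw [← this]
    refine Eq.trans ?_ h.symm
    simp [covector]
  rw [e]
  simp [koszul, U, lieDeriv, D.γ_n hD, dirDeriv, ext_self, bracket,
    VectorField.mlieBracket_swap_apply (V := D.n), mvfderiv_const]
  rw [D.symm p v]
  ring

/-- The connection is torsion-free. -/
theorem connection_torsion (p : M) (v w : TangentSpace (𝓡 d) p) :
    D.connection (ext w) p v - D.connection (ext v) p w = bracket (ext v) (ext w) p := by
  rw [D.connection_apply (diffAt_ext w), D.connection_apply (diffAt_ext v)]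
  have : D.koszulSharp (ext w) p (diffAt_ext w) v - D.koszulSharp (ext v) p (diffAt_ext v) w
      = (bracket (ext v) (ext w) p, (0 : ℝ)) := by
    refine D.ambientForm_injective fun z b ↦ ?_
    have hγ (q : M) : D.γ q (ext w q) (ext v q) = D.γ q (ext v q) (ext w q) := D.symm _ _ _
    rw [map_sub, LinearMap.sub_apply, D.ambientForm_koszulSharp', D.ambientForm_koszulSharp']
    simp [koszul, koszulScalar, ambientForm, bracket, ext_self, hγ,
      VectorField.mlieBracket_swap_apply (V := ext w) (W := ext v)]
    ring
  exact congrArg Prod.fst this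

/-- `∇_a γ_{bc} = -ℓ_c U_{ab} - ℓ_b U_{ac}`. -/
theorem connection_γ (hD : D.IsNull) {p : M} (hn : DiffAt D.n p)
    (v w z : TangentSpace (𝓡 d) p) :
    dirDeriv (fun q ↦ D.γ q (ext w q) (ext z q)) p v
      - D.γ p (D.connection (ext w) p v) z - D.γ p w (D.connection (ext z) p v)
      = -D.ℓ p z * D.U p v w - D.ℓ p w * D.U p v z := by
  rw [D.connection_apply (diffAt_ext w), D.connection_apply (diffAt_ext z)]
  have h1 := D.ambientForm_koszulSharp' (diffAt_ext w) v z 0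
  have h2 := D.ambientForm_koszulSharp' (diffAt_ext z) v w 0
  simp only [ambientForm, LinearMap.mk₂_apply, D.koszulSharp_snd hD hn] at h1 h2
  have hγ (q : M) : D.γ q (ext z q) (ext w q) = D.γ q (ext w q) (ext z q) := D.symm _ _ _
  simp [koszul, ext_self, hγ, bracket,
    VectorField.mlieBracket_swap_apply (V := ext z) (W := ext w)] at h1 h2
  rw [D.symm p w]
  linear_combination -h1 - h2

/-- `∇_a ℓ_b = F_{ab} - ℓ⁽²⁾ U_{ab}`. -/
theorem connection_ℓ (hD : D.IsNull) {p : M} (hn : DiffAt D.n p) (v w : TangentSpace (𝓡 d) p) :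
    covDeriv D.connection (fun q x ↦ D.ℓ q x) p v w = D.F p v w - D.ℓ2 p * D.U p v w := by
  have h1 := D.ambientForm_koszulSharp' (diffAt_ext w) v 0 1
  have h0 := D.ambientForm_koszulSharp' (diffAt_ext w) v 0 0
  simp only [ambientForm, LinearMap.mk₂_apply, D.koszulSharp_snd hD hn] at h1 h0
  simp only [map_zero, mul_zero, zero_mul, add_zero, one_mul, mul_one, zero_add] at h1 h0
  rw [covDeriv, D.connection_apply (diffAt_ext w), F, extDeriv]
  rw [← h0, koszulScalar, ext_self, ext_self] at h1
  linear_combination -h1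

/-! ### The constraint tensor -/

/-- The constraint tensor
`R_{ab} = R°_{(ab)} - 2 L_n Y_{ab} - (2 κ_n + tr_P U) Y_{ab} + ∇_{(a}(s_{b)} + 2 r_{b)})
  - 2 r_a r_b + 4 r_{(a} s_{b)} - s_a s_b - (tr_P Y) U_{ab} + 2 P^{cd} U_{d(a}(2 Y_{b)c} + F_{b)c})`,
where indices in parentheses are symmetrized, `T_{(ab)} = (T_{ab} + T_{ba}) / 2`. -/
def constraintTensor (Y : TwoTensor d M) (p : M) (v w : TangentSpace (𝓡 d) p) : ℝ :=
  (ricci D.connection p v w + ricci D.connection p w v) / 2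
    - 2 * lieDeriv D.n (fun q x y ↦ Y q x y) p v w
    - (2 * D.κ Y p + D.trP D.U p) * Y p v w
    + (covDeriv D.connection (fun q x ↦ D.s q x + 2 * D.r Y q x) p v w
      + covDeriv D.connection (fun q x ↦ D.s q x + 2 * D.r Y q x) p w v) / 2
    - 2 * D.r Y p v * D.r Y p w
    + 2 * (D.r Y p v * D.s p w + D.r Y p w * D.s p v)
    - D.s p v * D.s p w
    - D.trP (fun q x y ↦ Y q x y) p * D.U p v w
    + ∑ c, ∑ e, D.Pc p c e * (D.U p (frame p e) v * (2 * Y p w (frame p c) + D.F p w (frame p c))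
      + D.U p (frame p e) w * (2 * Y p v (frame p c) + D.F p v (frame p c)))

/-- `-n(tr_P U) + (tr_P U) f - P^{ab} P^{cd} U_{ac} U_{bd} = 0`. -/
def RaychaudhuriEq (f : M → ℝ) : Prop :=
  ∀ p, -dirDeriv (D.trP D.U) p (D.n p) + D.trP D.U p * f p
    - ∑ a, ∑ b, ∑ c, ∑ e, D.Pc p a b * D.Pc p c e
      * D.U p (frame p a) (frame p c) * D.U p (frame p b) (frame p e) = 0

end MetricHypersurfaceData

/-! ### Cross-sections -/

/-- A cross-section: an embedded hypersurface which every integral curve of `n` meets exactly once,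
that is, through every point there is an integral curve which meets the hypersurface, and
no integral curve meets the hypersurface at two distinct parameter values. -/
structure IsCrossSection {m : ℕ} {M : Type*} [TopologicalSpace M]
    [ChartedSpace (EuclideanSpace ℝ (Fin (m + 1))) M] {S : Type*} [TopologicalSpace S]
    [ChartedSpace (EuclideanSpace ℝ (Fin m)) S]
    (n : Π p : M, TangentSpace (𝓡 (m + 1)) p) (ι : S → M) : Prop where
  isSmoothEmbedding : Manifold.IsSmoothEmbedding (𝓡 m) (𝓡 (m + 1)) ∞ ι
  meets : ∀ p : M, ∃ (a b : ℝ) (c : ℝ → M), a < 0 ∧ 0 < b ∧ c 0 = p ∧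
    IsMIntegralCurveOn (I := 𝓡 (m + 1)) c n (Set.Ioo a b) ∧ ∃ t ∈ Set.Ioo a b, c t ∈ Set.range ι
  meets_once : ∀ (a b : ℝ) (c : ℝ → M), IsMIntegralCurveOn (I := 𝓡 (m + 1)) c n (Set.Ioo a b) →
    ∀ t ∈ Set.Ioo a b, ∀ t' ∈ Set.Ioo a b, c t ∈ Set.range ι → c t' ∈ Set.range ι → t = t'

/-- The pullback `ι^* T` of a `(0,2)` tensor field. -/
def pullback {d m : ℕ} {M : Type*} [TopologicalSpace M] [ChartedSpace (EuclideanSpace ℝ (Fin d)) M]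
    [IsManifold (𝓡 d) ∞ M] {S : Type*} [TopologicalSpace S]
    [ChartedSpace (EuclideanSpace ℝ (Fin m)) S] (ι : S → M) (T : TwoTensor d M) (x : S)
    (v w : TangentSpace (𝓡 m) x) : ℝ :=
  T (ι x) (mfderiv (𝓡 m) (𝓡 d) ι x v) (mfderiv (𝓡 m) (𝓡 d) ι x w)

end Data

end NullData

end

open Set Filter Topology

set_option linter.unusedSectionVars false

/-! For a given field `n`, the equation `𝓡 = λγ` is a transport equation for `Y` along the integral
curves of `n`: apart from derivatives of `r = Y(n,·)`, the only derivative of `Y` in it is `L_n Y`,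
and it becomes linear in `Y` once `r` and `κ_n` are regarded as known. The proof rests on the fact
that these two quantities decouple from the rest of `Y`.

Contract the equation with `n`. Since `γ(n,·) = 0` and `U(n,·) = 0`, everything that involves more
of `Y` than `r` drops out, the terms `2fr` and `2r∘U♯` cancel, and what remains is `L_n r = -(tr_P
U) r + b` with `b` built from the data and `f` alone (`constraintTensor_eq`, `source_n`,
`lieOne_contract_of_constraintTensor`). Contract once more. By the Raychaudhuri identity
`ricci_n_n`, the hypothesis on `f` says exactly that `ρ = r(n) + f` obeys `n(ρ) = -(tr_P U) ρ`.
Hence the condition `κ_n = f` is preserved along `n` and need only hold on the cross-section.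

For existence, solve the equation for `r`; then solve the linear equation for `Y` in which `κ_n` and
`r` are replaced by `f` and by this solution. Two consistency checks remain, both by uniqueness for
linear equations: `Y` is symmetric because its transpose solves the same problem (`evolution_symm`),
and `Y(n,·) = r` because both solve the same equation for one-forms (`contract_evolution`). For
uniqueness, the same hierarchy is read in order: first the one-forms `r` agree, hence the sources,
hence the tensors.

On the cross-section the prescribed quantities amount to the full value of `Y`. Non-degeneracy of
`h` makes `n` transversal, so the tangent space splits as the line of `n` plus the tangent space of
the section; `f` and `β` give the components with an index `n`, the trace-free part gives the
tangential ones up to a multiple of `γ`, and the multiple is fixed by the trace because `tr_P γ = d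
- 1` is nonzero (`IsInitial.eq`, `isInitial_add_smul_γ`).

Linear transport equations are solved globally without a global flow. In a flow box, variation of
constants turns solutions into functions constant along the field (`IsLinearTransport.isTransport`).
Local solutions are glued over open sets whose points are joined to the section inside the set; they
agree on overlaps because a curve meets the section only once, they extend through flow boxes, and
connectedness of the curves gives all of `H` (`IsTransport.exists_solution`). The smooth flow boxes
come from the inverse function theorem on a space of continuous curves (`exists_contDiffAt_flow`).
-/

namespace NullData

/-! ### Superposition operators on spaces of continuous maps. -/

section Superposition

variable {X : Type*} [TopologicalSpace X] [CompactSpace X]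

/-- Pointwise evaluation of a continuous family of operators, as a bounded bilinear map. -/
noncomputable def pointwiseApply (X : Type*) [TopologicalSpace X] [CompactSpace X]
    (E F : Type*) [NormedAddCommGroup E] [NormedSpace ℝ E] [NormedAddCommGroup F]
    [NormedSpace ℝ F] : C(X, E →L[ℝ] F) →L[ℝ] C(X, E) →L[ℝ] C(X, F) :=
  LinearMap.mkContinuous₂
    (LinearMap.mk₂ ℝ (fun (A : C(X, E →L[ℝ] F)) (h : C(X, E)) ↦
        (⟨fun x ↦ A x (h x), A.continuous.clm_apply h.continuous⟩ : C(X, F)))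
      (fun _ _ _ ↦ by ext; simp) (fun _ _ _ ↦ by ext; simp)
      (fun _ _ _ ↦ by ext; simp) (fun _ _ _ ↦ by ext; simp)) 1 (fun A h ↦ by
    rw [one_mul]
    refine (ContinuousMap.norm_le _ (by positivity)).2 fun x ↦ ?_
    exact (A x).le_of_opNorm_le_of_le (A.norm_coe_le_norm x) (h.norm_coe_le_norm x))

@[simp] theorem pointwiseApply_apply {E F : Type*} [NormedAddCommGroup E] [NormedSpace ℝ E]
    [NormedAddCommGroup F] [NormedSpace ℝ F] (A : C(X, E →L[ℝ] F)) (h : C(X, E)) (x : X) :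
    pointwiseApply X E F A h x = A x (h x) := rfl

/-- Composition with `f'` is continuous for the sup norm, so one `δ` serves all points of `X`; the
mean value inequality near `u x` then bounds the remainder uniformly in `x`. -/
theorem hasFDerivAt_superposition {E F : Type*} [NormedAddCommGroup E] [NormedSpace ℝ E]
    [NormedAddCommGroup F] [NormedSpace ℝ F] (f : C(E, F)) (f' : C(E, E →L[ℝ] F))
    (hf : ∀ x, HasFDerivAt f (f' x) x) (u : C(X, E)) :
    HasFDerivAt (fun u : C(X, E) ↦ f.comp u) (pointwiseApply X E F (f'.comp u)) u := by
  rw [hasFDerivAt_iff_isLittleO_nhds_zero, Asymptotics.isLittleO_iff]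
  intro c hc
  have hcont : Continuous fun u : C(X, E) ↦ f'.comp u := ContinuousMap.continuous_postcomp f'
  obtain ⟨δ, hδ, h⟩ := (Metric.continuousAt_iff (α := C(X, E)) (β := C(X, E →L[ℝ] F))).1
    (hcont.continuousAt (x := u)) c hc
  filter_upwards [Metric.ball_mem_nhds (0 : C(X, E)) hδ] with k hk
  refine (ContinuousMap.norm_le _ (by positivity)).2 fun x ↦ ?_
  have hkx : ‖k x‖ ≤ ‖k‖ := k.norm_coe_le_norm x
  rw [mem_ball_zero_iff] at hk
  have key : ‖f (u x + k x) - f (u x) - f' (u x) (u x + k x - u x)‖ ≤ c * ‖u x + k x - u x‖ := by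
    refine Convex.norm_image_sub_le_of_norm_hasFDerivWithin_le' (s := Metric.ball (u x) δ)
      (fun y _ ↦ (hf y).hasFDerivWithinAt) (fun y hy ↦ ?_) (convex_ball _ _)
      (Metric.mem_ball_self hδ) ?_
    -- Shifting `u` by a constant map reaches the arbitrary point `y` near `u x`, so the sup-norm
    -- estimate yields the bound for `f' y - f' (u x)`.
    · have hy' : dist (u + ContinuousMap.const X (y - u x)) u < δ := by
        rw [dist_eq_norm, add_sub_cancel_left]
        refine lt_of_le_of_lt ((ContinuousMap.norm_le _ (norm_nonneg (y - u x))).2 fun _ ↦ le_rfl) ?_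
        rwa [← dist_eq_norm]
      have h2 := (ContinuousMap.dist_le hc.le).1 (h hy').le x
      simpa [dist_eq_norm] using h2
    · simpa [Metric.mem_ball, dist_eq_norm] using hkx.trans_lt hk
  simp only [add_sub_cancel_left] at key
  simpa using key.trans (by gcongr)

/-- The superposition operator of a smooth function is smooth. -/
theorem contDiff_superposition {E : Type u} [NormedAddCommGroup E] [NormedSpace ℝ E] (n : ℕ) :
    ∀ {F : Type u} [NormedAddCommGroup F] [NormedSpace ℝ F] (f : C(E, F)), ContDiff ℝ ∞ f →
      ContDiff ℝ n (fun u : C(X, E) ↦ f.comp u) := by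
  -- The derivative at `u` is pointwise application of `f' ∘ u`, a bounded linear map after another
  -- superposition operator, so each step gains one derivative. The target changes from `F` to `E
  -- →L[ℝ] F`, hence the generalisation over `F` and the common universe.
  induction n with
  | zero =>
    intro F _ _ f _
    exact contDiff_zero.2 (ContinuousMap.continuous_postcomp f)
  | succ n ih =>
    intro F _ _ f hf
    have hf' : ContDiff ℝ ∞ (fderiv ℝ f) := hf.fderiv_right (by simp)
    rw [Nat.cast_add, Nat.cast_one, contDiff_succ_iff_hasFDerivAt]
    have hL : ContDiff ℝ n (pointwiseApply X E F) :=
      ContinuousLinearMap.contDiff (E := C(X, E →L[ℝ] F)) (F := C(X, E) →L[ℝ] C(X, F)) _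
    refine ⟨fun u ↦ pointwiseApply X E F ((⟨fderiv ℝ f, hf'.continuous⟩ : C(E, _)).comp u),
      hL.comp (ih ⟨fderiv ℝ f, hf'.continuous⟩ hf'), fun u ↦ ?_⟩
    exact hasFDerivAt_superposition f ⟨fderiv ℝ f, hf'.continuous⟩
      (fun x ↦ (hf.differentiable (by simp) x).hasFDerivAt) u

end Superposition

/-! ### The inverse function theorem, with smoothness on the whole target. -/

section InverseFunction

/-- The inverse function theorem with a smooth inverse on an open set. -/
theorem exists_openPartialHomeomorph_contDiffOn {E F : Type*} [NormedAddCommGroup E]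
    [NormedSpace ℝ E] [CompleteSpace E] [NormedAddCommGroup F] [NormedSpace ℝ F]
    {f : E → F} {O : Set E} {a : E} (hO : O ∈ 𝓝 a) (hf : ∀ x ∈ O, ContDiffAt ℝ ∞ f x)
    (f' : E ≃L[ℝ] F) (hf' : HasFDerivAt f (f' : E →L[ℝ] F) a) :
    ∃ e : OpenPartialHomeomorph E F, a ∈ e.source ∧ e.source ⊆ O ∧ (∀ x, e x = f x) ∧
      ∀ y ∈ e.target, ContDiffAt ℝ ∞ e.symm y := by
  have ha := hf a (mem_of_mem_nhds hO)
  have hs : HasStrictFDerivAt f (f' : E →L[ℝ] F) a := by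
    have := ha.hasStrictFDerivAt (by simp)
    rwa [hf'.fderiv] at this
  let e₀ := hs.toOpenPartialHomeomorph f
  have hc : ContinuousAt (fderiv ℝ f) a := (ha.fderiv_right (m := ∞) (by simp)).continuousAt
  -- Invertible operators form an open set, so the derivative stays invertible near `a`; this gives
  -- a smooth inverse at every point of the target and not only at `f a`.
  have hnhds : ∀ᶠ x in 𝓝 a, x ∈ O ∧
      fderiv ℝ f x ∈ range (ContinuousLinearEquiv.toContinuousLinearMap : (E ≃L[ℝ] F) → _) := by
    refine Filter.Eventually.and hO ?_
    exact hc.eventually_mem (ContinuousLinearEquiv.isOpen.mem_nhds ⟨f', hf'.fderiv.symm⟩)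
  obtain ⟨W, hW, hWo, haW⟩ := eventually_nhds_iff.1 hnhds
  refine ⟨e₀.restrOpen W hWo, ⟨hs.mem_toOpenPartialHomeomorph_source, haW⟩,
    fun x hx ↦ (hW x hx.2).1, fun x ↦ rfl, fun y hy ↦ ?_⟩
  have hy' : e₀.symm y ∈ W := by
    have := (e₀.restrOpen W hWo).map_target hy
    exact this.2
  obtain ⟨g, hg⟩ := (hW _ hy').2
  have hd := hf _ (hW _ hy').1
  refine (e₀.restrOpen W hWo).contDiffAt_symm (f₀' := g) hy ?_ hd
  rw [hg]
  exact (hd.differentiableAt (by simp)).hasFDerivAt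

end InverseFunction

/-! ### Smooth dependence of local flows on initial values. -/

section Flow

variable {E : Type u} [NormedAddCommGroup E] [NormedSpace ℝ E] [CompleteSpace E]

/-- The operator `u ↦ (t ↦ ∫₀ᵗ u)` on `C([0, 1], E)`. -/
noncomputable def primitiveCLM (E : Type*) [NormedAddCommGroup E] [NormedSpace ℝ E]
    [CompleteSpace E] : C(Icc (0 : ℝ) 1, E) →L[ℝ] C(Icc (0 : ℝ) 1, E) :=
  LinearMap.mkContinuous
    { toFun := fun u ↦ ⟨fun t ↦ ∫ s in (0 : ℝ)..t, IccExtend zero_le_one u s,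
        (intervalIntegral.continuous_primitive
          (fun _ _ ↦ (u.continuous.Icc_extend').intervalIntegrable _ _) 0).comp
          continuous_subtype_val⟩
      map_add' := fun u v ↦ by
        ext t
        exact intervalIntegral.integral_add (u.continuous.Icc_extend'.intervalIntegrable _ _)
          (v.continuous.Icc_extend'.intervalIntegrable _ _)
      map_smul' := fun c u ↦ by
        ext t
        exact intervalIntegral.integral_smul c _ } 1 (fun u ↦ by
    rw [one_mul]
    refine (ContinuousMap.norm_le _ (norm_nonneg _)).2 fun t ↦ ?_
    have := intervalIntegral.norm_integral_le_of_norm_le_const (a := 0) (b := (t : ℝ))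
      (f := IccExtend zero_le_one u) (C := ‖u‖) (fun s _ ↦ u.norm_coe_le_norm _)
    refine this.trans (mul_le_of_le_one_right (norm_nonneg _) ?_)
    rw [sub_zero, abs_of_nonneg t.2.1]
    exact t.2.2)

/-- A globally Lipschitz smooth vector field has a smooth local flow. -/
theorem exists_contDiffAt_flow {f : E → E} (hf : ContDiff ℝ ∞ f) {K : NNReal}
    (hK : LipschitzWith K f) (x₀ : E) :
    ∃ ε > 0, ∃ V ∈ 𝓝 x₀, ∃ φ : ℝ × E → E, (∀ x ∈ V, φ (0, x) = x) ∧
      (∀ s ∈ Ioo (-ε) ε, ∀ x ∈ V, ContDiffAt ℝ ∞ φ (s, x)) ∧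
      ∀ x ∈ V, ∀ s ∈ Ioo (-ε) ε, HasDerivAt (fun s ↦ φ (s, x)) (f (φ (s, x))) s := by
  let J := primitiveCLM E
  let fc : C(E, E) := ⟨f, hf.continuous⟩
  let k : E →L[ℝ] C(Icc (0 : ℝ) 1, E) := ContinuousLinearMap.const ℝ (Icc (0 : ℝ) 1)
  let N : (ℝ × E) × C(Icc (0 : ℝ) 1, E) → C(Icc (0 : ℝ) 1, E) := fun p ↦
    J (fc.comp (k p.1.2 + p.2))
  -- With time rescaled to `[0, 1]`, the flow for time `s` from `x` is `x + u`, where `u = s • ∫₀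
  -- f(x + u)`. The solutions are the points where the second component of `G` vanishes. At `s = 0`
  -- the derivative of `G` is a shear, hence invertible.
  let G : (ℝ × E) × C(Icc (0 : ℝ) 1, E) → (ℝ × E) × C(Icc (0 : ℝ) 1, E) :=
    fun p ↦ (p.1, p.2 - p.1.1 • N p)
  have hsup : ContDiff ℝ ∞ (fun u : C(Icc (0 : ℝ) 1, E) ↦ fc.comp u) :=
    contDiff_infty.2 fun n ↦ contDiff_superposition n fc hf
  have hN : ContDiff ℝ ∞ N := J.contDiff.comp (hsup.comp (by fun_prop))
  have hG : ContDiff ℝ ∞ G := by fun_prop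
  let p₀ : (ℝ × E) × C(Icc (0 : ℝ) 1, E) := ((0, x₀), 0)
  have hG' : HasFDerivAt G (((ContinuousLinearEquiv.refl ℝ (ℝ × E)).skewProd
      (ContinuousLinearEquiv.refl ℝ C(Icc (0 : ℝ) 1, E))
      (-(ContinuousLinearMap.fst ℝ ℝ E).smulRight (N p₀)) :
        ((ℝ × E) × C(Icc (0 : ℝ) 1, E)) ≃L[ℝ] (ℝ × E) × C(Icc (0 : ℝ) 1, E)) :
        ((ℝ × E) × C(Icc (0 : ℝ) 1, E)) →L[ℝ] (ℝ × E) × C(Icc (0 : ℝ) 1, E)) p₀ := by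
    have h1 : HasFDerivAt N (fderiv ℝ N p₀) p₀ := (hN.differentiable (by simp) p₀).hasFDerivAt
    have h2 := ((hasFDerivAt_fst (𝕜 := ℝ) (p := p₀)).fst).smul h1
    have h3 := (hasFDerivAt_fst (𝕜 := ℝ) (p := p₀)).prodMk ((hasFDerivAt_snd (𝕜 := ℝ)).sub h2)
    refine h3.congr_fderiv ?_
    refine ContinuousLinearMap.ext fun v ↦ ?_
    simp [p₀, sub_eq_add_neg]
  obtain ⟨e, he₀, -, he, hes⟩ := exists_openPartialHomeomorph_contDiffOn (O := univ)
    univ_mem (fun x _ ↦ hG.contDiffAt) _ hG'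
  let u : ℝ × E → C(Icc (0 : ℝ) 1, E) := fun q ↦ (e.symm (q, 0)).2
  have hu : ∀ q : ℝ × E, (q, 0) ∈ e.target → ContDiffAt ℝ ∞ u q ∧
      u q = q.1 • J (fc.comp (k q.2 + u q)) := by
    intro q hq
    refine ⟨((hes _ hq).comp q (f := fun q : ℝ × E ↦ (q, (0 : C(Icc (0 : ℝ) 1, E))))
      (by fun_prop)).snd, ?_⟩
    have h1 : G (e.symm (q, 0)) = (q, 0) := by rw [← he, e.right_inv hq]
    have h2 : (e.symm (q, 0)).1 = q := congrArg Prod.fst h1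
    have h3 := congrArg Prod.snd h1
    simp only [G, N, h2, sub_eq_zero] at h3
    exact h3
  have htarget : ∀ᶠ q : ℝ × E in 𝓝 (0, x₀), (q, (0 : C(Icc (0 : ℝ) 1, E))) ∈ e.target := by
    have h0 : e p₀ = ((0, x₀), 0) := by simp [he, G, p₀]
    have hmem : ((0, x₀), (0 : C(Icc (0 : ℝ) 1, E))) ∈ e.target := h0 ▸ e.map_source he₀
    exact (Continuous.continuousAt (f := fun q : ℝ × E ↦ (q, (0 : C(Icc (0 : ℝ) 1, E))))
      (by fun_prop)).eventually_mem (e.open_target.mem_nhds hmem)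
  obtain ⟨I, hI, V, hV, hIV⟩ := mem_nhds_prod_iff.1 htarget
  obtain ⟨δ, hδ, hδI⟩ := Metric.mem_nhds_iff.1 hI
  -- The Picard–Lindelöf curves serve only to show that `φ (·, x)`, obtained from a separate fixed
  -- point for each time, is a single integral curve.
  obtain ⟨r, hr, ε, hε, hα⟩ :=
    (hf.contDiffAt (x := x₀)).of_le (m := 1) (by simp)
      |>.exists_forall_mem_closedBall_exists_eq_forall_mem_Ioo_hasDerivAt 0
  choose! α hα0 hα using hα
  have hmem : ∀ s ∈ Ioo (-min δ ε) (min δ ε), ∀ x ∈ V ∩ Metric.closedBall x₀ r,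
      ((s, x), (0 : C(Icc (0 : ℝ) 1, E))) ∈ e.target := by
    intro s hs x hx
    refine hIV (mk_mem_prod (hδI ?_) hx.1)
    rw [Metric.mem_ball, dist_zero_right, Real.norm_eq_abs, abs_lt]
    exact ⟨by linarith [hs.1, min_le_left δ ε], by linarith [hs.2, min_le_left δ ε]⟩
  let φ : ℝ × E → E := fun q ↦ q.2 + u q 1
  have hφα : ∀ s ∈ Ioo (-min δ ε) (min δ ε), ∀ x ∈ V ∩ Metric.closedBall x₀ r,
      φ (s, x) = α x s := by
    intro s hs x hx
    have hfix := (hu _ (hmem s hs x hx)).2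
    set w := u (s, x) with hw
    let g : ℝ → E := fun t ↦ x + s • ∫ τ in (0 : ℝ)..t,
      IccExtend zero_le_one (fc.comp (k x + w)) τ
    have hg : ∀ t : Icc (0 : ℝ) 1, g t = x + w t := fun t ↦ by
      conv_rhs => rw [hfix]
      rfl
    have hgd : ∀ t ∈ Icc (0 : ℝ) 1, HasDerivAt g (s • f (g t)) t := by
      intro t ht
      have h1 := (fc.comp (k x + w)).continuous.Icc_extend' (h := zero_le_one).integral_hasStrictDerivAt
        0 t |>.hasDerivAt
      have h2 := (h1.const_smul s).const_add x
      rw [IccExtend_of_mem _ _ ht] at h2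
      rw [hg ⟨t, ht⟩]
      exact h2
    have hαd : ∀ t ∈ Icc (0 : ℝ) 1, HasDerivAt (fun t ↦ α x (s * t)) (s • f (α x (s * t))) t := by
      intro t ht
      have h1 : HasDerivAt (α x) (f (α x (s * t))) (s * t) := by
        refine hα x hx.2 _ ?_
        have : |s| < ε := abs_lt.2 ⟨by linarith [hs.1, min_le_right δ ε],
          by linarith [hs.2, min_le_right δ ε]⟩
        have h2 : |s * t| < ε := by
          rw [abs_mul, abs_of_nonneg ht.1]
          exact (mul_le_of_le_one_right (abs_nonneg s) ht.2).trans_lt this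
        rw [zero_sub, zero_add]
        exact abs_lt.1 h2
      have h2 : HasDerivAt (fun t : ℝ ↦ s * t) s t := by simpa using (hasDerivAt_id t).const_mul s
      exact h1.scomp t h2
    -- `g` and `t ↦ α x (s * t)` solve the same rescaled equation with the same start; the global
    -- Lipschitz bound gives equality, which is read off at `t = 1`.
    have key := ODE_solution_unique (v := fun _ y ↦ s • f y) (K := ‖s‖₊ * K) (f := g)
      (g := fun t ↦ α x (s * t)) (a := 0) (b := 1) (fun _ ↦ (lipschitzWith_smul s).comp hK)
      (fun t ht ↦ (hgd t ht).continuousAt.continuousWithinAt)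
      (fun t ht ↦ (hgd t ⟨ht.1, ht.2.le⟩).hasDerivWithinAt)
      (fun t ht ↦ (hαd t ht).continuousAt.continuousWithinAt)
      (fun t ht ↦ (hαd t ⟨ht.1, ht.2.le⟩).hasDerivWithinAt)
      (by simp [g, hα0 x hx.2]) (right_mem_Icc.2 zero_le_one)
    have h1 := hg 1
    simp only [mul_one] at key
    rw [← key]
    exact h1.symm
  refine ⟨min δ ε, lt_min hδ hε, V ∩ Metric.closedBall x₀ r,
    inter_mem hV (Metric.closedBall_mem_nhds x₀ hr), φ, fun x hx ↦ ?_, fun s hs x hx ↦ ?_,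
    fun x hx s hs ↦ ?_⟩
  · rw [hφα 0 ⟨by simp [hδ, hε], by simp [hδ, hε]⟩ x hx, hα0 x hx.2]
  · have := (hu _ (hmem s hs x hx)).1
    exact contDiffAt_snd.add
      ((ContinuousLinearMap.contDiff (E := C(Icc (0 : ℝ) 1, E)) (F := E)
        (ContinuousMap.evalCLM ℝ (1 : Icc (0 : ℝ) 1))).contDiffAt.comp (s, x) this)
  · have h1 : (fun s ↦ φ (s, x)) =ᶠ[𝓝 s] α x := by
      filter_upwards [isOpen_Ioo.mem_nhds hs] with s' hs' using hφα s' hs' x hx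
    rw [hφα s hs x hx]
    refine HasDerivAt.congr_of_eventuallyEq (hα x hx.2 s ?_) h1
    rw [zero_sub, zero_add]
    exact ⟨by linarith [hs.1, min_le_right δ ε], by linarith [hs.2, min_le_right δ ε]⟩

end Flow

/-! ### Flow boxes in a vector space. -/

section FlowBox

/-- A smooth map defined near a point agrees near this point with a smooth Lipschitz map. -/
theorem exists_lipschitz_contDiff_eq {E F : Type*} [NormedAddCommGroup E] [NormedSpace ℝ E]
    [FiniteDimensional ℝ E] [NormedAddCommGroup F] [NormedSpace ℝ F] {f : E → F} {U : Set E}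
    (hU : IsOpen U) (hf : ∀ x ∈ U, ContDiffAt ℝ ∞ f x) {x₀ : E} (hx₀ : x₀ ∈ U) :
    ∃ (g : E → F) (K : NNReal), ContDiff ℝ ∞ g ∧ LipschitzWith K g ∧ ∀ᶠ x in 𝓝 x₀, g x = f x := by
  obtain ⟨r, hr, hrU⟩ := Metric.isOpen_iff.1 hU x₀ hx₀
  let b : ContDiffBump x₀ := ⟨r / 4, r / 2, by positivity, by linarith⟩
  have hb : tsupport b ⊆ U := by
    rw [b.tsupport_eq]
    exact (Metric.closedBall_subset_ball (by simp only [b]; linarith)).trans hrU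
  have hg : ContDiff ℝ ∞ (fun x ↦ b x • f x) := by
    rw [contDiff_iff_contDiffAt]
    intro x
    by_cases hx : x ∈ U
    · exact b.contDiff.contDiffAt.smul (hf x hx)
    · have : (fun x ↦ b x • f x) =ᶠ[𝓝 x] fun _ ↦ 0 := by
        filter_upwards [(isClosed_tsupport b).isOpen_compl.mem_nhds fun h ↦ hx (hb h)] with y hy
        rw [image_eq_zero_of_notMem_tsupport hy, zero_smul]
      exact contDiffAt_const.congr_of_eventuallyEq this
  have hc : HasCompactSupport (fun x ↦ b x • f x) := b.hasCompactSupport.smul_right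
  obtain ⟨K, hK⟩ := hg.lipschitzWith_of_hasCompactSupport hc (by simp)
  refine ⟨_, K, hg, hK, ?_⟩
  filter_upwards [b.eventuallyEq_one] with x hx
  simp [hx]

/-- Rectification of a vector field along a transversal slice, together with a solution of
an ordinary differential equation along its integral curves. -/
theorem exists_rectification {E F K : Type*} [NormedAddCommGroup E] [NormedSpace ℝ E]
    [FiniteDimensional ℝ E] [NormedAddCommGroup F] [NormedSpace ℝ F] [FiniteDimensional ℝ F]
    [NormedAddCommGroup K] [NormedSpace ℝ K] [CompleteSpace K]
    {U : Set E} (hU : IsOpen U) {X : E → E} (hX : ∀ x ∈ U, ContDiffAt ℝ ∞ X x)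
    {G : E × F → F} (hG : ∀ x ∈ U, ∀ w, ContDiffAt ℝ ∞ G (x, w)) (w₀ : F)
    {j : K → E} {y₀ : K} {Q : K → Prop}
    (hj : ∀ᶠ y in 𝓝 y₀, ContDiffAt ℝ ∞ j y ∧ Q y) (hjU : j y₀ ∈ U)
    (L : (ℝ × K) ≃L[ℝ] E) (hL : ∀ s y, L (s, y) = s • X (j y₀) + fderiv ℝ j y₀ y) :
    ∃ ε > 0, ∃ O : Set K, IsOpen O ∧ y₀ ∈ O ∧ ∃ Ψ : OpenPartialHomeomorph (ℝ × K) E,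
      Ψ.source = Ioo (-ε) ε ×ˢ O ∧ Ψ.target ⊆ U ∧ (∀ z ∈ Ψ.source, ContDiffAt ℝ ∞ Ψ z) ∧
      (∀ x ∈ Ψ.target, ContDiffAt ℝ ∞ Ψ.symm x) ∧ (∀ y ∈ O, Ψ (0, y) = j y ∧ Q y) ∧
      (∀ y ∈ O, ∀ s ∈ Ioo (-ε) ε, HasDerivAt (fun s ↦ Ψ (s, y)) (X (Ψ (s, y))) s) ∧
      ∃ w : E → F, w (j y₀) = w₀ ∧ (∀ x ∈ Ψ.target, ContDiffAt ℝ ∞ w x) ∧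
        ∀ y ∈ O, ∀ s ∈ Ioo (-ε) ε,
          HasDerivAt (fun s ↦ w (Ψ (s, y))) (G (Ψ (s, y), w (Ψ (s, y)))) s := by
  have : CompleteSpace (E × F) := FiniteDimensional.complete ℝ (E × F)
  have : CompleteSpace E := FiniteDimensional.complete ℝ E
  -- The field and the additional equation `w' = G` are integrated together, as one autonomous field
  -- on `E × F`, cut off so as to be globally Lipschitz.
  obtain ⟨g, C, hg, hgC, hgeq⟩ := exists_lipschitz_contDiff_eq
    (f := fun z : E × F ↦ (X z.1, G z)) (U := U ×ˢ univ) (hU.prod isOpen_univ)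
    (fun z hz ↦ ((hX _ hz.1).comp z contDiffAt_fst).prodMk (hG _ hz.1 z.2))
    (x₀ := (j y₀, w₀)) ⟨hjU, trivial⟩
  obtain ⟨ε₁, hε₁, V, hV, φ, hφ0, hφs, hφd⟩ := exists_contDiffAt_flow hg hgC (j y₀, w₀)
  have hjc : ContinuousAt j y₀ := hj.self_of_nhds.1.continuousAt
  let Ξ : ℝ × K → E × F := fun z ↦ φ (z.1, (j z.2, w₀))
  have hVy : ∀ᶠ y in 𝓝 y₀, (j y, w₀) ∈ V :=
    (hjc.prodMk continuousAt_const).eventually_mem hV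
  have hsnd : Tendsto (Prod.snd : ℝ × K → K) (𝓝 (0, y₀)) (𝓝 y₀) := continuousAt_snd
  have hmain : ∀ᶠ z : ℝ × K in 𝓝 (0, y₀), z.1 ∈ Ioo (-ε₁) ε₁ ∧ (j z.2, w₀) ∈ V ∧
      (ContDiffAt ℝ ∞ j z.2 ∧ Q z.2) :=
    (continuousAt_fst.eventually_mem (isOpen_Ioo.mem_nhds ⟨by simpa, by simpa⟩)).and
      ((hsnd.eventually hVy).and (hsnd.eventually hj))
  have hΞs : ∀ z : ℝ × K, z.1 ∈ Ioo (-ε₁) ε₁ → (j z.2, w₀) ∈ V → ContDiffAt ℝ ∞ j z.2 →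
      ContDiffAt ℝ ∞ Ξ z := fun z h1 h2 h3 ↦
    (hφs _ h1 _ h2).comp z (contDiffAt_fst.prodMk
      ((h3.comp z contDiffAt_snd).prodMk contDiffAt_const))
  have hΞ0 : Ξ (0, y₀) = (j y₀, w₀) := hφ0 _ hVy.self_of_nhds
  obtain ⟨h01, h02, h03, -⟩ := hmain.self_of_nhds
  have hΞc : ContinuousAt Ξ (0, y₀) := (hΞs _ h01 h02 h03).continuousAt
  have hmain2 : ∀ᶠ z : ℝ × K in 𝓝 (0, y₀), Ξ z ∈ U ×ˢ (univ : Set F) ∧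
      g (Ξ z) = (X (Ξ z).1, G (Ξ z)) := by
    have hΞt : Tendsto Ξ (𝓝 (0, y₀)) (𝓝 (j y₀, w₀)) := hΞ0 ▸ hΞc
    exact (hΞt.eventually_mem ((hU.prod isOpen_univ).mem_nhds ⟨hjU, trivial⟩)).and
      (hΞt.eventually hgeq)
  have hΞd : ∀ y s, (j y, w₀) ∈ V → s ∈ Ioo (-ε₁) ε₁ →
      HasDerivAt (fun s ↦ Ξ (s, y)) (g (Ξ (s, y))) s := fun y s hy hs ↦ hφd _ hy s hs
  let ψ : ℝ × K → E := fun z ↦ (Ξ z).1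
  -- The time direction is mapped to `X (j y₀)` and the slice direction by the derivative of `j`;
  -- together these form the isomorphism `L`.
  have hψd : HasFDerivAt ψ (L : (ℝ × K) →L[ℝ] E) (0, y₀) := by
    have h1 : HasFDerivAt ψ (fderiv ℝ ψ (0, y₀)) (0, y₀) :=
      ((hΞs _ h01 h02 h03).fst.differentiableAt (by simp)).hasFDerivAt
    refine h1.congr_fderiv (ContinuousLinearMap.ext fun z ↦ ?_)
    obtain ⟨s, y⟩ := z
    have e1 : fderiv ℝ ψ (0, y₀) (s, 0) = s • X (j y₀) := by
      have hc : HasDerivAt (fun s : ℝ ↦ ((s, y₀) : ℝ × K)) (1, 0) 0 :=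
        (hasDerivAt_id 0).prodMk (hasDerivAt_const _ _)
      have ha := HasFDerivAt.comp_hasDerivAt (0 : ℝ) (f := fun s : ℝ ↦ ((s, y₀) : ℝ × K)) h1 hc
      have hb : HasDerivAt (fun s ↦ ψ (s, y₀)) (g (Ξ (0, y₀))).1 0 :=
        (hΞd y₀ 0 h02 h01).fst
      have := ha.unique hb
      rw [hΞ0, hgeq.self_of_nhds] at this
      rw [show ((s, 0) : ℝ × K) = s • (1, 0) by simp, map_smul, this]
    have e2 : fderiv ℝ ψ (0, y₀) (0, y) = fderiv ℝ j y₀ y := by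
      have hc : HasFDerivAt (fun y : K ↦ ((0, y) : ℝ × K)) (ContinuousLinearMap.inr ℝ ℝ K) y₀ :=
        (hasFDerivAt_const _ _).prodMk (hasFDerivAt_id _)
      have ha := HasFDerivAt.comp y₀ (f := fun y : K ↦ ((0, y) : ℝ × K)) h1 hc
      have hb : HasFDerivAt j (fderiv ℝ j y₀) y₀ :=
        (h03.differentiableAt (by simp)).hasFDerivAt
      have hab : ψ ∘ (fun y : K ↦ ((0, y) : ℝ × K)) =ᶠ[𝓝 y₀] j := by
        filter_upwards [hVy] with y hy
        simp [ψ, Ξ, hφ0 _ hy]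
      have := (hb.congr_of_eventuallyEq hab).unique ha
      rw [this]
      simp
    rw [show ((s, y) : ℝ × K) = (s, 0) + (0, y) by simp, map_add, e1, e2]
    simpa using (hL s y).symm
  -- The neighbourhood is also shrunk so that the cut-off field equals `(X, G)` along the flow; the
  -- curves of the box are then integral curves of `X` itself.
  obtain ⟨e, he0, heO, he, hes⟩ := exists_openPartialHomeomorph_contDiffOn
    (O := {z | (z.1 ∈ Ioo (-ε₁) ε₁ ∧ (j z.2, w₀) ∈ V ∧ (ContDiffAt ℝ ∞ j z.2 ∧ Q z.2)) ∧
      Ξ z ∈ U ×ˢ (univ : Set F) ∧ g (Ξ z) = (X (Ξ z).1, G (Ξ z))}) (f := ψ)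
    (hmain.and hmain2) (fun z hz ↦ (hΞs z hz.1.1 hz.1.2.1 hz.1.2.2.1).fst) L hψd
  obtain ⟨I, O, hI, h0I, hO, h0O, hsrc⟩ := mem_nhds_prod_iff'.1 (e.open_source.mem_nhds he0)
  obtain ⟨ε, hε, hεI⟩ := Metric.isOpen_iff.1 hI 0 h0I
  have hεI' : Ioo (-ε) ε ⊆ I := by
    rwa [Real.ball_eq_Ioo, zero_sub, zero_add] at hεI
  have hsub : Ioo (-ε) ε ×ˢ O ⊆ e.source := (prod_mono hεI' subset_rfl).trans hsrc
  let Ψ := e.restrOpen (Ioo (-ε) ε ×ˢ O) (isOpen_Ioo.prod hO)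
  have hΨ : ∀ z, Ψ z = ψ z := he
  have hΨt : ∀ x ∈ Ψ.target, Ψ.symm x ∈ Ioo (-ε) ε ×ˢ O ∧ x ∈ e.target := by
    intro x hx
    exact ⟨(Ψ.map_target hx).2, hx.1⟩
  have hsrc : Ψ.source = Ioo (-ε) ε ×ˢ O := inter_eq_right.2 hsub
  have h0 : (0 : ℝ) ∈ Ioo (-ε) ε := ⟨by simpa using hε, hε⟩
  -- The function `w` is the `F`-component of the joint flow, read at the box coordinates of the
  -- point.
  refine ⟨ε, hε, O, hO, h0O, Ψ, hsrc, fun x hx ↦ ?_, fun z hz ↦ ?_, fun x hx ↦ hes _ (hΨt x hx).2,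
    fun y hy ↦ ?_, fun y hy s hs ↦ ?_, fun x ↦ (Ξ (Ψ.symm x)).2, ?_, fun x hx ↦ ?_,
    fun y hy s hs ↦ ?_⟩
  · have h1 := (heO (hsub (hΨt x hx).1)).2.1.1
    rw [← Ψ.right_inv hx, hΨ]
    exact h1
  · have h1 := heO (hsub (hsrc ▸ hz))
    exact (hΞs z h1.1.1 h1.1.2.1 h1.1.2.2.1).fst.congr_of_eventuallyEq (Eventually.of_forall hΨ)
  · have h1 := heO (hsub (mk_mem_prod h0 hy))
    refine ⟨?_, h1.1.2.2.2⟩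
    rw [hΨ]
    simp [ψ, Ξ, hφ0 _ h1.1.2.1]
  · have h1 := heO (hsub (mk_mem_prod hs hy))
    have h2 := (hΞd y s h1.1.2.1 h1.1.1).fst
    rw [h1.2.2] at h2
    simp only [hΨ]
    exact h2
  · have h1 : Ψ (0, y₀) = j y₀ := by rw [hΨ]; simp [ψ, hΞ0]
    have h2 : Ψ.symm (Ψ (0, y₀)) = (0, y₀) := Ψ.left_inv (hsrc ▸ mk_mem_prod h0 h0O)
    simp only [← h1, h2]
    rw [hΞ0]
  · have h1 := heO (hsub (hΨt x hx).1)
    exact ((hΞs _ h1.1.1 h1.1.2.1 h1.1.2.2.1).comp x (hes _ (hΨt x hx).2)).snd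
  · have h1 := heO (hsub (mk_mem_prod hs hy))
    have h2 := (hΞd y s h1.1.2.1 h1.1.1).snd
    rw [h1.2.2] at h2
    have h3 : ∀ s ∈ Ioo (-ε) ε, Ψ.symm (Ψ (s, y)) = (s, y) := fun s hs ↦
      Ψ.left_inv (hsrc ▸ mk_mem_prod hs hy)
    have h4 : (fun s ↦ (Ξ (Ψ.symm (Ψ (s, y)))).2) =ᶠ[𝓝 s] fun s ↦ (Ξ (s, y)).2 := by
      filter_upwards [isOpen_Ioo.mem_nhds hs] with s' hs'
      rw [h3 s' hs']
    refine HasDerivAt.congr_of_eventuallyEq ?_ h4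
    simp only [h3 s hs]
    have h5 : ((Ψ (s, y), (Ξ (s, y)).2) : E × F) = Ξ (s, y) := by rw [hΨ]
    rw [h5]
    exact h2

end FlowBox

/-! ### Flow boxes on a manifold. -/

section Rectification

variable {E : Type*} [NormedAddCommGroup E] [NormedSpace ℝ E] [FiniteDimensional ℝ E]
  {H : Type*} [TopologicalSpace H] [ChartedSpace E H] [IsManifold 𝓘(ℝ, E) ∞ H]

/-- Smoothness of a vector field at a point. -/
abbrev SmoothVectorAt (X : Π p : H, TangentSpace 𝓘(ℝ, E) p) (p : H) : Prop :=
  ContMDiffAt 𝓘(ℝ, E) (𝓘(ℝ, E).prod 𝓘(ℝ, E)) ∞ (fun q ↦ Bundle.TotalSpace.mk' E q (X q)) p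

/-- The representative of a vector field in a chart. -/
noncomputable def chartField (p₀ : H) (X : Π p : H, TangentSpace 𝓘(ℝ, E) p) (x : E) : E :=
  (trivializationAt E (TangentSpace 𝓘(ℝ, E)) p₀
    ⟨(chartAt E p₀).symm x, X ((chartAt E p₀).symm x)⟩).2

theorem contMDiffAt_chartAt_symm (p₀ : H) {x : E} (hx : x ∈ (chartAt E p₀).target) :
    ContMDiffAt 𝓘(ℝ, E) 𝓘(ℝ, E) ∞ (chartAt E p₀).symm x := by
  have h := contMDiffOn_extChartAt_symm (I := 𝓘(ℝ, E)) (n := ∞) p₀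
  refine h.contMDiffAt ?_
  simpa using (chartAt E p₀).open_target.mem_nhds hx

theorem contDiffAt_chartField {p₀ : H} {X : Π p : H, TangentSpace 𝓘(ℝ, E) p} {x : E}
    (hx : x ∈ (chartAt E p₀).target) (hX : SmoothVectorAt X ((chartAt E p₀).symm x)) :
    ContDiffAt ℝ ∞ (chartField p₀ X) x := by
  rw [← contMDiffAt_iff_contDiffAt]
  have h1 := ((trivializationAt E (TangentSpace 𝓘(ℝ, E)) p₀).contMDiffAt_section_iff
    (IB := 𝓘(ℝ, E)) (n := ∞) (s := X) (x₀ := (chartAt E p₀).symm x) (by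
      rw [TangentBundle.trivializationAt_baseSet]
      exact (chartAt E p₀).map_target hx)).1 hX
  exact h1.comp x (contMDiffAt_chartAt_symm p₀ hx)

theorem chartField_apply {p₀ : H} {X : Π p : H, TangentSpace 𝓘(ℝ, E) p} {x : E}
    (hx : x ∈ (chartAt E p₀).target) : chartField p₀ X x =
      mfderiv 𝓘(ℝ, E) 𝓘(ℝ, E) (extChartAt 𝓘(ℝ, E) p₀) ((chartAt E p₀).symm x)
        (X ((chartAt E p₀).symm x)) := by
  have h := (chartAt E p₀).map_target hx
  have h1 : Bundle.Trivialization.continuousLinearMapAt ℝ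
      (trivializationAt E (TangentSpace 𝓘(ℝ, E)) p₀) ((chartAt E p₀).symm x)
        (X ((chartAt E p₀).symm x)) = chartField p₀ X x := by
    rw [Bundle.Trivialization.continuousLinearMapAt_apply,
      Bundle.Trivialization.linearMapAt_apply,
      if_pos (by rwa [TangentBundle.trivializationAt_baseSet])]
    rfl
  rw [← h1]
  exact congrArg (fun A ↦ A (X ((chartAt E p₀).symm x)))
    (TangentBundle.continuousLinearMapAt_trivializationAt h)

theorem mfderiv_chartAt_symm_chartField {p₀ : H} {X : Π p : H, TangentSpace 𝓘(ℝ, E) p} {x : E}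
    (hx : x ∈ (chartAt E p₀).target) :
    HasMFDerivAt 𝓘(ℝ, E) 𝓘(ℝ, E) (chartAt E p₀).symm x
      (mfderiv 𝓘(ℝ, E) 𝓘(ℝ, E) (chartAt E p₀).symm x) ∧
    mfderiv 𝓘(ℝ, E) 𝓘(ℝ, E) (chartAt E p₀).symm x (chartField (E := E) p₀ X x)
      = X ((chartAt E p₀).symm x) := by
  have h := (chartAt E p₀).map_target hx
  refine ⟨((contMDiffAt_chartAt_symm p₀ hx).mdifferentiableAt (by simp)).hasMFDerivAt, ?_⟩
  rw [chartField_apply hx]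
  have h1 := mfderivWithin_extChartAt_symm_comp_mfderiv_extChartAt' (I := 𝓘(ℝ, E)) (x := p₀)
    (y := (chartAt E p₀).symm x) (by simpa using h)
  have h2 : (extChartAt 𝓘(ℝ, E) p₀) ((chartAt E p₀).symm x) = x := (chartAt E p₀).right_inv hx
  rw [h2] at h1
  simp only [modelWithCornersSelf_coe, range_id, mfderivWithin_univ] at h1
  exact congrArg (fun A ↦ A (X ((chartAt E p₀).symm x))) h1

variable {F K : Type*} [NormedAddCommGroup F] [NormedSpace ℝ F] [FiniteDimensional ℝ F]
    [NormedAddCommGroup K] [NormedSpace ℝ K] [FiniteDimensional ℝ K]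

/-- A flow box: a rectification of the vector field `X` on `(-ε, ε) × O`. -/
structure IsFlowBox (X : Π p : H, TangentSpace 𝓘(ℝ, E) p) (ε : ℝ) (O : Set K)
    (Ψ : OpenPartialHomeomorph (ℝ × K) H) : Prop where
  pos : 0 < ε
  isOpen : IsOpen O
  source_eq : Ψ.source = Ioo (-ε) ε ×ˢ O
  smooth : ∀ z ∈ Ψ.source, ContMDiffAt 𝓘(ℝ, ℝ × K) 𝓘(ℝ, E) ∞ Ψ z
  smooth_symm : ∀ p ∈ Ψ.target, ContMDiffAt 𝓘(ℝ, E) 𝓘(ℝ, ℝ × K) ∞ Ψ.symm p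
  integral : ∀ y ∈ O, IsMIntegralCurveOn (I := 𝓘(ℝ, E)) (fun s ↦ Ψ (s, y)) X (Ioo (-ε) ε)

/-- Rectification of a vector field along a transversal slice, together with a solution of
an ordinary differential equation along its integral curves. -/
theorem exists_isFlowBox {U : Set H} (hU : IsOpen U) {X : Π p : H, TangentSpace 𝓘(ℝ, E) p}
    (hX : ∀ p ∈ U, SmoothVectorAt X p) {G : H × F → F}
    (hG : ∀ p ∈ U, ∀ w, ContMDiffAt (𝓘(ℝ, E).prod 𝓘(ℝ, F)) 𝓘(ℝ, F) ∞ G (p, w)) (w₀ : F)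
    {j : K → H} {y₀ : K} {Q : K → Prop}
    (hj : ∀ᶠ y in 𝓝 y₀, ContMDiffAt 𝓘(ℝ, K) 𝓘(ℝ, E) ∞ j y ∧ Q y)
    (hjU : j y₀ ∈ U) (hdim : Module.finrank ℝ E = Module.finrank ℝ K + 1)
    (hinj : ∀ (s : ℝ) (y : K), s • X (j y₀) + mfderiv 𝓘(ℝ, K) 𝓘(ℝ, E) j y₀ y = 0 →
      s = 0 ∧ y = 0) :
    ∃ (ε : ℝ) (O : Set K) (Ψ : OpenPartialHomeomorph (ℝ × K) H), IsFlowBox X ε O Ψ ∧ y₀ ∈ O ∧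
      Ψ.target ⊆ U ∧ (∀ y ∈ O, Ψ (0, y) = j y ∧ Q y) ∧
      ∃ w : H → F, w (j y₀) = w₀ ∧ (∀ p ∈ Ψ.target, ContMDiffAt 𝓘(ℝ, E) 𝓘(ℝ, F) ∞ w p) ∧
        ∀ y ∈ O, ∀ s ∈ Ioo (-ε) ε,
          HasDerivAt (fun s ↦ w (Ψ (s, y))) (G (Ψ (s, y), w (Ψ (s, y)))) s := by
  let p₀ := j y₀
  let c := chartAt E p₀
  have hp₀ : p₀ ∈ c.source := mem_chart_source E p₀
  have hjc : ContinuousAt j y₀ := hj.self_of_nhds.1.continuousAt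
  have hjsrc : ∀ᶠ y in 𝓝 y₀, j y ∈ c.source := hjc.eventually_mem (c.open_source.mem_nhds hp₀)
  have hcs : ∀ p ∈ c.source, ContMDiffAt 𝓘(ℝ, E) 𝓘(ℝ, E) ∞ c p := fun p hp ↦
    contMDiffAt_extChartAt' (I := 𝓘(ℝ, E)) hp
  have hinv : c.symm (c p₀) = p₀ := c.left_inv hp₀
  have hcd : HasMFDerivAt 𝓘(ℝ, E) 𝓘(ℝ, E) c p₀ (mfderiv 𝓘(ℝ, E) 𝓘(ℝ, E) c p₀) :=
    ((hcs p₀ hp₀).mdifferentiableAt (by simp)).hasMFDerivAt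
  have hjd : HasMFDerivAt 𝓘(ℝ, K) 𝓘(ℝ, E) j y₀ (mfderiv 𝓘(ℝ, K) 𝓘(ℝ, E) j y₀) :=
    (hj.self_of_nhds.1.mdifferentiableAt (by simp)).hasMFDerivAt
  let A : E →L[ℝ] E := mfderiv 𝓘(ℝ, E) 𝓘(ℝ, E) c p₀
  let J : K →L[ℝ] E := mfderiv 𝓘(ℝ, K) 𝓘(ℝ, E) j y₀
  have hfd : HasFDerivAt (c ∘ j) (A.comp J) y₀ :=
    (HasMFDerivAt.comp y₀ hcd hjd).hasFDerivAt
  have hXc : chartField p₀ X (c p₀) = mfderiv 𝓘(ℝ, E) 𝓘(ℝ, E) c p₀ (X p₀) := by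
    rw [chartField_apply (c.map_source hp₀)]
    change mfderiv 𝓘(ℝ, E) 𝓘(ℝ, E) c (c.symm (c p₀)) (X (c.symm (c p₀))) = _
    rw [hinv]
  have hcinj : Function.Injective (mfderiv 𝓘(ℝ, E) 𝓘(ℝ, E) c p₀) := by
    have := isInvertible_mfderiv_extChartAt (I := 𝓘(ℝ, E)) (x := p₀) (y := p₀) (by simp)
    exact this.injective
  -- In the chart this is the derivative at `(0, y₀)` of the rectifying map. Transversality makes it
  -- injective, and the dimension count makes it an isomorphism.
  let L₀ : (ℝ × K) →ₗ[ℝ] E :=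
    ((LinearMap.id.smulRight (chartField p₀ X (c p₀))).coprod
      (fderiv ℝ (c ∘ j) y₀).toLinearMap)
  have hL₀' : ∀ s y, L₀ (s, y) = s • chartField p₀ X (c p₀) + fderiv ℝ (c ∘ j) y₀ y :=
    fun s y ↦ rfl
  have hL₀ : Function.Injective L₀ := by
    rw [← LinearMap.ker_eq_bot, LinearMap.ker_eq_bot']
    rintro ⟨s, y⟩ h
    let x : E := X p₀
    have h1 : A (s • x + J y) = 0 := by
      have h2 := hL₀' s y
      rw [h, hfd.fderiv, hXc] at h2
      rw [A.map_add, A.map_smul]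
      exact h2.symm
    obtain ⟨h2, h3⟩ := hinj s y (hcinj (h1.trans (map_zero _).symm))
    rw [h2, h3]; rfl
  let L := (LinearMap.linearEquivOfInjective L₀ hL₀
    (by rw [Module.finrank_prod, Module.finrank_self, hdim, add_comm])).toContinuousLinearEquiv
  have hVo : IsOpen (c.target ∩ c.symm ⁻¹' U) := c.isOpen_inter_preimage_symm hU
  obtain ⟨ε, hε, O, hO, hy₀, Φ, hsrc, htgt, hΦ, hΦs, hΦ0, hΦd, w, hw0, hws, hwd⟩ :=
    exists_rectification (U := c.target ∩ c.symm ⁻¹' U) hVo (X := chartField p₀ X)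
      (fun x hx ↦ contDiffAt_chartField hx.1 (hX _ hx.2))
      (G := fun z ↦ G (c.symm z.1, z.2))
      (fun x hx w ↦ by
        rw [← contMDiffAt_iff_contDiffAt]
        have h1 : ContMDiffAt 𝓘(ℝ, E × F) (𝓘(ℝ, E).prod 𝓘(ℝ, F)) ∞
            (fun z : E × F ↦ (c.symm z.1, z.2)) (x, w) := by
          refine ContMDiffAt.prodMk ?_ ?_
          · exact (contMDiffAt_chartAt_symm p₀ hx.1).comp (x, w)
              (contDiffAt_fst.contMDiffAt)
          · exact contDiffAt_snd.contMDiffAt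
        exact ContMDiffAt.comp (x, w) (g := G) (hG _ hx.2 w) h1)
      w₀ (j := c ∘ j) (y₀ := y₀) (Q := fun y ↦ j y ∈ c.source ∧ Q y)
      (by
        filter_upwards [hj, hjsrc] with y hy hy'
        refine ⟨?_, hy', hy.2⟩
        rw [← contMDiffAt_iff_contDiffAt]
        exact (hcs _ hy').comp y hy.1)
      ⟨c.map_source hp₀, by
        change c.symm (c p₀) ∈ U
        rwa [hinv]⟩ L (fun s y ↦ rfl)
  have hsub : Φ.target ⊆ c.symm.source := fun x hx ↦ (htgt hx).1
  let Ψ := Φ.trans c.symm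
  have hΨsrc : Ψ.source = Φ.source := by
    rw [OpenPartialHomeomorph.trans_source]
    exact inter_eq_left.2 fun z hz ↦ hsub (Φ.map_source hz)
  have hΨt : ∀ p ∈ Ψ.target, p ∈ c.source ∧ c p ∈ Φ.target := fun p hp ↦ by
    rw [OpenPartialHomeomorph.trans_target] at hp
    exact ⟨hp.1, hp.2⟩
  have hleft : ∀ z ∈ Φ.source, c (c.symm (Φ z)) = Φ z := fun z hz ↦
    c.right_inv (hsub (Φ.map_source hz))
  refine ⟨ε, O, Ψ, ⟨hε, hO, hΨsrc.trans hsrc, fun z hz ↦ ?_, fun p hp ↦ ?_, fun y hy s hs ↦ ?_⟩,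
    hy₀, fun p hp ↦ ?_, fun y hy ↦ ?_, w ∘ c, hw0, fun p hp ↦ ?_, fun y hy s hs ↦ ?_⟩
  · rw [hΨsrc] at hz
    exact (contMDiffAt_chartAt_symm p₀ (hsub (Φ.map_source hz))).comp z (hΦ z hz).contMDiffAt
  · exact (hΦs _ (hΨt p hp).2).contMDiffAt.comp p (hcs p (hΨt p hp).1)
  · have hz : (s, y) ∈ Φ.source := hsrc ▸ mk_mem_prod hs hy
    obtain ⟨h1, h2⟩ := mfderiv_chartAt_symm_chartField (X := X) (hsub (Φ.map_source hz))
    have h3 : HasMFDerivAt 𝓘(ℝ, ℝ) 𝓘(ℝ, E) (fun s ↦ Φ (s, y)) s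
      (ContinuousLinearMap.toSpanSingleton ℝ (chartField (E := E) p₀ X (Φ (s, y)))) :=
      (hΦd y hy s hs).hasFDerivAt.hasMFDerivAt
    have h4 := (HasMFDerivAt.comp s h1 h3).hasMFDerivWithinAt (s := Ioo (-ε) ε)
    have h5 : (1 : ℝ →L[ℝ] ℝ).smulRight (X (Ψ (s, y))) =
        (mfderiv 𝓘(ℝ, E) 𝓘(ℝ, E) c.symm (Φ (s, y))).comp
          (ContinuousLinearMap.toSpanSingleton ℝ (chartField (E := E) p₀ X (Φ (s, y)))) := by
      ext
      change (1 : ℝ) • X (Ψ (s, y)) =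
        mfderiv 𝓘(ℝ, E) 𝓘(ℝ, E) c.symm (Φ (s, y)) ((1 : ℝ) • chartField (E := E) p₀ X (Φ (s, y)))
      rw [one_smul, one_smul, h2]
      rfl
    rw [h5]
    exact h4
  · have h1 := (htgt (hΨt p hp).2).2
    rwa [mem_preimage, c.left_inv (hΨt p hp).1] at h1
  · obtain ⟨h1, h2, h3⟩ := hΦ0 y hy
    refine ⟨?_, h3⟩
    change c.symm (Φ (0, y)) = j y
    rw [h1]
    exact c.left_inv h2
  · exact (hws _ (hΨt p hp).2).contMDiffAt.comp p (hcs p (hΨt p hp).1)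
  · have h1 : ∀ s ∈ Ioo (-ε) ε, c (Ψ (s, y)) = Φ (s, y) := fun s hs ↦
      hleft _ (hsrc ▸ mk_mem_prod hs hy)
    have h2 : (fun s ↦ (w ∘ c) (Ψ (s, y))) =ᶠ[𝓝 s] fun s ↦ w (Φ (s, y)) := by
      filter_upwards [isOpen_Ioo.mem_nhds hs] with s' hs'
      simp only [Function.comp_apply, h1 s' hs']
    refine HasDerivAt.congr_of_eventuallyEq ?_ h2
    simp only [Function.comp_apply, h1 s hs]
    exact hwd y hy s hs

end Rectification

/-! ### Transport equations and propagation along integral curves. -/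

section Transport

variable {E : Type*} [NormedAddCommGroup E] [NormedSpace ℝ E]
  {H : Type*} [TopologicalSpace H] [ChartedSpace E H] [IsManifold 𝓘(ℝ, E) ∞ H]
  {V : Type*} [NormedAddCommGroup V] [NormedSpace ℝ V]
  {X : Π p : H, TangentSpace 𝓘(ℝ, E) p}

theorem hasDerivAt_comp_integralCurve {u : H → V} {c : ℝ → H} {a b s : ℝ}
    (hc : IsMIntegralCurveOn (I := 𝓘(ℝ, E)) c X (Ioo a b)) (hs : s ∈ Ioo a b)
    (hu : MDifferentiableAt 𝓘(ℝ, E) 𝓘(ℝ, V) u (c s)) :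
    HasDerivAt (fun s ↦ u (c s)) (mvfderiv 𝓘(ℝ, E) u (c s) (X (c s))) s := by
  have h1 := (hc s hs).hasMFDerivAt (isOpen_Ioo.mem_nhds hs)
  let A : E →L[ℝ] V := mfderiv 𝓘(ℝ, E) 𝓘(ℝ, V) u (c s)
  let x : E := X (c s)
  have h2 : HasFDerivAt (fun s ↦ u (c s)) (A.comp ((1 : ℝ →L[ℝ] ℝ).smulRight x)) s :=
    (HasMFDerivAt.comp s hu.hasMFDerivAt h1).hasFDerivAt
  have h3 := h2.hasDerivAt
  have h4 : (A.comp ((1 : ℝ →L[ℝ] ℝ).smulRight x)) 1 = A x := by simp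
  rw [h4] at h3
  exact h3

theorem continuousAt_integralCurve {c : ℝ → H} {a b s : ℝ}
    (hc : IsMIntegralCurveOn (I := 𝓘(ℝ, E)) c X (Ioo a b)) (hs : s ∈ Ioo a b) :
    ContinuousAt c s :=
  ((hc s hs).hasMFDerivAt (isOpen_Ioo.mem_nhds hs)).continuousAt

/-- The predicate `P T q` that `T` solves a linear differential equation along `X` near `q`:
in suitable local trivialisations, which preserve smoothness `Sm`, the solutions are the smooth
functions constant along `X`. -/
def IsTransport {Vb : H → Type*} (V : Type*) [NormedAddCommGroup V] [NormedSpace ℝ V]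
    (X : Π p : H, TangentSpace 𝓘(ℝ, E) p) (Sm P : (Π q, Vb q) → H → Prop) : Prop :=
  ∀ p₀ : H, ∃ (W : Set H) (e : Π q, Vb q → V) (e' : Π q, V → Vb q), IsOpen W ∧ p₀ ∈ W ∧
    (∀ q ∈ W, ∀ v, e q (e' q v) = v) ∧ (∀ q ∈ W, ∀ t, e' q (e q t) = t) ∧
    (∀ T, ∀ q ∈ W, P T q ↔ ∀ᶠ q' in 𝓝 q, ContMDiffAt 𝓘(ℝ, E) 𝓘(ℝ, V) ∞ (fun z ↦ e z (T z)) q' ∧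
      mvfderiv 𝓘(ℝ, E) (fun z ↦ e z (T z)) q' (X q') = 0) ∧
    ∀ T, ∀ q ∈ W, Sm T q → ContMDiffAt 𝓘(ℝ, E) 𝓘(ℝ, V) ∞ (fun z ↦ e z (T z)) q

namespace IsTransport

variable {Vb : H → Type*} {Sm P : (Π q, Vb q) → H → Prop}

theorem congr (hP : IsTransport V X Sm P) {T T' : Π q, Vb q} {q : H} (h : ∀ᶠ z in 𝓝 q, T z = T' z)
    (hT : P T q) : P T' q := by
  obtain ⟨W, e, e', -, hqW, -, -, hiff, -⟩ := hP q
  rw [hiff _ _ hqW] at hT ⊢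
  filter_upwards [hT, h.eventually_nhds] with z hz hz'
  have h1 : (fun z ↦ e z (T' z)) =ᶠ[𝓝 z] fun z ↦ e z (T z) := hz'.mono fun y hy ↦ by
    simp only [hy]
  refine ⟨hz.1.congr_of_eventuallyEq h1, ?_⟩
  have h2 : mvfderiv 𝓘(ℝ, E) (fun z ↦ e z (T' z)) z = mvfderiv 𝓘(ℝ, E) (fun z ↦ e z (T z)) z := by
    ext v
    simp only [mvfderiv, h1.mfderiv_eq]
    rfl
  rw [h2]
  exact hz.2

/-- Two solutions along an integral curve which agree at one point agree at every point. -/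
theorem eq_along (hP : IsTransport V X Sm P) {T T' : Π q, Vb q} {c : ℝ → H} {a b : ℝ}
    (hc : IsMIntegralCurveOn (I := 𝓘(ℝ, E)) c X (Ioo a b)) {t₁ t₂ : ℝ} (ht₁ : t₁ ∈ Ioo a b)
    (ht₂ : t₂ ∈ Ioo a b) (hT : ∀ s ∈ uIcc t₁ t₂, P T (c s) ∧ P T' (c s))
    (h : T (c t₁) = T' (c t₁)) : T (c t₂) = T' (c t₂) := by
  have hsub : uIcc t₁ t₂ ⊆ Ioo a b := ordConnected_Ioo.uIcc_subset ht₁ ht₂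
  -- In a local trivialisation both solutions are constant along the curve, so agreement at `s` is
  -- equivalent to agreement at all nearby parameters; connectedness of the interval does the rest.
  refine (isPreconnected_uIcc (a := t₁) (b := t₂)).induction₂'
    (fun x y ↦ T (c x) = T' (c x) → T (c y) = T' (c y)) (fun s hs ↦ ?_)
    (fun _ _ _ _ _ _ h1 h2 h ↦ h2 (h1 h)) left_mem_uIcc right_mem_uIcc h
  obtain ⟨W, e, e', hW, hsW, h1, h2, hiff, -⟩ := hP (c s)
  have hcs := continuousAt_integralCurve hc (hsub hs)
  have hcon : ∀ T'' : Π q, Vb q, P T'' (c s) → ∀ᶠ s' in 𝓝 s,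
      e (c s') (T'' (c s')) = e (c s) (T'' (c s)) := by
    intro T'' hT''
    rw [hiff _ _ hsW] at hT''
    have h3 : ∀ᶠ s' in 𝓝 s, s' ∈ Ioo a b ∧
        ContMDiffAt 𝓘(ℝ, E) 𝓘(ℝ, V) ∞ (fun z ↦ e z (T'' z)) (c s') ∧
        mvfderiv 𝓘(ℝ, E) (fun z ↦ e z (T'' z)) (c s') (X (c s')) = 0 :=
      (isOpen_Ioo.eventually_mem (hsub hs)).and (hcs.eventually hT'')
    obtain ⟨δ, hδ, hball⟩ := Metric.eventually_nhds_iff_ball.1 h3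
    filter_upwards [Metric.ball_mem_nhds s hδ] with s' hs'
    have hder : ∀ y ∈ Metric.ball s δ, HasDerivAt (fun y ↦ e (c y) (T'' (c y))) 0 y := by
      intro y hy
      obtain ⟨hy1, hy2, hy3⟩ := hball y hy
      have := hasDerivAt_comp_integralCurve hc hy1 (hy2.mdifferentiableAt (by simp))
      rwa [hy3] at this
    exact (convex_ball s δ).is_const_of_fderivWithin_eq_zero (𝕜 := ℝ)
      (fun y hy ↦ (hder y hy).differentiableAt.differentiableWithinAt)
      (fun y hy ↦ by
        rw [fderivWithin_of_isOpen Metric.isOpen_ball hy, (hder y hy).hasFDerivAt.fderiv]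
        ext; simp) hs' (Metric.mem_ball_self hδ)
  have hsWe : ∀ᶠ s' in 𝓝 s, c s' ∈ W := hcs.eventually_mem (hW.mem_nhds hsW)
  refine nhdsWithin_le_nhds ?_
  filter_upwards [hcon T (hT s hs).1, hcon T' (hT s hs).2, hsWe] with s' ha hb hs'
  have key : T (c s') = T' (c s') ↔ T (c s) = T' (c s) := by
    constructor
    · intro h
      rw [← h2 _ hsW (T (c s)), ← h2 _ hsW (T' (c s)), ← ha, ← hb, h]
    · intro h
      rw [← h2 _ hs' (T (c s')), ← h2 _ hs' (T' (c s')), ha, hb, h]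
  exact ⟨key.2, key.1⟩

end IsTransport

end Transport

/-! ### Gluing of integral curves, and slices met once by each curve. -/

section Glue

variable {E : Type*} [NormedAddCommGroup E] [NormedSpace ℝ E] [FiniteDimensional ℝ E]
  {H : Type*} [TopologicalSpace H] [T2Space H] [ChartedSpace E H] [IsManifold 𝓘(ℝ, E) ∞ H]
  {X : Π p : H, TangentSpace 𝓘(ℝ, E) p}

/-- Two integral curves which meet are restrictions of one integral curve. -/
theorem exists_glue_integralCurve (hX : ∀ p, SmoothVectorAt X p) {c₁ c₂ : ℝ → H}
    {a₁ b₁ a₂ b₂ t : ℝ} (h₁ : IsMIntegralCurveOn (I := 𝓘(ℝ, E)) c₁ X (Ioo a₁ b₁))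
    (h₂ : IsMIntegralCurveOn (I := 𝓘(ℝ, E)) c₂ X (Ioo a₂ b₂)) (ht₁ : t ∈ Ioo a₁ b₁)
    (ht₂ : t ∈ Ioo a₂ b₂) (h : c₁ t = c₂ t) :
    ∃ c : ℝ → H, IsMIntegralCurveOn (I := 𝓘(ℝ, E)) c X (Ioo (min a₁ a₂) (max b₁ b₂)) ∧
      EqOn c c₁ (Ioo a₁ b₁) ∧ EqOn c c₂ (Ioo a₂ b₂) := by
  classical
  have : IsManifold 𝓘(ℝ, E) 1 H := IsManifold.of_le (n := ∞) (by simp)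
  have hX' : ContMDiff 𝓘(ℝ, E) (𝓘(ℝ, E).prod 𝓘(ℝ, E)) 1
      (fun q ↦ Bundle.TotalSpace.mk' E q (X q)) := fun p ↦ (hX p).of_le (by simp)
  refine ⟨piecewise (Ioo a₁ b₁) c₁ c₂, ?_, piecewise_eqOn _ _ _,
    eqOn_piecewise_of_isMIntegralCurveOn_Ioo hX' h₁ h₂ ⟨ht₁, ht₂⟩ h⟩
  rw [← Ioo_union_Ioo' (ht₂.1.trans ht₁.2) (ht₁.1.trans ht₂.2)]
  exact isMIntegralCurveOn_piecewise hX' h₁ h₂ ⟨ht₁, ht₂⟩ h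

/-- A set which every integral curve meets exactly once. -/
structure IsSlice (X : Π p : H, TangentSpace 𝓘(ℝ, E) p) (R : Set H) : Prop where
  meets : ∀ p : H, ∃ (a b : ℝ) (c : ℝ → H), a < 0 ∧ 0 < b ∧ c 0 = p ∧
    IsMIntegralCurveOn (I := 𝓘(ℝ, E)) c X (Ioo a b) ∧ ∃ t ∈ Ioo a b, c t ∈ R
  meets_once : ∀ (a b : ℝ) (c : ℝ → H), IsMIntegralCurveOn (I := 𝓘(ℝ, E)) c X (Ioo a b) →
    ∀ t ∈ Ioo a b, ∀ t' ∈ Ioo a b, c t ∈ R → c t' ∈ R → t = t'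

/-- The point `p` is joined to the slice by an integral curve in `W`. -/
def IsJoined (X : Π p : H, TangentSpace 𝓘(ℝ, E) p) (R W : Set H) (p : H) : Prop :=
  ∃ (a b t₀ t : ℝ) (c : ℝ → H), t₀ ∈ Ioo a b ∧ c t₀ = p ∧
    IsMIntegralCurveOn (I := 𝓘(ℝ, E)) c X (Ioo a b) ∧ t ∈ Ioo a b ∧ c t ∈ R ∧
      ∀ s ∈ uIcc t₀ t, c s ∈ W

-- The field is autonomous, so time may be translated. This places two curves through `p` at a
-- common parameter, where they can be glued.
omit [FiniteDimensional ℝ E] [T2Space H] in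
theorem IsJoined.shift {R W : Set H} {p : H} (h : IsJoined X R W p) (t₀ : ℝ) :
    ∃ (a b t : ℝ) (c : ℝ → H), t₀ ∈ Ioo a b ∧ c t₀ = p ∧
    IsMIntegralCurveOn (I := 𝓘(ℝ, E)) c X (Ioo a b) ∧ t ∈ Ioo a b ∧ c t ∈ R ∧
      ∀ s ∈ uIcc t₀ t, c s ∈ W := by
  obtain ⟨a, b, t₁, t, c, ht₁, hp, hc, ht, htR, hW⟩ := h
  refine ⟨a + (t₀ - t₁), b + (t₀ - t₁), t + (t₀ - t₁), c ∘ (· + (t₁ - t₀)), ?_, ?_, ?_, ?_, ?_, ?_⟩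
  · constructor <;> linarith [ht₁.1, ht₁.2]
  · simpa using hp
  · refine (hc.comp_add (t₁ - t₀)).mono fun s hs ↦ ?_
    constructor <;> linarith [hs.1, hs.2]
  · constructor <;> linarith [ht.1, ht.2]
  · simpa [Function.comp_def, add_assoc] using htR
  · intro s hs
    refine hW _ ?_
    rw [mem_uIcc] at hs ⊢
    rcases hs with hs | hs
    · left; constructor <;> linarith [hs.1, hs.2]
    · right; constructor <;> linarith [hs.1, hs.2]

end Glue

/-! ### Flow boxes away from zeros, and functions constant along the field. -/

section Box

variable {E : Type*} [NormedAddCommGroup E] [NormedSpace ℝ E] [FiniteDimensional ℝ E]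
  {H : Type*} [TopologicalSpace H] [ChartedSpace E H] [IsManifold 𝓘(ℝ, E) ∞ H]
  {X : Π p : H, TangentSpace 𝓘(ℝ, E) p}
  {F : Type*} [NormedAddCommGroup F] [NormedSpace ℝ F] [FiniteDimensional ℝ F]

/-- Every point where the vector field does not vanish lies in a flow box. -/
theorem exists_isFlowBox_of_ne_zero {U : Set H} (hU : IsOpen U)
    (hX : ∀ p ∈ U, SmoothVectorAt X p) {G : H × F → F}
    (hG : ∀ p ∈ U, ∀ w, ContMDiffAt (𝓘(ℝ, E).prod 𝓘(ℝ, F)) 𝓘(ℝ, F) ∞ G (p, w)) (w₀ : F)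
    {p₀ : H} (hp₀ : p₀ ∈ U) (hX₀ : X p₀ ≠ 0) :
    ∃ (K : Submodule ℝ E) (ε : ℝ) (O : Set K) (Ψ : OpenPartialHomeomorph (ℝ × K) H) (y₀ : K),
      IsFlowBox X ε O Ψ ∧ y₀ ∈ O ∧ Ψ (0, y₀) = p₀ ∧ Ψ.target ⊆ U ∧
      ∃ w : H → F, w p₀ = w₀ ∧ (∀ p ∈ Ψ.target, ContMDiffAt 𝓘(ℝ, E) 𝓘(ℝ, F) ∞ w p) ∧
        ∀ y ∈ O, ∀ s ∈ Ioo (-ε) ε,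
          HasDerivAt (fun s ↦ w (Ψ (s, y))) (G (Ψ (s, y), w (Ψ (s, y)))) s := by
  let c := chartAt E p₀
  have hps : p₀ ∈ c.source := mem_chart_source E p₀
  let x₀ : E := chartField p₀ X (c p₀)
  obtain ⟨hd, hd'⟩ := mfderiv_chartAt_symm_chartField (X := X) (c.map_source hps)
  have hinv : c.symm (c p₀) = p₀ := c.left_inv hps
  let A : E →L[ℝ] E := mfderiv 𝓘(ℝ, E) 𝓘(ℝ, E) c.symm (c p₀)
  have hA : A x₀ = X (c.symm (c p₀)) := hd'
  have hAinj : Function.Injective A := by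
    have := isInvertible_mfderivWithin_extChartAt_symm (I := 𝓘(ℝ, E)) (x := p₀) (y := c p₀)
      (by simpa using c.map_source hps)
    simp only [modelWithCornersSelf_coe, range_id, mfderivWithin_univ] at this
    exact this.injective
  have hXn : X (c.symm (c p₀)) ≠ 0 := by rwa [hinv]
  have hx₀ : x₀ ≠ 0 := fun h ↦ hXn (by rw [← hA, h]; exact A.map_zero)
  -- A linear complement of the field's value, taken in the chart, supplies a transversal slice
  -- through the point.
  obtain ⟨K, hK⟩ := Submodule.exists_isCompl (Submodule.span ℝ {x₀})
  let j : K → H := fun y ↦ c.symm (c p₀ + y)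
  have hjs : ∀ᶠ y : K in 𝓝 0, ContMDiffAt 𝓘(ℝ, K) 𝓘(ℝ, E) ∞ j y ∧ True := by
    have h1 : ContDiff ℝ ∞ (fun y : K ↦ c p₀ + (y : E)) :=
      contDiff_const.add K.subtypeL.contDiff
    have h2 : ∀ᶠ y : K in 𝓝 0, c p₀ + (y : E) ∈ c.target :=
      h1.continuous.continuousAt.eventually_mem
        (c.open_target.mem_nhds (by simpa using c.map_source hps))
    filter_upwards [h2] with y hy
    exact ⟨(contMDiffAt_chartAt_symm p₀ hy).comp y h1.contDiffAt.contMDiffAt, trivial⟩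
  have hj0 : j 0 = p₀ := by simp [j, hinv]
  obtain ⟨ε, O, Ψ, hΨ, h0, ht, hj, w, hw0, hw, hwd⟩ := exists_isFlowBox (K := K) (y₀ := 0) hU hX hG
    w₀ hjs (by rwa [hj0]) (by
      rw [← Submodule.finrank_add_eq_of_isCompl hK, finrank_span_singleton hx₀, add_comm]) (by
      intro s y h
      have hder : mfderiv 𝓘(ℝ, K) 𝓘(ℝ, E) j 0 = A.comp K.subtypeL := by
        have h1 : HasMFDerivAt 𝓘(ℝ, K) 𝓘(ℝ, E) (fun y : K ↦ c p₀ + (y : E)) 0 K.subtypeL :=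
          (K.subtypeL.hasFDerivAt.const_add (c p₀)).hasMFDerivAt
        have h2 : HasMFDerivAt 𝓘(ℝ, E) 𝓘(ℝ, E) c.symm (c p₀ + ((0 : K) : E)) A := by
          rw [ZeroMemClass.coe_zero, add_zero]; exact hd
        exact (h2.comp (0 : K) h1).mfderiv
      let x : H → E := X
      have h3 : s • x (j 0) + A y = 0 :=
        (congrArg (fun B : K →L[ℝ] E ↦ s • x (j 0) + B y) hder).symm.trans h
      have h4 : A (s • x₀ + (y : E)) = 0 := by
        have hA' : A x₀ = x (j 0) := by rw [hj0]; exact hA.trans (congrArg x hinv)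
        rw [A.map_add, A.map_smul, hA']
        exact h3
      have h5 : s • x₀ + (y : E) = 0 := hAinj (h4.trans A.map_zero.symm)
      have h6 : (y : E) ∈ Submodule.span ℝ {x₀} := by
        rw [← neg_eq_of_add_eq_zero_right h5]
        exact neg_mem (Submodule.smul_mem _ _ (Submodule.mem_span_singleton_self x₀))
      have h7 : (y : E) = 0 := by
        have := hK.disjoint.le_bot ⟨h6, y.2⟩
        simpa using this
      rw [h7, add_zero, smul_eq_zero] at h5
      exact ⟨h5.resolve_right hx₀, by simpa using h7⟩)
  exact ⟨K, ε, O, Ψ, 0, hΨ, h0, (hj 0 h0).1.trans hj0, ht, w, by rw [← hj0, hw0], hw, hwd⟩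

/-- Functions constant along the vector field, in a flow box. -/
theorem IsFlowBox.exists_const_extension {K : Type*} [NormedAddCommGroup K] [NormedSpace ℝ K]
    {V : Type*} [NormedAddCommGroup V] [NormedSpace ℝ V] {ε : ℝ} {O : Set K}
    {Ψ : OpenPartialHomeomorph (ℝ × K) H} (hΨ : IsFlowBox X ε O Ψ) {u : H → V} {σ : ℝ}
    (hσ : σ ∈ Ioo (-ε) ε) {O' : Set K} (hO : O' ⊆ O)
    (hu : ∀ y ∈ O', ContMDiffAt 𝓘(ℝ, E) 𝓘(ℝ, V) ∞ u (Ψ (σ, y))) :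
    ∃ u' : H → V, (∀ y ∈ O', u' (Ψ (σ, y)) = u (Ψ (σ, y))) ∧
      ∀ q ∈ Ψ '' (Ioo (-ε) ε ×ˢ O'), ContMDiffAt 𝓘(ℝ, E) 𝓘(ℝ, V) ∞ u' q ∧
        mvfderiv 𝓘(ℝ, E) u' q (X q) = 0 := by
  have hin : ∀ {τ : ℝ} {y : K}, τ ∈ Ioo (-ε) ε → y ∈ O' → (τ, y) ∈ Ψ.source := fun h1 h2 ↦ by
    rw [hΨ.source_eq]; exact ⟨h1, hO h2⟩
  have hΨl : ∀ {τ : ℝ} {y : K}, τ ∈ Ioo (-ε) ε → y ∈ O' → Ψ.symm (Ψ (τ, y)) = (τ, y) :=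
    fun h1 h2 ↦ Ψ.left_inv (hin h1 h2)
  refine ⟨fun q ↦ u (Ψ (σ, (Ψ.symm q).2)), fun y hy ↦ by simp only [hΨl hσ hy], ?_⟩
  rintro _ ⟨⟨τ, y⟩, ⟨hτ, hy⟩, rfl⟩
  have hsm : ContMDiffAt 𝓘(ℝ, E) 𝓘(ℝ, V) ∞ (fun q ↦ u (Ψ (σ, (Ψ.symm q).2))) (Ψ (τ, y)) := by
    have h2 : ContMDiffAt 𝓘(ℝ, E) 𝓘(ℝ, ℝ × K) ∞ (fun q ↦ (σ, (Ψ.symm q).2)) (Ψ (τ, y)) := by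
      have h3 := hΨ.smooth_symm _ (Ψ.map_source (hin hτ hy))
      have h4 : ContDiff ℝ ∞ (fun z : ℝ × K ↦ (σ, z.2)) := contDiff_const.prodMk contDiff_snd
      exact h4.contDiffAt.contMDiffAt.comp _ h3
    have h5 : (σ, (Ψ.symm (Ψ (τ, y))).2) = (σ, y) := by rw [hΨl hτ hy]
    have h6 : ContMDiffAt 𝓘(ℝ, E) 𝓘(ℝ, E) ∞ (fun q ↦ Ψ (σ, (Ψ.symm q).2)) (Ψ (τ, y)) :=
      ContMDiffAt.comp (g := Ψ) _ (by rw [h5]; exact hΨ.smooth _ (hin hσ hy)) h2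
    exact ContMDiffAt.comp (g := u) _ (by rw [h5]; exact hu y hy) h6
  refine ⟨hsm, ?_⟩
  have h8 := hasDerivAt_comp_integralCurve (hΨ.integral y (hO hy)) hτ
    (hsm.mdifferentiableAt (by simp))
  have h9 : HasDerivAt (fun τ ↦ u (Ψ (σ, (Ψ.symm (Ψ (τ, y))).2))) 0 τ :=
    (hasDerivAt_const τ (u (Ψ (σ, y)))).congr_of_eventuallyEq (by
      filter_upwards [isOpen_Ioo.mem_nhds hτ] with τ' hτ'
      simp only [hΨl hτ' hy])
  exact h8.unique h9

/-- Turns a function constant along `X` into a section satisfying the local condition that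
characterises solutions in `IsTransport`. -/
theorem eventually_comp_inverse {V : Type*} [NormedAddCommGroup V] [NormedSpace ℝ V]
    {Vb : H → Type*} {e : Π q, Vb q → V} {e' : Π q, V → Vb q} {B B' : Set H} (hBB : B' ⊆ B)
    (he : ∀ q ∈ B, ∀ v, e q (e' q v) = v) (hB' : IsOpen B') {q : H} (hq : q ∈ B') {u : H → V}
    (hu : ∀ q ∈ B', ContMDiffAt 𝓘(ℝ, E) 𝓘(ℝ, V) ∞ u q ∧ mvfderiv 𝓘(ℝ, E) u q (X q) = 0) :
    ∀ᶠ q' in 𝓝 q, ContMDiffAt 𝓘(ℝ, E) 𝓘(ℝ, V) ∞ (fun z ↦ e z (e' z (u z))) q' ∧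
      mvfderiv 𝓘(ℝ, E) (fun z ↦ e z (e' z (u z))) q' (X q') = 0 := by
  filter_upwards [hB'.mem_nhds hq] with q' hq'
  have h : (fun z ↦ e z (e' z (u z))) =ᶠ[𝓝 q'] u := by
    filter_upwards [hB'.mem_nhds hq'] with z hz
    exact he z (hBB hz) _
  refine ⟨(hu q' hq').1.congr_of_eventuallyEq h, ?_⟩
  rw [← (hu q' hq').2]
  simp only [mvfderiv, h.mfderiv_eq]
  rfl

end Box

/-! ### Global solutions with initial values on a slice. -/

section Existence

variable {E : Type*} [NormedAddCommGroup E] [NormedSpace ℝ E] [FiniteDimensional ℝ E]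
  {H : Type*} [TopologicalSpace H] [T2Space H] [ChartedSpace E H] [IsManifold 𝓘(ℝ, E) ∞ H]
  {X : Π p : H, TangentSpace 𝓘(ℝ, E) p}
  {V : Type*} [NormedAddCommGroup V] [NormedSpace ℝ V]
  {Vb : H → Type*} {Sm P : (Π q, Vb q) → H → Prop} {R : Set H} {T₀ : Π q, Vb q}

/-- A solution on an open set all of whose points are joined to the slice `R` inside it, with
initial values `T₀`. -/
structure IsPartialSolution (X : Π p : H, TangentSpace 𝓘(ℝ, E) p) (P : (Π q, Vb q) → H → Prop)
    (R : Set H) (T₀ : Π q, Vb q) (W : Set H) (T : Π q, Vb q) : Prop where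
  isOpen : IsOpen W
  isJoined : ∀ q ∈ W, IsJoined X R W q
  solution : ∀ q ∈ W, P T q
  initial : ∀ q ∈ W, q ∈ R → T q = T₀ q

omit [FiniteDimensional ℝ E] [T2Space H] [IsManifold 𝓘(ℝ, E) ∞ H] in
theorem IsJoined.mono {W W' : Set H} {p : H} (h : IsJoined X R W p) (hW : W ⊆ W') :
    IsJoined X R W' p := by
  obtain ⟨a, b, t₁, t, c, ht₁, hp, hc, ht, htR, hW'⟩ := h
  exact ⟨a, b, t₁, t, c, ht₁, hp, hc, ht, htR, fun s hs ↦ hW (hW' s hs)⟩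

namespace IsPartialSolution

variable {W W' : Set H} {T T' : Π q, Vb q}

/-- The curves that join `q` to the slice in the two domains glue to one integral curve, so they
meet the slice at the same parameter. From that common point, where both solutions take the initial
value, agreement propagates back to `q` inside both domains. -/
theorem eq_of_mem (hP : IsTransport V X Sm P) (hX : ∀ p, SmoothVectorAt X p) (hR : IsSlice X R)
    (h : IsPartialSolution X P R T₀ W T) (h' : IsPartialSolution X P R T₀ W' T') {q : H}
    (hq : q ∈ W) (hq' : q ∈ W') : T q = T' q := by
  obtain ⟨a, b, t, c, h0, hc0, hc, ht, htR, hcW⟩ := (h.isJoined q hq).shift 0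
  obtain ⟨a', b', t', c', h0', hc0', hc', ht', htR', hcW'⟩ := (h'.isJoined q hq').shift 0
  obtain ⟨g, hg, hgc, hgc'⟩ := exists_glue_integralCurve hX hc hc' h0 h0' (hc0.trans hc0'.symm)
  have hsub : Ioo a b ⊆ Ioo (min a a') (max b b') :=
    Ioo_subset_Ioo (min_le_left _ _) (le_max_left _ _)
  have hsub' : Ioo a' b' ⊆ Ioo (min a a') (max b b') :=
    Ioo_subset_Ioo (min_le_right _ _) (le_max_right _ _)
  have htt : t = t' := hR.meets_once _ _ g hg t (hsub ht) t' (hsub' ht')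
    (by rwa [hgc ht]) (by rwa [hgc' ht'])
  subst htt
  have hs : ∀ s ∈ uIcc 0 t, g s ∈ W ∧ g s ∈ W' := fun s hs ↦
    ⟨by rw [hgc (ordConnected_Ioo.uIcc_subset h0 ht hs)]; exact hcW s hs,
      by rw [hgc' (ordConnected_Ioo.uIcc_subset h0' ht' hs)]; exact hcW' s hs⟩
  have hgt : g t ∈ R := by rwa [hgc ht]
  have := hP.eq_along hg (hsub ht) (hsub h0) (T := T) (T' := T')
    (fun s hs' ↦ by
      rw [uIcc_comm] at hs'
      exact ⟨h.solution _ (hs s hs').1, h'.solution _ (hs s hs').2⟩)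
    (by
      obtain ⟨h1, h2⟩ := hs t right_mem_uIcc
      rw [h.initial _ h1 hgt, h'.initial _ h2 hgt])
  rwa [hgc h0, hc0] at this

/-- Solutions extend through flow boxes. -/
theorem exists_extension (hP : IsTransport V X Sm P) (hX : ∀ p, SmoothVectorAt X p)
    (hX₀ : ∀ p, X p ≠ 0) (hR : IsSlice X R) (h : IsPartialSolution X P R T₀ W T) (p : H) :
    ∃ (δ : ℝ), 0 < δ ∧ ∀ (c : ℝ → H) (a b s₁ : ℝ),
      IsMIntegralCurveOn (I := 𝓘(ℝ, E)) c X (Ioo a b) → s₁ ∈ Ioo a b → c s₁ = p → ∀ s s',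
      s ∈ Ioo a b → s' ∈ Ioo a b → |s - s₁| < δ → |s' - s₁| < δ → c s ∈ W →
      ∃ W' T', IsPartialSolution X P R T₀ W' T' ∧ c s' ∈ W' := by
  obtain ⟨B, e, e', hB, hpB, he, he', hiff, -⟩ := hP p
  obtain ⟨K, ε, O, Ψ, y₀, hΨ, hy₀, hp, htgt, -⟩ := exists_isFlowBox_of_ne_zero (F := ℝ) hB
    (fun q _ ↦ hX q) (G := fun _ ↦ 0) (fun _ _ _ ↦ contMDiffAt_const) 0 hpB (hX₀ p)
  -- The half-length of a flow box at `p` works for every curve: while it is less than `ε` away in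
  -- time from `p`, the curve is the central curve of the box.
  refine ⟨ε, hΨ.pos, fun c a b s₁ hc hs₁ hcp s s' hs hs' hsε hsε' hcW ↦ ?_⟩
  have hin : ∀ {τ : ℝ} {y : K}, τ ∈ Ioo (-ε) ε → y ∈ O → (τ, y) ∈ Ψ.source := fun h1 h2 ↦ by
    rw [hΨ.source_eq]; exact ⟨h1, h2⟩
  have h0ε : (0 : ℝ) ∈ Ioo (-ε) ε := ⟨neg_lt_zero.2 hΨ.pos, hΨ.pos⟩
  -- the curve in the box
  have hcbox : ∀ τ ∈ Ioo a b, |τ - s₁| < ε → c τ = Ψ (τ - s₁, y₀) := by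
    intro τ hτ hτε
    have h1 := (hΨ.integral y₀ hy₀).comp_add (-s₁)
    have h2 : IsMIntegralCurveOn (I := 𝓘(ℝ, E)) ((fun s ↦ Ψ (s, y₀)) ∘ (· + -s₁)) X
        (Ioo (s₁ - ε) (s₁ + ε)) := h1.mono fun x hx ↦ by
      constructor <;> linarith [hx.1, hx.2]
    have hs₁' : s₁ ∈ Ioo (s₁ - ε) (s₁ + ε) := ⟨by linarith [hΨ.pos], by linarith [hΨ.pos]⟩
    obtain ⟨g, -, hg1, hg2⟩ := exists_glue_integralCurve hX hc h2 hs₁ hs₁' (by simp [hcp, hp])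
    have h3 : τ ∈ Ioo (s₁ - ε) (s₁ + ε) := by
      rw [abs_lt] at hτε
      constructor <;> linarith [hτε.1, hτε.2]
    rw [← hg1 hτ, hg2 h3]
    simp [sub_eq_add_neg]
  set σ := s - s₁ with hσ
  have hσε : σ ∈ Ioo (-ε) ε := abs_lt.1 hsε
  -- Only those box curves are kept that lie in `W` at time `σ`; the values of `T` there are spread
  -- over the entire box as constants of the trivialisation.
  let O' : Set K := {y | y ∈ O ∧ Ψ (σ, y) ∈ W}
  have hO' : IsOpen O' := by
    have h1 : ContinuousOn (fun y ↦ Ψ (σ, y)) O := Ψ.continuousOn.comp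
      (Continuous.prodMk_right σ).continuousOn fun y hy ↦ hin hσε hy
    exact h1.isOpen_inter_preimage hΨ.isOpen h.isOpen
  have hy₀' : y₀ ∈ O' := ⟨hy₀, by rw [← hcbox s hs hsε]; exact hcW⟩
  let B' : Set H := Ψ '' (Ioo (-ε) ε ×ˢ O')
  have hB' : IsOpen B' := Ψ.isOpen_image_of_subset_source (isOpen_Ioo.prod hO')
    fun z hz ↦ hin hz.1 hz.2.1
  have hB'B : B' ⊆ B := by
    rintro _ ⟨z, hz, rfl⟩
    exact htgt (Ψ.map_source (hin hz.1 hz.2.1))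
  have hΨt : ∀ {τ : ℝ} {y : K}, τ ∈ Ioo (-ε) ε → y ∈ O → Ψ (τ, y) ∈ Ψ.target :=
    fun h1 h2 ↦ Ψ.map_source (hin h1 h2)
  obtain ⟨u, hu, hu'⟩ := hΨ.exists_const_extension (O' := O')
    (u := fun z ↦ e z (T z)) hσε (fun y hy ↦ hy.1)
    fun y hy ↦ ((hiff _ _ (htgt (hΨt hσε hy.1))).1 (h.solution _ hy.2)).self_of_nhds.1
  let T' : Π q, Vb q := fun q ↦ e' q (u q)
  have hT'P : ∀ q ∈ B', P T' q := by
    intro q hq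
    rw [hiff _ _ (hB'B hq)]
    exact eventually_comp_inverse hB'B he hB' hq hu'
  have hTT' : ∀ {y : K}, y ∈ O' → T' (Ψ (σ, y)) = T (Ψ (σ, y)) := fun {y} hy ↦ by
    change e' _ (u _) = _
    rw [hu y hy, he' _ (htgt (hΨt hσε hy.1))]
  -- the box curves, continued to the slice
  have hbox : ∀ y ∈ O', ∃ (a b t : ℝ) (g : ℝ → H), IsMIntegralCurveOn (I := 𝓘(ℝ, E)) g X (Ioo a b) ∧
      Ioo (-ε) ε ⊆ Ioo a b ∧ t ∈ Ioo a b ∧ (∀ τ ∈ Ioo (-ε) ε, g τ = Ψ (τ, y)) ∧ g t ∈ R ∧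
      ∀ τ ∈ uIcc σ t, g τ ∈ W := by
    intro y hy
    obtain ⟨a, b, t, c, hσ', hc0, hc, ht, htR, hcW⟩ := (h.isJoined _ hy.2).shift σ
    obtain ⟨g, hg, hg1, hg2⟩ := exists_glue_integralCurve hX (hΨ.integral y hy.1) hc hσε hσ' hc0.symm
    refine ⟨_, _, t, g, hg, Ioo_subset_Ioo (min_le_left _ _) (le_max_left _ _),
      Ioo_subset_Ioo (min_le_right _ _) (le_max_right _ _) ht, fun τ hτ ↦ hg1 hτ,
      by rwa [hg2 ht], fun τ hτ ↦ ?_⟩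
    rw [hg2 (ordConnected_Ioo.uIcc_subset hσ' ht hτ)]
    exact hcW τ hτ
  have hboxB : ∀ {y : K}, y ∈ O' → ∀ {τ : ℝ}, τ ∈ Ioo (-ε) ε → ∀ s ∈ uIcc τ σ, s ∈ Ioo (-ε) ε ∧
      Ψ (s, y) ∈ B' := fun {y} hy {τ} hτ s hs ↦ by
    have := ordConnected_Ioo.uIcc_subset hτ hσε hs
    exact ⟨this, mem_image_of_mem Ψ (mk_mem_prod this hy)⟩
  -- A point at time `τ` in `W` has its own curve to the slice. Glued with the continued box curve
  -- it must reach the slice at the same parameter `t`, so `[σ, τ]` is covered by `[σ, t]` and `[t,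
  -- τ]`, and the box curve stays in `W` between `σ` and `τ`. Both solutions can then be compared
  -- from time `σ`.
  have hagree : ∀ q ∈ B', q ∈ W → T' q = T q := by
    rintro _ ⟨⟨τ, y⟩, ⟨hτ, hy⟩, rfl⟩ hqW
    obtain ⟨a, b, t, g, hg, hsub, ht, hgΨ, hgR, hgW⟩ := hbox y hy
    obtain ⟨a₁, b₁, t₁, c₁, hτ₁, hc0₁, hc₁, ht₁, htR₁, hcW₁⟩ := (h.isJoined _ hqW).shift τ
    obtain ⟨f, hf, hf1, hf2⟩ := exists_glue_integralCurve hX hg hc₁ (hsub hτ) hτ₁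
      (by rw [hgΨ τ hτ, hc0₁])
    have htt : t = t₁ := hR.meets_once _ _ f hf t
      (Ioo_subset_Ioo (min_le_left _ _) (le_max_left _ _) ht) t₁
      (Ioo_subset_Ioo (min_le_right _ _) (le_max_right _ _) ht₁) (by rwa [hf1 ht])
      (by rwa [hf2 ht₁])
    subst htt
    have key : ∀ s ∈ uIcc σ τ, Ψ (s, y) ∈ W := by
      intro s hs
      have hsε : s ∈ Ioo (-ε) ε := (hboxB hy hτ s (by rwa [uIcc_comm])).1
      have hs' : s ∈ uIcc σ t ∪ uIcc t τ := uIcc_subset_uIcc_union_uIcc hs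
      rcases hs' with hs' | hs'
      · rw [← hgΨ s hsε]; exact hgW s hs'
      · rw [← hgΨ s hsε, ← hf1 (hsub hsε), hf2 (ordConnected_Ioo.uIcc_subset ht₁ hτ₁ hs')]
        exact hcW₁ s (by rwa [uIcc_comm])
    exact hP.eq_along (hΨ.integral y hy.1) hσε hτ (fun s hs ↦
      ⟨hT'P _ (hboxB hy hτ s (by rwa [uIcc_comm])).2, h.solution _ (key s hs)⟩) (hTT' hy)
  classical
  let T'' : Π q, Vb q := fun q ↦ if q ∈ W then T q else T' q
  have hT''W : ∀ q ∈ W, T'' q = T q := fun q hq ↦ if_pos hq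
  have hT''B : ∀ q ∈ B', T'' q = T' q := fun q hq ↦ by
    by_cases hqW : q ∈ W
    · rw [hT''W q hqW, hagree q hq hqW]
    · exact if_neg hqW
  refine ⟨W ∪ B', T'', ⟨h.isOpen.union hB', ?_, ?_, ?_⟩, ?_⟩
  · rintro q (hq | ⟨⟨τ, y⟩, ⟨hτ, hy⟩, rfl⟩)
    · exact (h.isJoined q hq).mono subset_union_left
    · obtain ⟨a, b, t, g, hg, hsub, ht, hgΨ, hgR, hgW⟩ := hbox y hy
      refine ⟨a, b, τ, t, g, hsub hτ, hgΨ τ hτ, hg, ht, hgR, fun s hs ↦ ?_⟩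
      have hs' : s ∈ uIcc τ σ ∪ uIcc σ t := uIcc_subset_uIcc_union_uIcc hs
      rcases hs' with hs' | hs'
      · obtain ⟨h1, h2⟩ := hboxB hy hτ s hs'
        rw [hgΨ s h1]; exact Or.inr h2
      · exact Or.inl (hgW s hs')
  · rintro q (hq | hq)
    · refine hP.congr ?_ (h.solution q hq)
      filter_upwards [h.isOpen.mem_nhds hq] with z hz
      exact (hT''W z hz).symm
    · refine hP.congr ?_ (hT'P q hq)
      filter_upwards [hB'.mem_nhds hq] with z hz
      exact (hT''B z hz).symm
  · rintro q (hq | ⟨⟨τ, y⟩, ⟨hτ, hy⟩, rfl⟩) hqR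
    · rw [hT''W q hq]; exact h.initial q hq hqR
    · obtain ⟨a, b, t, g, hg, hsub, ht, hgΨ, hgR, hgW⟩ := hbox y hy
      -- The continued box curve meets the slice only at `t`, inside `W`; hence the added box
      -- contributes no new points of the slice.
      have htt : τ = t := hR.meets_once _ _ g hg τ (hsub hτ) t ht (by rwa [hgΨ τ hτ]) hgR
      have hqW : Ψ (τ, y) ∈ W := by
        rw [← hgΨ τ hτ, htt]
        exact hgW t right_mem_uIcc
      rw [hT''W _ hqW]; exact h.initial _ hqW hqR
  · refine Or.inr ⟨(s' - s₁, y₀), ⟨abs_lt.1 hsε', hy₀'⟩, ?_⟩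
    exact (hcbox s' hs' hsε').symm

end IsPartialSolution

/-- Solutions of a transport equation with initial data on a slice. -/
theorem IsTransport.exists_solution (hP : IsTransport V X Sm P) (hX : ∀ p, SmoothVectorAt X p)
    (hX₀ : ∀ p, X p ≠ 0) (hR : IsSlice X R)
    (hinit : ∀ p ∈ R, ∃ W T, IsPartialSolution X P R T₀ W T ∧ p ∈ W) :
    ∃ T : Π q, Vb q, (∀ q, P T q) ∧ ∀ q ∈ R, T q = T₀ q := by
  classical
  let Wu : Set H := {q | ∃ W T, IsPartialSolution X P R T₀ W T ∧ q ∈ W}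
  let Tu : Π q, Vb q := fun q ↦ if h : q ∈ Wu then h.choose_spec.choose q else T₀ q
  -- The union of all partial solutions is single-valued by `eq_of_mem`, whichever one is chosen at
  -- each point.
  have hT : ∀ {W T}, IsPartialSolution X P R T₀ W T → ∀ q ∈ W, Tu q = T q := by
    intro W T hWT q hq
    have hqW : q ∈ Wu := ⟨W, T, hWT, hq⟩
    have h1 := hqW.choose_spec.choose_spec
    have h2 : Tu q = hqW.choose_spec.choose q := dif_pos hqW
    rw [h2]
    exact h1.1.eq_of_mem hP hX hR hWT h1.2 hq
  have hsol : IsPartialSolution X P R T₀ Wu Tu := by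
    refine ⟨?_, ?_, ?_, ?_⟩
    · rw [isOpen_iff_mem_nhds]
      rintro q ⟨W, T, hWT, hq⟩
      filter_upwards [hWT.isOpen.mem_nhds hq] with z hz
      exact ⟨W, T, hWT, hz⟩
    · rintro q ⟨W, T, hWT, hq⟩
      exact (hWT.isJoined q hq).mono fun z hz ↦ ⟨W, T, hWT, hz⟩
    · rintro q ⟨W, T, hWT, hq⟩
      refine hP.congr ?_ (hWT.solution q hq)
      filter_upwards [hWT.isOpen.mem_nhds hq] with z hz
      exact (hT hWT z hz).symm
    · rintro q ⟨W, T, hWT, hq⟩ hqR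
      rw [hT hWT q hq]
      exact hWT.initial q hq hqR
  have hall : ∀ p, p ∈ Wu := by
    intro p
    obtain ⟨a, b, c, ha, hb, hp, hc, t, ht, htR⟩ := hR.meets p
    rw [← hp]
    -- The extension works both towards and away from the centre of a flow box, so membership in the
    -- union is open and closed along the curve from the slice to `p`.
    refine isPreconnected_Ioo.induction₂' (fun x y ↦ c x ∈ Wu → c y ∈ Wu) (fun s₁ hs₁ ↦ ?_)
      (fun _ _ _ _ _ _ h1 h2 h ↦ h2 (h1 h)) ht ⟨ha, hb⟩ (hinit _ htR)
    obtain ⟨δ, hδ, hext⟩ := hsol.exists_extension hP hX hX₀ hR (c s₁)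
    have h1 : ∀ᶠ s in 𝓝[Ioo a b] s₁, |s - s₁| < δ :=
      nhdsWithin_le_nhds (Metric.ball_mem_nhds s₁ hδ)
    have h0 : |s₁ - s₁| < δ := by simpa using hδ
    filter_upwards [h1, self_mem_nhdsWithin] with s hs hs'
    exact ⟨fun h ↦ hext c a b s₁ hc hs₁ rfl s₁ s hs₁ hs' h0 hs h,
      fun h ↦ hext c a b s₁ hc hs₁ rfl s s₁ hs' hs₁ hs h0 h⟩
  exact ⟨Tu, fun q ↦ hsol.solution q (hall q), fun q hq ↦ hsol.initial q (hall q) hq⟩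

/-- Solutions of a transport equation near a point of the slice. -/
theorem IsTransport.exists_isPartialSolution (hP : IsTransport V X Sm P)
    (hX : ∀ p, SmoothVectorAt X p) (hR : IsSlice X R) {K : Type*} [NormedAddCommGroup K]
    [NormedSpace ℝ K] [FiniteDimensional ℝ K] {j : K → H} {y₀ : K} {T₁ : Π q, Vb q}
    (hj : ∀ᶠ y in 𝓝 y₀, ContMDiffAt 𝓘(ℝ, K) 𝓘(ℝ, E) ∞ j y ∧ j y ∈ R ∧ T₁ (j y) = T₀ (j y))
    (hdim : Module.finrank ℝ E = Module.finrank ℝ K + 1)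
    (hinj : ∀ (s : ℝ) (y : K), s • X (j y₀) + mfderiv 𝓘(ℝ, K) 𝓘(ℝ, E) j y₀ y = 0 →
      s = 0 ∧ y = 0) (hT₁ : ∀ᶠ q in 𝓝 (j y₀), Sm T₁ q) :
    ∃ W T, IsPartialSolution X P R T₀ W T ∧ j y₀ ∈ W := by
  obtain ⟨B, e, e', hB, hpB, he, he', hiff, hSm⟩ := hP (j y₀)
  obtain ⟨B₁, hB₁, hB₁o, hpB₁⟩ := eventually_nhds_iff.1 hT₁
  obtain ⟨ε, O, Ψ, hΨ, hy₀, htgt, hjO, -⟩ := exists_isFlowBox (F := ℝ) (hB.inter hB₁o)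
    (fun q _ ↦ hX q) (G := fun _ ↦ 0) (fun _ _ _ ↦ contMDiffAt_const) 0 hj ⟨hpB, hpB₁⟩ hdim hinj
  have hin : ∀ {τ : ℝ} {y : K}, τ ∈ Ioo (-ε) ε → y ∈ O → Ψ (τ, y) ∈ Ψ.target := fun h1 h2 ↦
    Ψ.map_source (by rw [hΨ.source_eq]; exact ⟨h1, h2⟩)
  have h0ε : (0 : ℝ) ∈ Ioo (-ε) ε := ⟨neg_lt_zero.2 hΨ.pos, hΨ.pos⟩
  have himg : Ψ '' (Ioo (-ε) ε ×ˢ O) = Ψ.target := by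
    rw [← hΨ.source_eq, Ψ.image_source_eq_target]
  obtain ⟨u, hu, hu'⟩ := hΨ.exists_const_extension (u := fun z ↦ e z (T₁ z))
    h0ε subset_rfl
    fun y hy ↦ hSm _ _ (htgt (hin h0ε hy)).1 (hB₁ _ (htgt (hin h0ε hy)).2)
  rw [himg] at hu'
  refine ⟨Ψ.target, fun q ↦ e' q (u q), ⟨Ψ.open_target, ?_, ?_, ?_⟩, ?_⟩
  · rw [← himg]
    rintro _ ⟨⟨τ, y⟩, ⟨hτ, hy⟩, rfl⟩
    refine ⟨-ε, ε, τ, 0, _, hτ, rfl, hΨ.integral y hy, h0ε, ?_, fun s hs ↦ ?_⟩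
    · rw [(hjO y hy).1]; exact (hjO y hy).2.1
    · rw [himg]; exact hin (ordConnected_Ioo.uIcc_subset hτ h0ε hs) hy
  · intro q hq
    rw [hiff _ _ (htgt hq).1]
    exact eventually_comp_inverse (fun z hz ↦ (htgt hz).1) he Ψ.open_target hq hu'
  · rw [← himg]
    rintro _ ⟨⟨τ, y⟩, ⟨hτ, hy⟩, rfl⟩ hqR
    have h0 := (hjO y hy).1
    have hτ0 : τ = 0 := hR.meets_once _ _ _ (hΨ.integral y hy) τ hτ 0 h0ε hqR
      (by rw [h0]; exact (hjO y hy).2.1)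
    subst hτ0
    change e' _ (u _) = _
    rw [hu y hy, he' _ (htgt (hin h0ε hy)).1, h0, (hjO y hy).2.2]
  · rw [← (hjO y₀ hy₀).1]
    exact hin h0ε hy₀

end Existence

/-! ### Smooth fields, their brackets and directional derivatives. -/

section Calculus

variable {d : ℕ} {M : Type*} [TopologicalSpace M] [ChartedSpace (EuclideanSpace ℝ (Fin d)) M]
  [IsManifold (𝓡 d) ∞ M]

/-- Smoothness of a function at a point. -/
abbrev SmoothFnAt (d : ℕ) {M : Type*} [TopologicalSpace M]
    [ChartedSpace (EuclideanSpace ℝ (Fin d)) M] (u : M → ℝ) (p : M) : Prop :=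
  ContMDiffAt (𝓡 d) 𝓘(ℝ, ℝ) ∞ u p

/-- Smoothness of a one-form at a point. -/
abbrev SmoothOneAt (θ : Π q : M, TangentSpace (𝓡 d) q →L[ℝ] ℝ) (p : M) : Prop :=
  ContMDiffAt (𝓡 d) ((𝓡 d).prod 𝓘(ℝ, EuclideanSpace ℝ (Fin d) →L[ℝ] ℝ)) ∞
    (fun q ↦ Bundle.TotalSpace.mk' (EuclideanSpace ℝ (Fin d) →L[ℝ] ℝ)
      (E := fun q : M ↦ TangentSpace (𝓡 d) q →L[ℝ] ℝ) q (θ q)) p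

/-- Smoothness of a `(0,2)` tensor field at a point. -/
abbrev SmoothTwoAt
    (T : Π q : M, TangentSpace (𝓡 d) q →L[ℝ] TangentSpace (𝓡 d) q →L[ℝ] ℝ) (p : M) : Prop :=
  ContMDiffAt (𝓡 d)
    ((𝓡 d).prod 𝓘(ℝ, EuclideanSpace ℝ (Fin d) →L[ℝ] EuclideanSpace ℝ (Fin d) →L[ℝ] ℝ)) ∞
    (fun q ↦ Bundle.TotalSpace.mk' (EuclideanSpace ℝ (Fin d) →L[ℝ] EuclideanSpace ℝ (Fin d) →L[ℝ] ℝ)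
      (E := fun q : M ↦ TangentSpace (𝓡 d) q →L[ℝ] TangentSpace (𝓡 d) q →L[ℝ] ℝ) q (T q)) p

theorem SmoothTwoAt.apply {T : Π q : M, TangentSpace (𝓡 d) q →L[ℝ] TangentSpace (𝓡 d) q →L[ℝ] ℝ}
    {p : M} {V W : Π q : M, TangentSpace (𝓡 d) q} (hT : SmoothTwoAt T p) (hV : SmoothVectorAt V p)
    (hW : SmoothVectorAt W p) : SmoothFnAt d (fun q ↦ T q (V q) (W q)) p := by
  have : ContMDiffAt (𝓡 d) ((𝓡 d).prod 𝓘(ℝ, ℝ)) ∞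
      (fun m ↦ Bundle.TotalSpace.mk' ℝ (E := Bundle.Trivial M ℝ) m (T m (V m) (W m))) p :=
    ContMDiffAt.clm_bundle_apply₂ (F₁ := EuclideanSpace ℝ (Fin d))
      (F₂ := EuclideanSpace ℝ (Fin d)) hT hV hW
  rw [Bundle.contMDiffAt_totalSpace] at this
  exact this.2

theorem SmoothOneAt.apply {θ : Π q : M, TangentSpace (𝓡 d) q →L[ℝ] ℝ}
    {p : M} {V : Π q : M, TangentSpace (𝓡 d) q} (hθ : SmoothOneAt θ p) (hV : SmoothVectorAt V p) :
    SmoothFnAt d (fun q ↦ θ q (V q)) p := by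
  have : ContMDiffAt (𝓡 d) ((𝓡 d).prod 𝓘(ℝ, ℝ)) ∞
      (fun m ↦ Bundle.TotalSpace.mk' ℝ (E := Bundle.Trivial M ℝ) m (θ m (V m))) p :=
    ContMDiffAt.clm_bundle_apply (F₁ := EuclideanSpace ℝ (Fin d)) hθ hV
  rw [Bundle.contMDiffAt_totalSpace] at this
  exact this.2

theorem SmoothVectorAt.diffAt {V : Π q : M, TangentSpace (𝓡 d) q} {p : M}
    (hV : SmoothVectorAt V p) : DiffAt V p := hV.mdifferentiableAt (by simp)

theorem SmoothVectorAt.eventually_diffAt {V : Π q : M, TangentSpace (𝓡 d) q} {p : M}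
    (hV : SmoothVectorAt V p) : ∀ᶠ q in 𝓝 p, DiffAt V q := by
  have h : ContMDiffAt (𝓡 d) ((𝓡 d).prod (𝓡 d)) 1 (fun q ↦ Bundle.TotalSpace.mk'
    (EuclideanSpace ℝ (Fin d)) q (V q)) p := hV.of_le (by simp)
  filter_upwards [(contMDiffAt_iff_contMDiffAt_nhds (by simp)).1 h] with q hq
  exact hq.mdifferentiableAt (by simp)

theorem SmoothVectorAt.add {V W : Π q : M, TangentSpace (𝓡 d) q} {p : M}
    (hV : SmoothVectorAt V p) (hW : SmoothVectorAt W p) :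
    SmoothVectorAt (fun q ↦ V q + W q) p := hV.add_section hW

theorem SmoothVectorAt.smul {u : M → ℝ} {W : Π q : M, TangentSpace (𝓡 d) q} {p : M}
    (hu : SmoothFnAt d u p) (hW : SmoothVectorAt W p) :
    SmoothVectorAt (fun q ↦ u q • W q) p := ContMDiffAt.smul_section hu hW

theorem SmoothVectorAt.sum {ι : Type*} {s : Finset ι} {V : ι → Π q : M, TangentSpace (𝓡 d) q}
    {p : M} (hV : ∀ i, SmoothVectorAt (V i) p) :
    SmoothVectorAt (fun q ↦ ∑ i ∈ s, V i q) p := ContMDiffAt.sum_section fun i _ ↦ hV i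

theorem SmoothVectorAt.bracket {V W : Π q : M, TangentSpace (𝓡 d) q} {p : M}
    (hV : SmoothVectorAt V p) (hW : SmoothVectorAt W p) :
    SmoothVectorAt (bracket V W) p := by
  have : IsManifold (𝓡 d) (((⊤ : ℕ∞) : ℕ∞ω) + 1) M := IsManifold.of_le (n := ∞) (by simp)
  have : IsManifold (𝓡 d) (minSmoothness ℝ 2) M :=
    IsManifold.of_le (n := ∞) (by
      rw [minSmoothness_of_isRCLikeNormedField]
      exact WithTop.coe_le_coe.2 (le_top : (2 : ℕ∞) ≤ ⊤))
  exact ContMDiffAt.mlieBracket_vectorField (m := ⊤) (n := ⊤) hV hW (by simp)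

theorem smoothVectorAt_ext {p : M} (v : TangentSpace (𝓡 d) p) : SmoothVectorAt (ext v) p :=
  FiberBundle.contMDiffAt_extend ..

theorem SmoothFnAt.dirDeriv {u : M → ℝ} {p : M} {V : Π q : M, TangentSpace (𝓡 d) q}
    (hu : SmoothFnAt d u p) (hV : SmoothVectorAt V p) :
    SmoothFnAt d (fun q ↦ dirDeriv u q (V q)) p := by
  have h1 := ContMDiffAt.mfderiv_const (m := ∞) hu (by simp)
  have h2 := ContMDiffAt.clm_apply_of_inCoordinates (b₁ := id) (b₂ := u)
    (ϕ := fun q ↦ mfderiv (𝓡 d) 𝓘(ℝ, ℝ) u q) (v := V) (m₀ := p) h1 hV hu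
  rw [Bundle.contMDiffAt_totalSpace] at h2
  refine h2.2.congr_of_eventuallyEq (Eventually.of_forall fun q ↦ ?_)
  simp [NullData.dirDeriv, mvfderiv]
  rfl

end Calculus

/-! ### Coordinate frames and smoothness tests for tensor fields. -/

section Frames

variable {d : ℕ} {M : Type*} [TopologicalSpace M] [ChartedSpace (EuclideanSpace ℝ (Fin d)) M]
  [IsManifold (𝓡 d) ∞ M]

/-- The frame of the tangent bundle given by the chart at `p₀`. -/
noncomputable def coordFrame (p₀ : M) (i : Fin d) (q : M) : TangentSpace (𝓡 d) q :=
  (trivializationAt (EuclideanSpace ℝ (Fin d)) (TangentSpace (𝓡 d)) p₀).localFrame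
    (EuclideanSpace.basisFun (Fin d) ℝ).toBasis i q

/-- The basis of a tangent space given by the chart at `p₀`. -/
noncomputable def coordBasis (p₀ : M) {q : M} (hq : q ∈ (chartAt (EuclideanSpace ℝ (Fin d)) p₀).source) :
    Module.Basis (Fin d) ℝ (TangentSpace (𝓡 d) q) :=
  (trivializationAt (EuclideanSpace ℝ (Fin d)) (TangentSpace (𝓡 d)) p₀).basisAt
    (EuclideanSpace.basisFun (Fin d) ℝ).toBasis (by rwa [TangentBundle.trivializationAt_baseSet])

theorem coordBasis_apply (p₀ : M) {q : M}
    (hq : q ∈ (chartAt (EuclideanSpace ℝ (Fin d)) p₀).source) (i : Fin d) :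
    coordBasis p₀ hq i = coordFrame p₀ i q :=
  (Bundle.Trivialization.localFrame_apply_of_mem_baseSet _ _
    (by rwa [TangentBundle.trivializationAt_baseSet])).symm

/-- The components of a tangent vector in the chart at `p₀`. -/
noncomputable def coordCoeff (p₀ : M) (i : Fin d) (q : M) : TangentSpace (𝓡 d) q →ₗ[ℝ] ℝ :=
  (trivializationAt (EuclideanSpace ℝ (Fin d)) (TangentSpace (𝓡 d)) p₀).localFrameCoeff (𝓡 d)
    (EuclideanSpace.basisFun (Fin d) ℝ).toBasis i q

theorem smoothVectorAt_coordFrame (p₀ : M) {q : M}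
    (hq : q ∈ (chartAt (EuclideanSpace ℝ (Fin d)) p₀).source) (i : Fin d) :
    SmoothVectorAt (coordFrame p₀ i) q :=
  contMDiffAt_localFrame_of_mem ∞ _ _ i (by rwa [TangentBundle.trivializationAt_baseSet])

theorem smoothVectorAt_iff_coordCoeff (p₀ : M) {q : M}
    (hq : q ∈ (chartAt (EuclideanSpace ℝ (Fin d)) p₀).source) {V : Π q : M, TangentSpace (𝓡 d) q} :
    SmoothVectorAt V q ↔ ∀ i, SmoothFnAt d (fun z ↦ coordCoeff p₀ i z (V z)) q :=
  contMDiffAt_iff_localFrameCoeff (𝕜 := ℝ) (I := 𝓡 d) (k := ∞)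
    (e := trivializationAt (EuclideanSpace ℝ (Fin d)) (TangentSpace (𝓡 d)) p₀)
    (EuclideanSpace.basisFun (Fin d) ℝ).toBasis (by rwa [TangentBundle.trivializationAt_baseSet])

theorem eq_sum_coordCoeff (p₀ : M) {q : M}
    (hq : q ∈ (chartAt (EuclideanSpace ℝ (Fin d)) p₀).source) (v : TangentSpace (𝓡 d) q) :
    v = ∑ i, coordCoeff p₀ i q v • coordFrame p₀ i q := by
  classical
  -- The expansion is stated for sections, so `v` is extended by zero off `q`; it is pointwise and
  -- asks for no regularity.
  have := Bundle.Trivialization.eq_sum_localFrameCoeff_smul (𝕜 := ℝ) (I := 𝓡 d)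
    (e := trivializationAt (EuclideanSpace ℝ (Fin d)) (TangentSpace (𝓡 d)) p₀)
    (b := (EuclideanSpace.basisFun (Fin d) ℝ).toBasis) (x' := q)
    (s := fun z ↦ if h : z = q then h ▸ v else 0)
    (by rwa [TangentBundle.trivializationAt_baseSet])
  simpa [coordCoeff, coordFrame] using this

theorem coordCoeff_coordFrame (p₀ : M) {q : M}
    (hq : q ∈ (chartAt (EuclideanSpace ℝ (Fin d)) p₀).source) (i j : Fin d) :
    coordCoeff p₀ i q (coordFrame p₀ j q) = if j = i then 1 else 0 := by
  have h : q ∈ (trivializationAt (EuclideanSpace ℝ (Fin d)) (TangentSpace (𝓡 d)) p₀).baseSet := by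
    rwa [TangentBundle.trivializationAt_baseSet]
  refine (Bundle.Trivialization.localFrameCoeff_apply_of_mem_baseSet _ _ h
    (coordFrame p₀ j) i).trans ?_
  have h2 := coordBasis_apply p₀ hq j
  rw [← h2]
  exact (Module.Basis.repr_self_apply _ _ _)

theorem eventually_mem_chartAt_source (p : M) :
    ∀ᶠ q in 𝓝 p, q ∈ (chartAt (EuclideanSpace ℝ (Fin d)) p).source :=
  (chartAt (EuclideanSpace ℝ (Fin d)) p).open_source.mem_nhds (mem_chart_source _ p)

variable {F₂ : Type*} [NormedAddCommGroup F₂] [NormedSpace ℝ F₂] {E₂ : M → Type*}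
  [TopologicalSpace (Bundle.TotalSpace F₂ E₂)] [∀ x, AddCommGroup (E₂ x)] [∀ x, Module ℝ (E₂ x)]
  [∀ x, TopologicalSpace (E₂ x)] [∀ x, IsTopologicalAddGroup (E₂ x)]
  [∀ x, ContinuousSMul ℝ (E₂ x)] [FiberBundle F₂ E₂] [VectorBundle ℝ F₂ E₂]

/-- A section of the bundle of linear maps on the tangent bundle is smooth if its values on a frame
are smooth. -/
theorem contMDiffAt_hom_of_coordFrame {Φ : Π q : M, TangentSpace (𝓡 d) q →L[ℝ] E₂ q} {p : M}
    (h : ∀ i, ContMDiffAt (𝓡 d) ((𝓡 d).prod 𝓘(ℝ, F₂)) ∞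
      (fun q ↦ Bundle.TotalSpace.mk' F₂ q (Φ q (coordFrame p i q))) p) :
    ContMDiffAt (𝓡 d) ((𝓡 d).prod 𝓘(ℝ, EuclideanSpace ℝ (Fin d) →L[ℝ] F₂)) ∞
      (fun q ↦ Bundle.TotalSpace.mk' (EuclideanSpace ℝ (Fin d) →L[ℝ] F₂)
        (E := fun q : M ↦ TangentSpace (𝓡 d) q →L[ℝ] E₂ q) q (Φ q)) p := by
  rw [contMDiffAt_hom_bundle]
  refine ⟨contMDiffAt_id, ?_⟩
  have h2 : ∀ i, ContMDiffAt (𝓡 d) 𝓘(ℝ, F₂) ∞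
      (fun q ↦ (trivializationAt F₂ E₂ p ⟨q, Φ q (coordFrame p i q)⟩).2) p := fun i ↦
    ((Bundle.contMDiffAt_totalSpace).1 (h i)).2
  let b := (EuclideanSpace.basisFun (Fin d) ℝ).toBasis
  have h3 : ContMDiffAt (𝓡 d) 𝓘(ℝ, EuclideanSpace ℝ (Fin d) →L[ℝ] F₂) ∞
      (fun q ↦ ∑ i, (EuclideanSpace.proj i : EuclideanSpace ℝ (Fin d) →L[ℝ] ℝ).smulRight
        (trivializationAt F₂ E₂ p ⟨q, Φ q (coordFrame p i q)⟩).2) p := by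
    refine ContMDiffAt.sum fun i _ ↦ ?_
    let L : F₂ →L[ℝ] (EuclideanSpace ℝ (Fin d) →L[ℝ] F₂) :=
      ContinuousLinearMap.smulRightL ℝ _ _ (EuclideanSpace.proj i)
    exact L.contDiff.contDiffAt.contMDiffAt.comp p (h2 i)
  refine h3.congr_of_eventuallyEq ?_
  filter_upwards [eventually_mem_chartAt_source (d := d) p,
    (trivializationAt F₂ E₂ p).open_baseSet.mem_nhds
      (FiberBundle.mem_baseSet_trivializationAt' p)] with q hq hq2
  have hq' : q ∈ (trivializationAt (EuclideanSpace ℝ (Fin d)) (TangentSpace (𝓡 d)) p).baseSet := by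
    rwa [TangentBundle.trivializationAt_baseSet]
  rw [ContinuousLinearMap.inCoordinates_eq hq' hq2]
  ext x
  have hx : x = ∑ i, x i • b i := by
    simpa [b] using ((EuclideanSpace.basisFun (Fin d) ℝ).sum_repr x).symm
  have hb : ∀ i, (Bundle.Trivialization.continuousLinearEquivAt ℝ
      (trivializationAt (EuclideanSpace ℝ (Fin d)) (TangentSpace (𝓡 d)) p) q hq').symm (b i)
      = coordFrame p i q := fun i ↦ (coordBasis_apply p hq i)
  conv_lhs => rw [hx]
  simp only [ContinuousLinearMap.comp_apply, map_sum, map_smul, ContinuousLinearEquiv.coe_coe, hb]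
  simp

theorem smoothOneAt_of_apply {θ : Π q : M, TangentSpace (𝓡 d) q →L[ℝ] ℝ} {p : M}
    (h : ∀ V : Π q : M, TangentSpace (𝓡 d) q, SmoothVectorAt V p →
      SmoothFnAt d (fun q ↦ θ q (V q)) p) : SmoothOneAt θ p := by
  refine contMDiffAt_hom_of_coordFrame (E₂ := Bundle.Trivial M ℝ) fun i ↦ ?_
  rw [Bundle.contMDiffAt_totalSpace]
  exact ⟨contMDiffAt_id, h _ (smoothVectorAt_coordFrame p (mem_chart_source _ p) i)⟩

theorem smoothTwoAt_of_apply
    {T : Π q : M, TangentSpace (𝓡 d) q →L[ℝ] TangentSpace (𝓡 d) q →L[ℝ] ℝ} {p : M}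
    (h : ∀ V W : Π q : M, TangentSpace (𝓡 d) q, SmoothVectorAt V p → SmoothVectorAt W p →
      SmoothFnAt d (fun q ↦ T q (V q) (W q)) p) : SmoothTwoAt T p :=
  contMDiffAt_hom_of_coordFrame (E₂ := fun q : M ↦ TangentSpace (𝓡 d) q →L[ℝ] ℝ) fun i ↦
    smoothOneAt_of_apply fun W hW ↦
      h _ W (smoothVectorAt_coordFrame p (mem_chart_source _ p) i) hW

/-- The frame may be centred at a point other than `p`; this allows one chart to be used on its
whole domain in transport equations. -/
theorem smoothTwoAt_of_coordFrame
    {T : Π q : M, TangentSpace (𝓡 d) q →L[ℝ] TangentSpace (𝓡 d) q →L[ℝ] ℝ} {p₀ p : M}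
    (hp : p ∈ (chartAt (EuclideanSpace ℝ (Fin d)) p₀).source)
    (h : ∀ i j, SmoothFnAt d (fun q ↦ T q (coordFrame p₀ i q) (coordFrame p₀ j q)) p) :
    SmoothTwoAt T p := by
  refine smoothTwoAt_of_apply fun V W hV hW ↦ ?_
  have h1 : SmoothFnAt d (fun q ↦ ∑ i, ∑ j, coordCoeff p₀ i q (V q) * (coordCoeff p₀ j q (W q) *
      T q (coordFrame p₀ i q) (coordFrame p₀ j q))) p :=
    ContMDiffAt.sum fun i _ ↦ ContMDiffAt.sum fun j _ ↦
      ((smoothVectorAt_iff_coordCoeff p₀ hp).1 hV i).mul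
        (((smoothVectorAt_iff_coordCoeff p₀ hp).1 hW j).mul (h i j))
  refine h1.congr_of_eventuallyEq ?_
  filter_upwards [(chartAt (EuclideanSpace ℝ (Fin d)) p₀).open_source.mem_nhds hp] with q hq
  conv_lhs => rw [eq_sum_coordCoeff p₀ hq (V q), eq_sum_coordCoeff p₀ hq (W q)]
  simp only [map_sum, map_smul, sum_apply, smul_apply,
    smul_eq_mul, Finset.mul_sum]
  rw [Finset.sum_comm]
  refine Finset.sum_congr rfl fun i _ ↦ Finset.sum_congr rfl fun j _ ↦ ?_
  ring

end Frames

/-! ### Lie, exterior and covariant derivatives as tensor fields. -/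

section Tensoriality

variable {d : ℕ} {M : Type*} [TopologicalSpace M] [ChartedSpace (EuclideanSpace ℝ (Fin d)) M]
  [IsManifold (𝓡 d) ∞ M]

variable {T : Π q : M, TangentSpace (𝓡 d) q →L[ℝ] TangentSpace (𝓡 d) q →L[ℝ] ℝ}
  {θ : Π q : M, TangentSpace (𝓡 d) q →L[ℝ] ℝ} {p : M} {X V W : Π q : M, TangentSpace (𝓡 d) q}

theorem SmoothTwoAt.mdifferentiableAt (hT : SmoothTwoAt T p) (hV : DiffAt V p) (hW : DiffAt W p) :
    MDifferentiableAt (𝓡 d) 𝓘(ℝ, ℝ) (fun q ↦ T q (V q) (W q)) p := by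
  have : MDifferentiableAt (𝓡 d) ((𝓡 d).prod 𝓘(ℝ, ℝ))
      (fun m ↦ Bundle.TotalSpace.mk' ℝ (E := Bundle.Trivial M ℝ) m (T m (V m) (W m))) p := by
    apply MDifferentiableAt.clm_bundle_apply₂ (F₁ := EuclideanSpace ℝ (Fin d))
      (F₂ := EuclideanSpace ℝ (Fin d))
    · exact ContMDiffAt.mdifferentiableAt hT (by simp)
    · exact hV
    · exact hW
  simp only [mdifferentiableAt_totalSpace] at this
  exact this.2

theorem SmoothOneAt.mdifferentiableAt (hθ : SmoothOneAt θ p) (hV : DiffAt V p) :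
    MDifferentiableAt (𝓡 d) 𝓘(ℝ, ℝ) (fun q ↦ θ q (V q)) p := by
  have : MDifferentiableAt (𝓡 d) ((𝓡 d).prod 𝓘(ℝ, ℝ))
      (fun m ↦ Bundle.TotalSpace.mk' ℝ (E := Bundle.Trivial M ℝ) m (θ m (V m))) p := by
    apply MDifferentiableAt.clm_bundle_apply (F₁ := EuclideanSpace ℝ (Fin d))
    · exact ContMDiffAt.mdifferentiableAt hθ (by simp)
    · exact hV
  simp only [mdifferentiableAt_totalSpace] at this
  exact this.2

theorem dirDeriv_mul {u v : M → ℝ} (hu : MDifferentiableAt (𝓡 d) 𝓘(ℝ, ℝ) u p)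
    (hv : MDifferentiableAt (𝓡 d) 𝓘(ℝ, ℝ) v p) (w : TangentSpace (𝓡 d) p) :
    dirDeriv (fun q ↦ u q * v q) p w = u p * dirDeriv v p w + v p * dirDeriv u p w := by
  simp [dirDeriv, mvfderiv_fun_mul hu hv]

theorem dirDeriv_add {u v : M → ℝ} (hu : MDifferentiableAt (𝓡 d) 𝓘(ℝ, ℝ) u p)
    (hv : MDifferentiableAt (𝓡 d) 𝓘(ℝ, ℝ) v p) (w : TangentSpace (𝓡 d) p) :
    dirDeriv (fun q ↦ u q + v q) p w = dirDeriv u p w + dirDeriv v p w := by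
  simp [dirDeriv, mvfderiv_fun_add hu hv]

theorem dirDeriv_const (c : ℝ) (w : TangentSpace (𝓡 d) p) :
    dirDeriv (fun _ : M ↦ c) p w = 0 := by
  simp [dirDeriv, mvfderiv_const]

theorem dirDeriv_congr {u v : M → ℝ} (h : u =ᶠ[𝓝 p] v) (w : TangentSpace (𝓡 d) p) :
    dirDeriv u p w = dirDeriv v p w := by
  simp only [dirDeriv, mvfderiv, h.mfderiv_eq]
  rfl

theorem dirDeriv_const_mul {u : M → ℝ} (c : ℝ) (hu : MDifferentiableAt (𝓡 d) 𝓘(ℝ, ℝ) u p)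
    (w : TangentSpace (𝓡 d) p) : dirDeriv (fun q ↦ c * u q) p w = c * dirDeriv u p w := by
  rw [dirDeriv_mul mdifferentiableAt_const hu, dirDeriv_const, mul_zero, add_zero]

/-- The Lie derivative of a tensor field, evaluated on vector fields. -/
noncomputable def lieExpr (X : Π q : M, TangentSpace (𝓡 d) q)
    (T : Π q : M, TangentSpace (𝓡 d) q →L[ℝ] TangentSpace (𝓡 d) q →L[ℝ] ℝ)
    (V W : Π q : M, TangentSpace (𝓡 d) q) (p : M) : ℝ :=
  dirDeriv (fun q ↦ T q (V q) (W q)) p (X p) - T p (bracket X V p) (W p)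
    - T p (V p) (bracket X W p)

/-- The derivative of `f` from the product rule cancels against the one in `[X, fV]`. -/
theorem lieExpr_tensorial₁ (hT : SmoothTwoAt T p) (hW : DiffAt W p) :
    TensorialAt (𝓡 d) (EuclideanSpace ℝ (Fin d)) (fun V ↦ lieExpr X T V W p) p where
  smul {f V} hf hV := by
    have h1 := mvfderiv_fun_mul hf (hT.mdifferentiableAt hV hW)
    simp [lieExpr, dirDeriv, bracket, h1, VectorField.mlieBracket_smul_right hf hV]
    ring
  add {V V'} hV hV' := by
    have h1 := mvfderiv_fun_add (hT.mdifferentiableAt hV hW) (hT.mdifferentiableAt hV' hW)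
    simp [lieExpr, dirDeriv, bracket, h1, VectorField.mlieBracket_add_right hV hV']
    ring

theorem lieExpr_tensorial₂ (hT : SmoothTwoAt T p) (hV : DiffAt V p) :
    TensorialAt (𝓡 d) (EuclideanSpace ℝ (Fin d)) (fun W ↦ lieExpr X T V W p) p where
  smul {f W} hf hW := by
    have h1 := mvfderiv_fun_mul hf (hT.mdifferentiableAt hV hW)
    simp [lieExpr, dirDeriv, bracket, h1, VectorField.mlieBracket_smul_right hf hW]
    ring
  add {W W'} hW hW' := by
    have h1 := mvfderiv_fun_add (hT.mdifferentiableAt hV hW) (hT.mdifferentiableAt hV hW')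
    simp [lieExpr, dirDeriv, bracket, h1, VectorField.mlieBracket_add_right hW hW']
    ring

/-- `lieDeriv` is defined through the extensions `ext`; by tensoriality every differentiable
extension gives the same value. -/
theorem lieDeriv_apply (hT : SmoothTwoAt T p) (hV : DiffAt V p)
    (hW : DiffAt W p) :
    lieDeriv X (fun q v w ↦ T q v w) p (V p) (W p) = lieExpr X T V W p := by
  have h := TensorialAt.pointwise₂ (Φ := fun V W ↦ lieExpr X T V W p)
    (fun _ hW ↦ lieExpr_tensorial₁ hT hW) (fun _ hV ↦ lieExpr_tensorial₂ hT hV)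
    (MetricHypersurfaceData.diffAt_ext (V p)) hV (MetricHypersurfaceData.diffAt_ext (W p)) hW
    (MetricHypersurfaceData.ext_self (V p)) (MetricHypersurfaceData.ext_self (W p))
  rw [← h, lieExpr, MetricHypersurfaceData.ext_self, MetricHypersurfaceData.ext_self]
  rfl

/-- Bundles the pointwise derivative as a smooth tensor field, so that it can enter further
derivatives; `exists_extDeriv`, `exists_covDeriv` and `exists_ricci` play the same role. -/
theorem exists_lieDeriv (hX : ∀ p, SmoothVectorAt X p) (T : TwoTensor d M) :
    ∃ L : TwoTensor d M, ∀ p v w, L p v w = lieDeriv X (fun q v w ↦ T q v w) p v w := by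
  have hT : ∀ p, SmoothTwoAt (fun q ↦ T q) p := fun p ↦ T.contMDiff p
  let L : Π q : M, TangentSpace (𝓡 d) q →L[ℝ] TangentSpace (𝓡 d) q →L[ℝ] ℝ := fun p ↦
    TensorialAt.mkHom₂ (fun V W ↦ lieExpr X (fun q ↦ T q) V W p) p
      (fun _ hW ↦ lieExpr_tensorial₁ (hT p) hW)
      (fun _ hV ↦ lieExpr_tensorial₂ (hT p) hV)
  have hL : ∀ {p : M} {V W : Π q : M, TangentSpace (𝓡 d) q}, DiffAt V p → DiffAt W p →
      L p (V p) (W p) = lieExpr X (fun q ↦ T q) V W p := fun {p} {V W} hV hW ↦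
    TensorialAt.mkHom₂_apply (fun _ hW ↦ lieExpr_tensorial₁ (hT p) hW)
      (fun _ hV ↦ lieExpr_tensorial₂ (hT p) hV) hV hW
  refine ⟨⟨L, fun p ↦ ?_⟩, fun p v w ↦ ?_⟩
  · refine smoothTwoAt_of_apply fun V W hV hW ↦ ?_
    have h1 : SmoothFnAt d (lieExpr X (fun q ↦ T q) V W) p :=
      ((((hT p).apply hV hW).dirDeriv (hX p)).sub ((hT p).apply ((hX p).bracket hV) hW)).sub
        ((hT p).apply hV ((hX p).bracket hW))
    refine h1.congr_of_eventuallyEq ?_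
    filter_upwards [hV.eventually_diffAt, hW.eventually_diffAt] with q hq hq'
    exact hL hq hq'
  · have h := hL (MetricHypersurfaceData.diffAt_ext v) (MetricHypersurfaceData.diffAt_ext w)
    have h' := lieDeriv_apply (X := X) (hT p) (MetricHypersurfaceData.diffAt_ext v)
      (MetricHypersurfaceData.diffAt_ext w)
    rw [MetricHypersurfaceData.ext_self, MetricHypersurfaceData.ext_self] at h h'
    exact h.trans h'.symm

/-- The exterior derivative of a one-form, evaluated on vector fields. -/
noncomputable def extDerivExpr (θ : Π q : M, TangentSpace (𝓡 d) q →L[ℝ] ℝ)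
    (V W : Π q : M, TangentSpace (𝓡 d) q) (p : M) : ℝ :=
  dirDeriv (fun q ↦ θ q (W q)) p (V p) - dirDeriv (fun q ↦ θ q (V q)) p (W p)
    - θ p (bracket V W p)

theorem extDerivExpr_tensorial₁ (hθ : SmoothOneAt θ p)
    (W : Π q : M, TangentSpace (𝓡 d) q) :
    TensorialAt (𝓡 d) (EuclideanSpace ℝ (Fin d)) (fun V ↦ extDerivExpr θ V W p) p where
  smul {f V} hf hV := by
    have h1 := mvfderiv_fun_mul hf (hθ.mdifferentiableAt hV)
    simp [extDerivExpr, dirDeriv, bracket, h1, VectorField.mlieBracket_smul_left hf hV]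
    ring
  add {V V'} hV hV' := by
    have h1 := mvfderiv_fun_add (hθ.mdifferentiableAt hV) (hθ.mdifferentiableAt hV')
    simp [extDerivExpr, dirDeriv, bracket, h1, VectorField.mlieBracket_add_left hV hV']
    ring

theorem extDerivExpr_tensorial₂ (hθ : SmoothOneAt θ p)
    (V : Π q : M, TangentSpace (𝓡 d) q) :
    TensorialAt (𝓡 d) (EuclideanSpace ℝ (Fin d)) (fun W ↦ extDerivExpr θ V W p) p where
  smul {f W} hf hW := by
    have h1 := mvfderiv_fun_mul hf (hθ.mdifferentiableAt hW)
    simp [extDerivExpr, dirDeriv, bracket, h1, VectorField.mlieBracket_smul_right hf hW]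
    ring
  add {W W'} hW hW' := by
    have h1 := mvfderiv_fun_add (hθ.mdifferentiableAt hW) (hθ.mdifferentiableAt hW')
    simp [extDerivExpr, dirDeriv, bracket, h1, VectorField.mlieBracket_add_right hW hW']
    ring

theorem extDeriv_apply (hθ : SmoothOneAt θ p) (hV : DiffAt V p) (hW : DiffAt W p) :
    extDeriv (fun q v ↦ θ q v) p (V p) (W p) = extDerivExpr θ V W p := by
  have h := TensorialAt.pointwise₂ (Φ := fun V W ↦ extDerivExpr θ V W p)
    (fun W _ ↦ extDerivExpr_tensorial₁ hθ W) (fun V _ ↦ extDerivExpr_tensorial₂ hθ V)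
    (MetricHypersurfaceData.diffAt_ext (V p)) hV (MetricHypersurfaceData.diffAt_ext (W p)) hW
    (MetricHypersurfaceData.ext_self (V p)) (MetricHypersurfaceData.ext_self (W p))
  rw [← h, extDerivExpr, MetricHypersurfaceData.ext_self, MetricHypersurfaceData.ext_self]
  rfl

theorem exists_extDeriv (θ : OneForm d M) :
    ∃ L : TwoTensor d M, ∀ p v w, L p v w = extDeriv (fun q v ↦ θ q v) p v w := by
  have hθ : ∀ p, SmoothOneAt (fun q ↦ θ q) p := fun p ↦ θ.contMDiff p
  let L : Π q : M, TangentSpace (𝓡 d) q →L[ℝ] TangentSpace (𝓡 d) q →L[ℝ] ℝ := fun p ↦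
    TensorialAt.mkHom₂ (fun V W ↦ extDerivExpr (fun q ↦ θ q) V W p) p
      (fun W _ ↦ extDerivExpr_tensorial₁ (hθ p) W)
      (fun V _ ↦ extDerivExpr_tensorial₂ (hθ p) V)
  have hL : ∀ {p : M} {V W : Π q : M, TangentSpace (𝓡 d) q}, DiffAt V p → DiffAt W p →
      L p (V p) (W p) = extDerivExpr (fun q ↦ θ q) V W p := fun {p} {V W} hV hW ↦
    TensorialAt.mkHom₂_apply (fun W _ ↦ extDerivExpr_tensorial₁ (hθ p) W)
      (fun V _ ↦ extDerivExpr_tensorial₂ (hθ p) V) hV hW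
  refine ⟨⟨L, fun p ↦ ?_⟩, fun p v w ↦ ?_⟩
  · refine smoothTwoAt_of_apply fun V W hV hW ↦ ?_
    have h1 : SmoothFnAt d (extDerivExpr (fun q ↦ θ q) V W) p :=
      ((((hθ p).apply hW).dirDeriv hV).sub (((hθ p).apply hV).dirDeriv hW)).sub
        ((hθ p).apply (hV.bracket hW))
    refine h1.congr_of_eventuallyEq ?_
    filter_upwards [hV.eventually_diffAt, hW.eventually_diffAt] with q hq hq'
    exact hL hq hq'
  · have h := hL (MetricHypersurfaceData.diffAt_ext v) (MetricHypersurfaceData.diffAt_ext w)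
    have h' := extDeriv_apply (hθ p) (MetricHypersurfaceData.diffAt_ext v)
      (MetricHypersurfaceData.diffAt_ext w)
    rw [MetricHypersurfaceData.ext_self, MetricHypersurfaceData.ext_self] at h h'
    exact h.trans h'.symm

variable (cov : CovariantDerivative (𝓡 d) (EuclideanSpace ℝ (Fin d))
      (fun p : M ↦ TangentSpace (𝓡 d) p))

/-- The covariant derivative of a one-form, evaluated on vector fields. -/
noncomputable def covDerivExpr (θ : Π q : M, TangentSpace (𝓡 d) q →L[ℝ] ℝ)
    (V W : Π q : M, TangentSpace (𝓡 d) q) (p : M) : ℝ :=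
  dirDeriv (fun q ↦ θ q (W q)) p (V p) - θ p (cov W p (V p))

theorem covDerivExpr_tensorial₁ (W : Π q : M, TangentSpace (𝓡 d) q) :
    TensorialAt (𝓡 d) (EuclideanSpace ℝ (Fin d)) (fun V ↦ covDerivExpr cov θ V W p) p where
  smul {f V} hf hV := by
    simp [covDerivExpr, dirDeriv]
    ring
  add {V V'} hV hV' := by
    simp [covDerivExpr, dirDeriv]
    ring

theorem cov_add {V W : Π q : M, TangentSpace (𝓡 d) q} (hV : DiffAt V p) (hW : DiffAt W p)
    (v : TangentSpace (𝓡 d) p) : cov (V + W) p v = cov V p v + cov W p v := by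
  rw [cov.isCovariantDerivativeOnUniv.add hV hW]
  rfl

theorem cov_smul {u : M → ℝ} (hV : DiffAt V p) (hu : MDifferentiableAt (𝓡 d) 𝓘(ℝ, ℝ) u p)
    (v : TangentSpace (𝓡 d) p) : cov (u • V) p v = u p • cov V p v + dirDeriv u p v • V p := by
  rw [cov.isCovariantDerivativeOnUniv.leibniz hV hu]
  rfl

theorem covDerivExpr_tensorial₂ (hθ : SmoothOneAt θ p) (V : Π q : M, TangentSpace (𝓡 d) q) :
    TensorialAt (𝓡 d) (EuclideanSpace ℝ (Fin d)) (fun W ↦ covDerivExpr cov θ V W p) p where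
  smul {f W} hf hW := by
    have h1 := mvfderiv_fun_mul hf (hθ.mdifferentiableAt hW)
    simp [covDerivExpr, dirDeriv, h1, cov_smul cov hW hf]
    ring
  add {W W'} hW hW' := by
    have h1 := mvfderiv_fun_add (hθ.mdifferentiableAt hW) (hθ.mdifferentiableAt hW')
    simp [covDerivExpr, dirDeriv, h1, cov_add cov hW hW']
    ring

theorem covDeriv_apply (hθ : SmoothOneAt θ p) (v : TangentSpace (𝓡 d) p) (hW : DiffAt W p) :
    covDeriv cov (fun q v ↦ θ q v) p v (W p)
      = dirDeriv (fun q ↦ θ q (W q)) p v - θ p (cov W p v) := by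
  have h := (covDerivExpr_tensorial₂ cov hθ (ext v)).pointwise
    (MetricHypersurfaceData.diffAt_ext (W p)) hW
    (MetricHypersurfaceData.ext_self (W p))
  simp only [covDerivExpr, MetricHypersurfaceData.ext_self] at h
  exact h

theorem exists_covDeriv (hcov : ∀ (p : M) (V W : Π q : M, TangentSpace (𝓡 d) q),
      SmoothVectorAt V p → SmoothVectorAt W p → SmoothVectorAt (fun q ↦ cov W q (V q)) p)
    (θ : OneForm d M) :
    ∃ L : TwoTensor d M, ∀ p v w, L p v w = covDeriv cov (fun q v ↦ θ q v) p v w := by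
  have hθ : ∀ p, SmoothOneAt (fun q ↦ θ q) p := fun p ↦ θ.contMDiff p
  let L : Π q : M, TangentSpace (𝓡 d) q →L[ℝ] TangentSpace (𝓡 d) q →L[ℝ] ℝ := fun p ↦
    TensorialAt.mkHom₂ (fun V W ↦ covDerivExpr cov (fun q ↦ θ q) V W p) p
      (fun W _ ↦ covDerivExpr_tensorial₁ cov W)
      (fun V _ ↦ covDerivExpr_tensorial₂ cov (hθ p) V)
  have hL : ∀ {p : M} {V W : Π q : M, TangentSpace (𝓡 d) q}, DiffAt V p → DiffAt W p →
      L p (V p) (W p) = covDerivExpr cov (fun q ↦ θ q) V W p := fun {p} {V W} hV hW ↦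
    TensorialAt.mkHom₂_apply (fun W _ ↦ covDerivExpr_tensorial₁ cov W)
      (fun V _ ↦ covDerivExpr_tensorial₂ cov (hθ p) V) hV hW
  refine ⟨⟨L, fun p ↦ ?_⟩, fun p v w ↦ ?_⟩
  · refine smoothTwoAt_of_apply fun V W hV hW ↦ ?_
    have h1 : SmoothFnAt d (covDerivExpr cov (fun q ↦ θ q) V W) p :=
      (((hθ p).apply hW).dirDeriv hV).sub ((hθ p).apply (hcov p V W hV hW))
    refine h1.congr_of_eventuallyEq ?_
    filter_upwards [hV.eventually_diffAt, hW.eventually_diffAt] with q hq hq'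
    exact hL hq hq'
  · have h := hL (MetricHypersurfaceData.diffAt_ext v) (MetricHypersurfaceData.diffAt_ext w)
    have h' := covDeriv_apply cov (hθ p) v (MetricHypersurfaceData.diffAt_ext w)
    simp only [covDerivExpr, MetricHypersurfaceData.ext_self] at h h'
    exact h.trans h'.symm

end Tensoriality

/-! ### Smoothness of the objects dual to the data, and of the connection. -/

theorem contDiffAt_matrix_inv {ι : Type*} [Fintype ι] [DecidableEq ι] {A : ι → ι → ℝ}
    (hA : (Matrix.of A).det ≠ 0) (a b : ι) :
    ContDiffAt ℝ ∞ (fun B : ι → ι → ℝ ↦ (Matrix.of B)⁻¹ a b) A := by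
  have hdet : ContDiff ℝ ∞ (fun B : ι → ι → ℝ ↦ (Matrix.of B).det) := by
    simp only [Matrix.det_apply]
    refine ContDiff.sum fun σ _ ↦ ContDiff.const_smul _ (contDiff_prod fun i _ ↦ ?_)
    exact contDiff_apply_apply ℝ ℝ (σ i) i
  have hadj : ContDiff ℝ ∞ (fun B : ι → ι → ℝ ↦ (Matrix.of B).adjugate a b) := by
    simp only [Matrix.adjugate_apply, Matrix.det_apply]
    refine ContDiff.sum fun σ _ ↦ ContDiff.const_smul _ (contDiff_prod fun i _ ↦ ?_)
    -- By Cramer's rule only minors matter: row `b` has been replaced by a constant unit vector, and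
    -- every other entry is an entry of `B`.
    by_cases h : σ i = b
    · simp only [Matrix.updateRow_apply, h, if_true]
      exact contDiff_const
    · simp only [Matrix.updateRow_apply, h, if_false]
      exact contDiff_apply_apply ℝ ℝ (σ i) i
  simp only [Matrix.inv_def, Matrix.smul_apply, smul_eq_mul, Ring.inverse_eq_inv']
  exact (hdet.contDiffAt.inv hA).mul hadj.contDiffAt

section SmoothData

variable {d : ℕ} {M : Type*} [TopologicalSpace M] [ChartedSpace (EuclideanSpace ℝ (Fin d)) M]
  [IsManifold (𝓡 d) ∞ M]

theorem coordBasis_repr (p₀ : M) {q : M}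
    (hq : q ∈ (chartAt (EuclideanSpace ℝ (Fin d)) p₀).source) (v : TangentSpace (𝓡 d) q)
    (i : Fin d) : (coordBasis p₀ hq).repr v i = coordCoeff p₀ i q v := by
  have h : ((coordBasis p₀ hq).coord i : TangentSpace (𝓡 d) q →ₗ[ℝ] ℝ) = coordCoeff p₀ i q := by
    refine (coordBasis p₀ hq).ext fun j ↦ ?_
    rw [Module.Basis.coord_apply, Module.Basis.repr_self_apply, coordBasis_apply,
      coordCoeff_coordFrame p₀ hq]
  exact congrArg (fun φ ↦ φ v) h

theorem smoothFnAt_matrix_inv {ι : Type*} [Fintype ι] [DecidableEq ι] {p : M} {G : M → Matrix ι ι ℝ}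
    (hG : ∀ a b, SmoothFnAt d (fun q ↦ G q a b) p) (hdet : (G p).det ≠ 0) (a b : ι) :
    SmoothFnAt d (fun q ↦ (G q)⁻¹ a b) p := by
  have h1 : ContMDiffAt (𝓡 d) 𝓘(ℝ, ι → ι → ℝ) ∞ (fun q ↦ (fun a b ↦ G q a b : ι → ι → ℝ)) p := by
    rw [contMDiffAt_pi_space]
    intro a
    rw [contMDiffAt_pi_space]
    exact hG a
  exact ContMDiffAt.comp p (contDiffAt_matrix_inv (A := fun a b ↦ G p a b) hdet a b).contMDiffAt h1

namespace MetricHypersurfaceData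

variable (D : MetricHypersurfaceData d M)

theorem smoothTwoAt_γ (p : M) : SmoothTwoAt (fun q ↦ D.γ q) p := D.γ.contMDiff p

theorem smoothOneAt_ℓ (p : M) : SmoothOneAt (fun q ↦ D.ℓ q) p := D.ℓ.contMDiff p

/-- A field on `T M × ℝ` is smooth if its products with smooth fields are. -/
theorem smoothAt_of_ambientForm {x : Π q : M, TangentSpace (𝓡 d) q × ℝ} {p : M}
    (h : ∀ V : Π q : M, TangentSpace (𝓡 d) q, SmoothVectorAt V p → SmoothFnAt d
      (fun q ↦ ambientForm (D.γ q) (D.ℓ q) (D.ℓ2 q) (x q) (V q, 0)) p)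
    (h1 : SmoothFnAt d (fun q ↦ ambientForm (D.γ q) (D.ℓ q) (D.ℓ2 q) (x q) (0, 1)) p) :
    SmoothVectorAt (fun q ↦ (x q).1) p ∧ SmoothFnAt d (fun q ↦ (x q).2) p := by
  have hp := mem_chart_source (EuclideanSpace ℝ (Fin d)) p
  -- The coordinate frame together with `(0, 1)` is a frame of `TM × ℝ`. Its Gram matrix is
  -- invertible by non-degeneracy, and the components of `x` are its products with the frame times
  -- the smooth inverse matrix.
  let e : Fin d ⊕ Unit → Π q : M, TangentSpace (𝓡 d) q × ℝ := fun a q ↦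
    Sum.elim (fun i ↦ (coordFrame p i q, 0)) (fun _ ↦ (0, 1)) a
  let A : Π q : M, LinearMap.BilinForm ℝ (TangentSpace (𝓡 d) q × ℝ) := fun q ↦
    ambientForm (D.γ q) (D.ℓ q) (D.ℓ2 q)
  let G : M → Matrix (Fin d ⊕ Unit) (Fin d ⊕ Unit) ℝ := fun q ↦
    Matrix.of fun a b ↦ A q (e a q) (e b q)
  have he := smoothVectorAt_coordFrame p hp
  have hG : ∀ a b, SmoothFnAt d (fun q ↦ G q a b) p := by
    have hl : ∀ i, SmoothFnAt d (fun q ↦ D.ℓ q (coordFrame p i q)) p := fun i ↦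
      (D.smoothOneAt_ℓ p).apply (he i)
    rintro (i | i) (j | j)
    · simpa [G, A, e, ambientForm] using (D.smoothTwoAt_γ p).apply (he i) (he j)
    · simpa [G, A, e, ambientForm] using hl i
    · simpa [G, A, e, ambientForm] using hl j
    · simpa [G, A, e, ambientForm] using D.ℓ2.contMDiff p
  let B : ∀ {q : M}, q ∈ (chartAt (EuclideanSpace ℝ (Fin d)) p).source →
      Module.Basis (Fin d ⊕ Unit) ℝ (TangentSpace (𝓡 d) q × ℝ) := fun hq ↦
    (coordBasis p hq).prod (Module.Basis.singleton Unit ℝ)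
  have hB : ∀ {q : M} (hq : q ∈ (chartAt (EuclideanSpace ℝ (Fin d)) p).source) a,
      B hq a = e a q := by
    rintro q hq (i | i)
    · simp [B, e, coordBasis_apply]
    · simp [B, e]
  have hdet : ∀ {q : M}, q ∈ (chartAt (EuclideanSpace ℝ (Fin d)) p).source → (G q).det ≠ 0 := by
    intro q hq
    have := (LinearMap.BilinForm.nondegenerate_iff_det_ne_zero (B hq)).1 (D.nondegenerate q)
    convert! this using 2
    ext a b
    simp [G, A, LinearMap.BilinForm.toMatrix_apply, hB hq]
  have hy : ∀ a, SmoothFnAt d (fun q ↦ A q (x q) (e a q)) p := by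
    rintro (i | i)
    · exact h _ (he i)
    · exact h1
  have hx : ∀ {q : M} (hq : q ∈ (chartAt (EuclideanSpace ℝ (Fin d)) p).source) a,
      (B hq).repr (x q) a = ∑ b, A q (x q) (e b q) * (G q)⁻¹ b a := by
    intro q hq a
    have h2 : (fun b ↦ A q (x q) (e b q)) = Matrix.vecMul ((B hq).repr (x q)) (G q) := by
      ext b
      conv_lhs => rw [← (B hq).sum_repr (x q)]
      simp [Matrix.vecMul, dotProduct, G, hB hq]
    have h3 : Matrix.vecMul (fun b ↦ A q (x q) (e b q)) (G q)⁻¹ = (B hq).repr (x q) := by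
      rw [h2, Matrix.vecMul_vecMul, Matrix.mul_nonsing_inv _ (isUnit_iff_ne_zero.2 (hdet hq)),
        Matrix.vecMul_one]
    rw [← h3]
    rfl
  have hc : ∀ a, SmoothFnAt d (fun q ↦ ∑ b, A q (x q) (e b q) * (G q)⁻¹ b a) p := fun a ↦
    ContMDiffAt.sum fun b _ ↦ (hy b).mul (smoothFnAt_matrix_inv hG (hdet hp) b a)
  constructor
  · rw [smoothVectorAt_iff_coordCoeff p hp]
    intro i
    refine (hc (Sum.inl i)).congr_of_eventuallyEq ?_
    filter_upwards [eventually_mem_chartAt_source (d := d) p] with q hq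
    rw [← hx hq]
    simp [B, coordBasis_repr]
  · refine (hc (Sum.inr ())).congr_of_eventuallyEq ?_
    filter_upwards [eventually_mem_chartAt_source (d := d) p] with q hq
    rw [← hx hq]
    simp [B]

theorem ambientForm_sharp {p : M} (φ : Module.Dual ℝ (TangentSpace (𝓡 d) p × ℝ))
    (y : TangentSpace (𝓡 d) p × ℝ) :
    ambientForm (D.γ p) (D.ℓ p) (D.ℓ2 p) (D.sharp p φ) y = φ y :=
  LinearMap.BilinForm.apply_toDual_symm_apply (hB := D.nondegenerate p) _ _

/-- The products of `(n, n⁽²⁾)` with `(V, 0)` and `(0, 1)` are the constants `0` and `1`. -/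
theorem smoothVectorAt_n (p : M) : SmoothVectorAt D.n p := by
  refine (D.smoothAt_of_ambientForm (x := fun q ↦ D.sharp q (covector 0 1)) (fun V hV ↦ ?_) ?_).1
  · simp only [ambientForm_sharp, covector]
    simpa using contMDiffAt_const
  · simp only [ambientForm_sharp, covector]
    simpa using contMDiffAt_const

/-- The vector field `P(θ, ·)`. -/
noncomputable def raise {p : M} (θ : TangentSpace (𝓡 d) p →ₗ[ℝ] ℝ) : TangentSpace (𝓡 d) p :=
  (D.sharp p (covector θ 0)).1

theorem smoothVectorAt_raise {θ : Π q : M, TangentSpace (𝓡 d) q →L[ℝ] ℝ} {p : M}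
    (hθ : SmoothOneAt θ p) : SmoothVectorAt (fun q ↦ D.raise (θ q).toLinearMap) p := by
  refine (D.smoothAt_of_ambientForm (x := fun q ↦ D.sharp q (covector (θ q).toLinearMap 0))
    (fun V hV ↦ ?_) ?_).1
  · simp only [ambientForm_sharp, covector]
    simpa using hθ.apply hV
  · simp only [ambientForm_sharp, covector]
    simpa using contMDiffAt_const

theorem P_eq_raise {p : M} (α β : TangentSpace (𝓡 d) p →ₗ[ℝ] ℝ) : D.P p α β = β (D.raise α) := by
  simp [P, raise, covector]

theorem smoothTwoAt_koszul {p : M} {V W Z : Π q : M, TangentSpace (𝓡 d) q}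
    (hV : SmoothVectorAt V p) (hW : SmoothVectorAt W p) (hZ : SmoothVectorAt Z p) :
    SmoothFnAt d (D.koszul V W Z) p := by
  have h := D.smoothTwoAt_γ p
  exact contMDiffAt_const.mul
    ((((((h.apply hW hZ).dirDeriv hV).add ((h.apply hV hZ).dirDeriv hW)).sub
      ((h.apply hV hW).dirDeriv hZ)).add (h.apply (hV.bracket hW) hZ)).sub
      (h.apply (hV.bracket hZ) hW) |>.sub (h.apply (hW.bracket hZ) hV))

theorem smoothFnAt_koszulScalar {p : M} {V W : Π q : M, TangentSpace (𝓡 d) q}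
    (hV : SmoothVectorAt V p) (hW : SmoothVectorAt W p) :
    SmoothFnAt d (D.koszulScalar V W) p := by
  have h := D.smoothOneAt_ℓ p
  exact contMDiffAt_const.mul
    ((((h.apply hW).dirDeriv hV).add ((h.apply hV).dirDeriv hW)).add (h.apply (hV.bracket hW)))

theorem smoothVectorAt_connection (p : M) (V W : Π q : M, TangentSpace (𝓡 d) q)
    (hV : SmoothVectorAt V p) (hW : SmoothVectorAt W p) :
    SmoothVectorAt (fun q ↦ D.connection W q (V q)) p := by
  classical
  -- The default `0` matches the value of the connection where `W` is not differentiable; near `p`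
  -- that case does not occur.
  let x : Π q : M, TangentSpace (𝓡 d) q × ℝ := fun q ↦
    if h : DiffAt W q then D.koszulSharp W q h (V q) else 0
  have hx : ∀ q, (x q).1 = D.connection W q (V q) := by
    intro q
    by_cases h : DiffAt W q
    · simp [x, h, D.connection_apply h]
    · simp [x, h, connection]
  simp only [← hx]
  refine (D.smoothAt_of_ambientForm (fun Z hZ ↦ ?_) ?_).1
  · refine (D.smoothTwoAt_koszul hV hW hZ).congr_of_eventuallyEq ?_
    filter_upwards [hV.eventually_diffAt, hW.eventually_diffAt, hZ.eventually_diffAt] with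
      q h1 h2 h3
    have h4 := D.ambientForm_koszulSharp h1 h2 h3 0
    simpa [x, h2] using h4
  · refine (D.smoothFnAt_koszulScalar hV hW).congr_of_eventuallyEq ?_
    filter_upwards [hV.eventually_diffAt, hW.eventually_diffAt] with q h1 h2
    -- Taking `Z = 0` and `b = 1` isolates the scalar component of the Koszul data.
    have h4 := D.ambientForm_koszulSharp (Z := 0) h1 h2 (Bundle.mdifferentiableAt_zeroSection ..) 1
    have h5 : D.koszul V W 0 q = 0 := by
      simp [koszul, dirDeriv, bracket, mvfderiv_const]
    rw [h5, zero_add, one_mul] at h4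
    simpa [x, h2] using h4

end MetricHypersurfaceData

end SmoothData

/-! ### Tensoriality of the curvature, and the Ricci tensor. -/

section Curvature

variable {d : ℕ} {M : Type*} [TopologicalSpace M] [ChartedSpace (EuclideanSpace ℝ (Fin d)) M]
  [IsManifold (𝓡 d) ∞ M] {p : M} {V W X Y Z : Π q : M, TangentSpace (𝓡 d) q} {f u : M → ℝ}

theorem bracket_smul_right (hf : MDifferentiableAt (𝓡 d) 𝓘(ℝ, ℝ) f p) (hW : DiffAt W p) :
    bracket V (f • W) p = dirDeriv f p (V p) • W p + f p • bracket V W p :=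
  VectorField.mlieBracket_smul_right hf hW

theorem bracket_smul_left (hf : MDifferentiableAt (𝓡 d) 𝓘(ℝ, ℝ) f p) (hV : DiffAt V p) :
    bracket (f • V) W p = -dirDeriv f p (W p) • V p + f p • bracket V W p :=
  VectorField.mlieBracket_smul_left hf hV

theorem bracket_add_right (hV : DiffAt V p) (hW : DiffAt W p) :
    bracket X (V + W) p = bracket X V p + bracket X W p :=
  VectorField.mlieBracket_add_right hV hW

theorem bracket_add_left (hV : DiffAt V p) (hW : DiffAt W p) :
    bracket (V + W) X p = bracket V X p + bracket W X p :=
  VectorField.mlieBracket_add_left hV hW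

theorem bracket_swap (V W : Π q : M, TangentSpace (𝓡 d) q) (p : M) :
    bracket V W p = -bracket W V p := VectorField.mlieBracket_swap_apply

theorem bracket_congr (hV : V =ᶠ[𝓝 p] X) (hW : W =ᶠ[𝓝 p] Y) : bracket V W p = bracket X Y p :=
  hV.mlieBracket_vectorField_eq hW

theorem SmoothFnAt.mdifferentiableAt (hf : SmoothFnAt d f p) :
    MDifferentiableAt (𝓡 d) 𝓘(ℝ, ℝ) f p := ContMDiffAt.mdifferentiableAt hf (by simp)

theorem SmoothFnAt.eventually_mdifferentiableAt (hf : SmoothFnAt d f p) :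
    ∀ᶠ q in 𝓝 p, MDifferentiableAt (𝓡 d) 𝓘(ℝ, ℝ) f q := by
  have h : ContMDiffAt (𝓡 d) 𝓘(ℝ, ℝ) 1 f p := hf.of_le (by simp)
  filter_upwards [(contMDiffAt_iff_contMDiffAt_nhds (by simp)).1 h] with q hq
  exact hq.mdifferentiableAt (by simp)

theorem SmoothVectorAt.smul' (hf : SmoothFnAt d f p) (hV : SmoothVectorAt V p) :
    SmoothVectorAt (f • V) p := SmoothVectorAt.smul hf hV

theorem SmoothVectorAt.add' (hV : SmoothVectorAt V p) (hW : SmoothVectorAt W p) :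
    SmoothVectorAt (V + W) p := SmoothVectorAt.add hV hW

theorem dirDeriv_add_vec (v w : TangentSpace (𝓡 d) p) :
    dirDeriv u p (v + w) = dirDeriv u p v + dirDeriv u p w := map_add _ _ _

theorem dirDeriv_smul_vec (c : ℝ) (v : TangentSpace (𝓡 d) p) :
    dirDeriv u p (c • v) = c * dirDeriv u p v := map_smul _ _ _

/-- The Lie bracket is the commutator of derivations. -/
theorem dirDeriv_bracket (hu : SmoothFnAt d u p) (hV : SmoothVectorAt V p)
    (hW : SmoothVectorAt W p) :
    dirDeriv u p (bracket V W p) = dirDeriv (fun q ↦ dirDeriv u q (W q)) p (V p)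
      - dirDeriv (fun q ↦ dirDeriv u q (V q)) p (W p) := by
  -- The argument compares coefficients of a non-zero vector, so the zero tangent space is treated
  -- apart.
  rcases subsingleton_or_nontrivial (TangentSpace (𝓡 d) p) with hs | hs
  · rw [Subsingleton.elim (bracket V W p) 0, Subsingleton.elim (V p) 0, Subsingleton.elim (W p) 0]
    simp [dirDeriv]
  obtain ⟨z, hz⟩ := exists_ne (0 : TangentSpace (𝓡 d) p)
  let Z : Π q : M, TangentSpace (𝓡 d) q := ext z
  have hZ : SmoothVectorAt Z p := smoothVectorAt_ext z
  have hmin : ∀ {V : Π q : M, TangentSpace (𝓡 d) q}, SmoothVectorAt V p →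
      ContMDiffAt (𝓡 d) ((𝓡 d).prod (𝓡 d)) (minSmoothness ℝ 2)
        (fun q ↦ Bundle.TotalSpace.mk' (EuclideanSpace ℝ (Fin d)) q (V q)) p := fun h ↦ by
    refine ContMDiffAt.of_le h ?_
    rw [minSmoothness_of_isRCLikeNormedField]
    exact WithTop.coe_le_coe.2 (le_top : (2 : ℕ∞) ≤ ⊤)
  have : IsManifold (𝓡 d) (minSmoothness ℝ 3) M := IsManifold.of_le (n := ∞) (by
    rw [minSmoothness_of_isRCLikeNormedField]
    exact WithTop.coe_le_coe.2 (le_top : (3 : ℕ∞) ≤ ⊤))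
  -- The Jacobi identity for `uZ`, minus `u` times the one for `Z`, leaves the desired relation
  -- between derivatives of `u` as a coefficient of `Z p ≠ 0`.
  have hJ : bracket V (bracket W (u • Z)) p = bracket (bracket V W) (u • Z) p
      + bracket W (bracket V (u • Z)) p :=
    VectorField.leibniz_identity_mlieBracket_apply (hmin hV) (hmin hW) (hmin (hZ.smul' hu))
  have hJ' : bracket V (bracket W Z) p = bracket (bracket V W) Z p
      + bracket W (bracket V Z) p :=
    VectorField.leibniz_identity_mlieBracket_apply (hmin hV) (hmin hW) (hmin hZ)
  have key : ∀ {V W : Π q : M, TangentSpace (𝓡 d) q}, SmoothVectorAt V p → SmoothVectorAt W p →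
      bracket V (bracket W (u • Z)) p = dirDeriv (fun q ↦ dirDeriv u q (W q)) p (V p) • Z p
        + dirDeriv u p (W p) • bracket V Z p + dirDeriv u p (V p) • bracket W Z p
        + u p • bracket V (bracket W Z) p := by
    intro V W hV hW
    have h1 : bracket W (u • Z) =ᶠ[𝓝 p] (fun q ↦ dirDeriv u q (W q)) • Z + u • bracket W Z := by
      filter_upwards [hu.eventually_mdifferentiableAt, hZ.eventually_diffAt] with q h1 h2
      exact bracket_smul_right h1 h2
    have h2 : SmoothFnAt d (fun q ↦ dirDeriv u q (W q)) p := hu.dirDeriv hW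
    have hWZ : SmoothVectorAt (bracket W Z) p := hW.bracket hZ
    rw [bracket_congr (EventuallyEq.refl _ V) h1, bracket_add_right (hZ.smul' h2).diffAt
      (hWZ.smul' hu).diffAt, bracket_smul_right h2.mdifferentiableAt hZ.diffAt,
      bracket_smul_right hu.mdifferentiableAt hWZ.diffAt]
    abel
  have hZp : Z p = z := MetricHypersurfaceData.ext_self z
  rw [key hV hW, key hW hV, bracket_smul_right hu.mdifferentiableAt hZ.diffAt, hJ', hZp] at hJ
  have h3 : (dirDeriv u p (bracket V W p) - (dirDeriv (fun q ↦ dirDeriv u q (W q)) p (V p)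
      - dirDeriv (fun q ↦ dirDeriv u q (V q)) p (W p))) • z = 0 := by
    rw [smul_add] at hJ
    simp only [sub_smul]
    rw [← sub_eq_zero] at hJ
    rw [← neg_eq_zero, ← hJ]
    abel
  exact sub_eq_zero.1 ((smul_eq_zero.1 h3).resolve_right hz)

variable {cov : CovariantDerivative (𝓡 d) (EuclideanSpace ℝ (Fin d))
      (fun p : M ↦ TangentSpace (𝓡 d) p)}

theorem cov_congr (hV : DiffAt V p) (hW : DiffAt W p) (h : V =ᶠ[𝓝 p] W) : cov V p = cov W p :=
  cov.isCovariantDerivativeOnUniv.congr_of_eventuallyEq hV hW univ_mem h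

/-- A connection which maps smooth vector fields to smooth vector fields. -/
def IsSmoothConnection (cov : CovariantDerivative (𝓡 d) (EuclideanSpace ℝ (Fin d))
      (fun p : M ↦ TangentSpace (𝓡 d) p)) : Prop :=
  ∀ (p : M) (V W : Π q : M, TangentSpace (𝓡 d) q),
      SmoothVectorAt V p → SmoothVectorAt W p → SmoothVectorAt (fun q ↦ cov W q (V q)) p

variable (hcov : IsSmoothConnection cov)

theorem curvature_swap (X Y Z : Π q : M, TangentSpace (𝓡 d) q) (p : M) :
    curvature cov X Y Z p = -curvature cov Y X Z p := by
  simp only [curvature, bracket_swap X Y, map_neg]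
  abel

-- The derivative of `f` enters through `∇_Y (f ∇_X Z)` and through `[fX, Y]`, with opposite effect.
include hcov in
theorem curvature_smul₁ (hf : SmoothFnAt d f p) (hX : SmoothVectorAt X p)
    (hZ : SmoothVectorAt Z p) :
    curvature cov (f • X) Y Z p = f p • curvature cov X Y Z p := by
  have h1 : (fun q ↦ cov Z q ((f • X) q)) = f • fun q ↦ cov Z q (X q) := by
    funext q
    exact (cov Z q).map_smul (f q) (X q)
  have h2 : (f • X) p = f p • X p := rfl
  rw [curvature, curvature, h1, h2, cov_smul cov (hcov p X Z hX hZ).diffAt hf.mdifferentiableAt,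
    bracket_smul_left hf.mdifferentiableAt hX.diffAt, map_add, map_smul, map_smul, map_smul,
    smul_sub, smul_sub, neg_smul]
  abel

include hcov in
theorem curvature_add₁ (hX : SmoothVectorAt X p) (hV : SmoothVectorAt V p)
    (hZ : SmoothVectorAt Z p) :
    curvature cov (X + V) Y Z p = curvature cov X Y Z p + curvature cov V Y Z p := by
  have h1 : (fun q ↦ cov Z q ((X + V) q)) = (fun q ↦ cov Z q (X q)) + fun q ↦ cov Z q (V q) := by
    funext q
    exact (cov Z q).map_add (X q) (V q)
  have h2 : (X + V) p = X p + V p := rfl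
  rw [curvature, curvature, curvature, h1, h2, cov_add cov (hcov p X Z hX hZ).diffAt
    (hcov p V Z hV hZ).diffAt, bracket_add_left hX.diffAt hV.diffAt, map_add, map_add]
  abel

-- First derivatives of `f` cancel by antisymmetry or against `∇_[X,Y]`; the second derivatives
-- `X(Yf) - Y(Xf)` cancel against `[X, Y]f`.
include hcov in
theorem curvature_smul₃ (hf : SmoothFnAt d f p) (hX : SmoothVectorAt X p)
    (hY : SmoothVectorAt Y p) (hZ : SmoothVectorAt Z p) :
    curvature cov X Y (f • Z) p = f p • curvature cov X Y Z p := by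
  have key : ∀ {X Y : Π q : M, TangentSpace (𝓡 d) q}, SmoothVectorAt X p → SmoothVectorAt Y p →
      cov (fun q ↦ cov (f • Z) q (Y q)) p (X p)
      = f p • cov (fun q ↦ cov Z q (Y q)) p (X p) + dirDeriv f p (X p) • cov Z p (Y p)
        + (dirDeriv f p (Y p) • cov Z p (X p)
        + dirDeriv (fun q ↦ dirDeriv f q (Y q)) p (X p) • Z p) := by
    intro X Y hX hY
    have h1 : (fun q ↦ cov (f • Z) q (Y q)) =ᶠ[𝓝 p]
        f • (fun q ↦ cov Z q (Y q)) + (fun q ↦ dirDeriv f q (Y q)) • Z := by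
      filter_upwards [hf.eventually_mdifferentiableAt, hZ.eventually_diffAt] with q h1 h2
      exact cov_smul cov h2 h1 _
    have h2 := hcov p Y Z hY hZ
    have h3 : SmoothFnAt d (fun q ↦ dirDeriv f q (Y q)) p := hf.dirDeriv hY
    rw [cov_congr (hcov p Y _ hY (hZ.smul' hf)).diffAt ((h2.smul' hf).add' (hZ.smul' h3)).diffAt h1,
      cov_add cov (h2.smul' hf).diffAt (hZ.smul' h3).diffAt,
      cov_smul cov h2.diffAt hf.mdifferentiableAt, cov_smul cov hZ.diffAt h3.mdifferentiableAt]
  rw [curvature, curvature, key hX hY, key hY hX, cov_smul cov hZ.diffAt hf.mdifferentiableAt,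
    dirDeriv_bracket hf hX hY]
  simp only [smul_sub, sub_smul]
  abel

include hcov in
theorem curvature_add₃ (hX : SmoothVectorAt X p) (hY : SmoothVectorAt Y p)
    (hZ : SmoothVectorAt Z p) (hV : SmoothVectorAt V p) :
    curvature cov X Y (Z + V) p = curvature cov X Y Z p + curvature cov X Y V p := by
  have key : ∀ {X Y : Π q : M, TangentSpace (𝓡 d) q}, SmoothVectorAt X p → SmoothVectorAt Y p →
      cov (fun q ↦ cov (Z + V) q (Y q)) p (X p)
      = cov (fun q ↦ cov Z q (Y q)) p (X p) + cov (fun q ↦ cov V q (Y q)) p (X p) := by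
    intro X Y hX hY
    have h1 : (fun q ↦ cov (Z + V) q (Y q)) =ᶠ[𝓝 p]
        (fun q ↦ cov Z q (Y q)) + (fun q ↦ cov V q (Y q)) := by
      filter_upwards [hV.eventually_diffAt, hZ.eventually_diffAt] with q h1 h2
      exact cov_add cov h2 h1 _
    have h2 := hcov p Y Z hY hZ
    have h3 := hcov p Y V hY hV
    rw [cov_congr (hcov p Y _ hY (hZ.add' hV)).diffAt (h2.add' h3).diffAt h1,
      cov_add cov h2.diffAt h3.diffAt]
  rw [curvature, curvature, curvature, key hX hY, key hY hX, cov_add cov hZ.diffAt hV.diffAt]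
  abel

include hcov in
theorem curvature_congr₁ (hX : SmoothVectorAt X p) (hV : SmoothVectorAt V p)
    (hZ : SmoothVectorAt Z p) (h : X =ᶠ[𝓝 p] V) :
    curvature cov X Y Z p = curvature cov V Y Z p := by
  have h1 : (fun q ↦ cov Z q (X q)) =ᶠ[𝓝 p] fun q ↦ cov Z q (V q) := by
    filter_upwards [h] with q hq
    rw [hq]
  rw [curvature, curvature, cov_congr (hcov p X Z hX hZ).diffAt (hcov p V Z hV hZ).diffAt h1,
    bracket_congr h (EventuallyEq.refl _ Y), h.self_of_nhds]

include hcov in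
theorem curvature_congr₃ (hX : SmoothVectorAt X p) (hY : SmoothVectorAt Y p)
    (hZ : SmoothVectorAt Z p) (hV : SmoothVectorAt V p) (h : Z =ᶠ[𝓝 p] V) :
    curvature cov X Y Z p = curvature cov X Y V p := by
  have key : ∀ {Y : Π q : M, TangentSpace (𝓡 d) q}, SmoothVectorAt Y p →
      cov (fun q ↦ cov Z q (Y q)) p = cov (fun q ↦ cov V q (Y q)) p := by
    intro Y hY
    refine cov_congr (hcov p Y Z hY hZ).diffAt (hcov p Y V hY hV).diffAt ?_
    filter_upwards [h.eventually_nhds, hV.eventually_diffAt, hZ.eventually_diffAt] with q h1 h2 h3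
    rw [cov_congr h3 h2 h1]
  rw [curvature, curvature, key hX, key hY, cov_congr hZ.diffAt hV.diffAt h]

/-- A local operator on smooth vector fields which is linear over smooth functions. -/
structure IsSmoothTensorial {A : Type*} [AddCommGroup A] [Module ℝ A]
    (Φ : (Π q : M, TangentSpace (𝓡 d) q) → A) (p : M) : Prop where
  smul : ∀ {f V}, SmoothFnAt d f p → SmoothVectorAt V p → Φ (f • V) = f p • Φ V
  add : ∀ {V W}, SmoothVectorAt V p → SmoothVectorAt W p → Φ (V + W) = Φ V + Φ W
  congr : ∀ {V W}, SmoothVectorAt V p → SmoothVectorAt W p → V =ᶠ[𝓝 p] W → Φ V = Φ W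

variable {A : Type*} [AddCommGroup A] [Module ℝ A] {Φ : (Π q : M, TangentSpace (𝓡 d) q) → A}

theorem IsSmoothTensorial.zero (h : IsSmoothTensorial Φ p) : Φ (fun _ ↦ 0) = 0 := by
  have h1 : SmoothVectorAt (fun q : M ↦ (0 : TangentSpace (𝓡 d) q)) p := by
    have := SmoothVectorAt.sum (p := p) (s := ∅) (V := fun i ↦ coordFrame (d := d) p i)
      fun i ↦ smoothVectorAt_coordFrame p (mem_chart_source _ p) i
    simpa using this
  have h2 := h.smul (f := fun _ ↦ 0) contMDiffAt_const h1
  rw [zero_smul] at h2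
  rw [← h2]
  congr 1
  funext q
  exact (smul_zero (0 : ℝ)).symm

theorem IsSmoothTensorial.sum (h : IsSmoothTensorial Φ p) {ι : Type*} (s : Finset ι)
    {F : ι → Π q : M, TangentSpace (𝓡 d) q} (hF : ∀ i, SmoothVectorAt (F i) p) :
    Φ (fun q ↦ ∑ i ∈ s, F i q) = ∑ i ∈ s, Φ (F i) := by
  classical
  induction s using Finset.induction_on with
  | empty => simpa using h.zero
  | insert a s ha ih =>
    simp only [Finset.sum_insert ha]
    rw [← ih]
    exact h.add (hF a) (SmoothVectorAt.sum hF)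

/-- Curvature differentiates twice and is linear over functions only for fields smooth at the point,
whereas `TensorialAt` admits fields that are merely differentiable there. Dependence on the value
alone is therefore derived from a frame expansion; it holds only near the point, hence the need for
`congr`. -/
theorem IsSmoothTensorial.eq_sum (h : IsSmoothTensorial Φ p) {p₀ : M}
    (hp : p ∈ (chartAt (EuclideanSpace ℝ (Fin d)) p₀).source) (hV : SmoothVectorAt V p) :
    Φ V = ∑ i, coordCoeff p₀ i p (V p) • Φ (coordFrame p₀ i) := by
  have h1 : ∀ i, SmoothVectorAt ((fun q ↦ coordCoeff p₀ i q (V q)) • coordFrame p₀ i) p := fun i ↦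
    (smoothVectorAt_coordFrame p₀ hp i).smul' ((smoothVectorAt_iff_coordCoeff p₀ hp).1 hV i)
  have h2 : V =ᶠ[𝓝 p] fun q ↦ ∑ i, ((fun q ↦ coordCoeff p₀ i q (V q)) • coordFrame p₀ i) q := by
    filter_upwards [(chartAt (EuclideanSpace ℝ (Fin d)) p₀).open_source.mem_nhds hp] with q hq
    exact eq_sum_coordCoeff p₀ hq (V q)
  rw [h.congr hV (SmoothVectorAt.sum h1) h2, h.sum _ h1]
  exact Finset.sum_congr rfl fun i _ ↦ h.smul ((smoothVectorAt_iff_coordCoeff p₀ hp).1 hV i)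
    (smoothVectorAt_coordFrame p₀ hp i)

theorem IsSmoothTensorial.pointwise (h : IsSmoothTensorial Φ p) (hV : SmoothVectorAt V p)
    (hW : SmoothVectorAt W p) (hVW : V p = W p) : Φ V = Φ W := by
  rw [h.eq_sum (mem_chart_source _ p) hV, h.eq_sum (mem_chart_source _ p) hW, hVW]

include hcov in
theorem isSmoothTensorial_curvature₁ (Y : Π q : M, TangentSpace (𝓡 d) q) (hZ : SmoothVectorAt Z p) :
    IsSmoothTensorial (fun X ↦ curvature cov X Y Z p) p where
  smul hf hX := curvature_smul₁ hcov hf hX hZ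
  add hX hV := curvature_add₁ hcov hX hV hZ
  congr hX hV h := curvature_congr₁ hcov hX hV hZ h

include hcov in
theorem isSmoothTensorial_curvature₂ (X : Π q : M, TangentSpace (𝓡 d) q) (hZ : SmoothVectorAt Z p) :
    IsSmoothTensorial (fun Y ↦ curvature cov X Y Z p) p where
  smul hf hY := by
    simp only [curvature_swap X, curvature_smul₁ hcov hf hY hZ, smul_neg]
  add hY hV := by
    simp only [curvature_swap X, curvature_add₁ hcov hY hV hZ, neg_add]
  congr hY hV h := by
    simp only [curvature_swap X, curvature_congr₁ hcov hY hV hZ h]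

include hcov in
theorem isSmoothTensorial_curvature₃ (hX : SmoothVectorAt X p) (hY : SmoothVectorAt Y p) :
    IsSmoothTensorial (fun Z ↦ curvature cov X Y Z p) p where
  smul hf hZ := curvature_smul₃ hcov hf hX hY hZ
  add hZ hV := curvature_add₃ hcov hX hY hZ hV
  congr hZ hV h := curvature_congr₃ hcov hX hY hZ hV h

include hcov in
theorem curvature_pointwise {X' Y' Z' : Π q : M, TangentSpace (𝓡 d) q} (hX : SmoothVectorAt X p)
    (hY : SmoothVectorAt Y p) (hZ : SmoothVectorAt Z p) (hX' : SmoothVectorAt X' p)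
    (hY' : SmoothVectorAt Y' p) (hZ' : SmoothVectorAt Z' p) (h₁ : X p = X' p) (h₂ : Y p = Y' p)
    (h₃ : Z p = Z' p) : curvature cov X Y Z p = curvature cov X' Y' Z' p := by
  rw [(isSmoothTensorial_curvature₁ hcov Y hZ).pointwise hX hX' h₁,
    (isSmoothTensorial_curvature₂ hcov X' hZ).pointwise hY hY' h₂,
    (isSmoothTensorial_curvature₃ hcov hX' hY').pointwise hZ hZ' h₃]

include hcov in
theorem SmoothVectorAt.curvature (hX : SmoothVectorAt X p) (hY : SmoothVectorAt Y p)
    (hZ : SmoothVectorAt Z p) : SmoothVectorAt (curvature cov X Y Z) p := by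
  have h1 : ∀ {V W : Π q : M, TangentSpace (𝓡 d) q}, SmoothVectorAt V p → SmoothVectorAt W p →
      SmoothVectorAt (fun q ↦ V q - W q) p := fun h h' ↦ h.sub_section h'
  exact h1 (h1 (hcov p X _ hX (hcov p Y Z hY hZ)) (hcov p Y _ hY (hcov p X Z hX hZ)))
    (hcov p _ Z (hX.bracket hY) hZ)

/-- Traces written with `frame p` can thus be moved to a coordinate basis. -/
theorem sum_coord_eq_trace {ι : Type*} [Fintype ι] [DecidableEq ι] {T : Type*} [AddCommGroup T]
    [Module ℝ T] (b : Module.Basis ι ℝ T) (φ : T →ₗ[ℝ] T) :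
    ∑ c, b.coord c (φ (b c)) = LinearMap.trace ℝ T φ := by
  rw [LinearMap.trace_eq_matrix_trace ℝ b, Matrix.trace]
  simp [LinearMap.toMatrix_apply]

/-- The map `x ↦ R(x, Y) Z` at `p`. -/
noncomputable def curvatureMap (Y Z : Π q : M, TangentSpace (𝓡 d) q) (p : M)
    (h : IsSmoothTensorial (fun X ↦ NullData.curvature cov X Y Z p) p) :
    TangentSpace (𝓡 d) p →ₗ[ℝ] TangentSpace (𝓡 d) p where
  toFun x := NullData.curvature cov (ext x) Y Z p
  map_add' x x' := by
    rw [← h.add (smoothVectorAt_ext x) (smoothVectorAt_ext x')]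
    refine h.pointwise (smoothVectorAt_ext _) ((smoothVectorAt_ext x).add' (smoothVectorAt_ext x')) ?_
    simp [MetricHypersurfaceData.ext_self]
  map_smul' c x := by
    have h1 : SmoothFnAt d (fun _ : M ↦ c) p := contMDiffAt_const
    rw [RingHom.id_apply, ← h.smul h1 (smoothVectorAt_ext x)]
    refine h.pointwise (smoothVectorAt_ext _) ((smoothVectorAt_ext x).smul' h1) ?_
    simp [MetricHypersurfaceData.ext_self]

include hcov in
/-- The Ricci tensor as a trace in any basis. -/
theorem ricci_eq_sum {ι : Type*} [Fintype ι] [DecidableEq ι]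
    (b : Module.Basis ι ℝ (TangentSpace (𝓡 d) p)) (hV : SmoothVectorAt V p)
    (hW : SmoothVectorAt W p) {E : ι → Π q : M, TangentSpace (𝓡 d) q}
    (hE : ∀ c, SmoothVectorAt (E c) p) (hEb : ∀ c, E c p = b c) :
    ricci cov p (V p) (W p) = ∑ c, b.coord c (NullData.curvature cov (E c) W V p) := by
  have h := isSmoothTensorial_curvature₁ hcov (Z := V) W hV
  have h1 : ricci cov p (V p) (W p) = LinearMap.trace ℝ _ (curvatureMap W V p h) := by
    rw [← sum_coord_eq_trace (frame p)]
    refine Finset.sum_congr rfl fun c _ ↦ ?_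
    congr 1
    exact curvature_pointwise hcov (smoothVectorAt_ext _) (smoothVectorAt_ext _)
      (smoothVectorAt_ext _) (smoothVectorAt_ext _) hW hV rfl
      (MetricHypersurfaceData.ext_self _) (MetricHypersurfaceData.ext_self _)
  rw [h1, ← sum_coord_eq_trace b]
  refine Finset.sum_congr rfl fun c _ ↦ ?_
  congr 1
  exact h.pointwise (smoothVectorAt_ext _) (hE c)
    ((MetricHypersurfaceData.ext_self _).trans (hEb c).symm)

include hcov in
theorem exists_ricci : ∃ L : TwoTensor d M, ∀ p v w, L p v w = ricci cov p v w := by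
  have hext : ∀ {p : M} (v : TangentSpace (𝓡 d) p), SmoothVectorAt (ext v) p := smoothVectorAt_ext
  have hs : ∀ {p : M} (v : TangentSpace (𝓡 d) p), ext v p = v := MetricHypersurfaceData.ext_self
  have h1 : ∀ {p : M} {V W : Π q : M, TangentSpace (𝓡 d) q}, SmoothVectorAt V p →
      SmoothVectorAt W p → ricci cov p (V p) (W p)
        = ∑ c, (frame p).coord c (NullData.curvature cov (ext (frame p c)) W V p) :=
    fun {p V W} hV hW ↦ ricci_eq_sum hcov (frame p) hV hW (fun c ↦ hext _) fun c ↦ hs _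
  let L : Π q : M, TangentSpace (𝓡 d) q →L[ℝ] TangentSpace (𝓡 d) q →L[ℝ] ℝ := fun p ↦
    ((LinearMap.toContinuousLinearMap :
      (TangentSpace (𝓡 d) p →ₗ[ℝ] ℝ) ≃ₗ[ℝ] (TangentSpace (𝓡 d) p →L[ℝ] ℝ)).toLinearMap ∘ₗ
    LinearMap.mk₂ ℝ (fun v w ↦ ricci cov p v w)
      (fun v v' w ↦ by
        have := h1 ((hext v).add' (hext v')) (hext w)
        simp only [Pi.add_apply, hs] at this
        rw [this, ricci, ricci, ← Finset.sum_add_distrib]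
        refine Finset.sum_congr rfl fun c _ ↦ ?_
        rw [(isSmoothTensorial_curvature₃ hcov (hext _) (hext _)).add (hext v) (hext v'), map_add])
      (fun a v w ↦ by
        have ha : SmoothFnAt d (fun _ : M ↦ a) p := contMDiffAt_const
        have := h1 ((hext v).smul' ha) (hext w)
        simp only [Pi.smul_apply', hs] at this
        rw [this, ricci, smul_eq_mul, Finset.mul_sum]
        refine Finset.sum_congr rfl fun c _ ↦ ?_
        rw [(isSmoothTensorial_curvature₃ hcov (hext _) (hext _)).smul ha (hext v), map_smul,
          smul_eq_mul])
      (fun v w w' ↦ by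
        have := h1 (hext v) ((hext w).add' (hext w'))
        simp only [Pi.add_apply, hs] at this
        rw [this, ricci, ricci, ← Finset.sum_add_distrib]
        refine Finset.sum_congr rfl fun c _ ↦ ?_
        rw [(isSmoothTensorial_curvature₂ hcov _ (hext _)).add (hext w) (hext w'), map_add])
      (fun a v w ↦ by
        have ha : SmoothFnAt d (fun _ : M ↦ a) p := contMDiffAt_const
        have := h1 (hext v) ((hext w).smul' ha)
        simp only [Pi.smul_apply', hs] at this
        rw [this, ricci, smul_eq_mul, Finset.mul_sum]
        refine Finset.sum_congr rfl fun c _ ↦ ?_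
        rw [(isSmoothTensorial_curvature₂ hcov _ (hext _)).smul ha (hext w), map_smul,
          smul_eq_mul])).toContinuousLinearMap
  have hL : ∀ p v w, L p v w = ricci cov p v w := fun p v w ↦ rfl
  refine ⟨⟨L, fun p₀ ↦ ?_⟩, hL⟩
  have hp₀ := mem_chart_source (EuclideanSpace ℝ (Fin d)) p₀
  refine smoothTwoAt_of_coordFrame hp₀ fun i j ↦ ?_
  have he := fun i ↦ smoothVectorAt_coordFrame p₀ hp₀ i
  -- `frame q` refers to the preferred chart at `q` and need not vary smoothly with `q`; the trace
  -- is smooth because it can be computed in the coordinate frame at `p₀`.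
  have h2 : SmoothFnAt d (fun q ↦ ∑ c, coordCoeff p₀ c q (NullData.curvature cov (coordFrame p₀ c)
      (coordFrame p₀ j) (coordFrame p₀ i) q)) p₀ :=
    ContMDiffAt.sum fun c _ ↦ (smoothVectorAt_iff_coordCoeff p₀ hp₀).1
      (SmoothVectorAt.curvature hcov (he c) (he j) (he i)) c
  refine h2.congr_of_eventuallyEq ?_
  filter_upwards [eventually_mem_chartAt_source (d := d) p₀] with q hq
  have he := fun i ↦ smoothVectorAt_coordFrame p₀ hq i
  rw [hL, ricci_eq_sum hcov (coordBasis p₀ hq) (he i) (he j) he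
    fun c ↦ (coordBasis_apply p₀ hq c).symm]
  exact Finset.sum_congr rfl fun c _ ↦ coordBasis_repr p₀ hq _ c

end Curvature

/-! ### Linear equations along a vector field. -/

section LinearTransport

variable {E : Type*} [NormedAddCommGroup E] [NormedSpace ℝ E] [FiniteDimensional ℝ E]
  {H : Type*} [TopologicalSpace H] [T2Space H] [ChartedSpace E H] [IsManifold 𝓘(ℝ, E) ∞ H]
  {X : Π p : H, TangentSpace 𝓘(ℝ, E) p}
  {V : Type*} [NormedAddCommGroup V] [NormedSpace ℝ V] [FiniteDimensional ℝ V]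
  {Vb : H → Type*} {Sm Eq : (Π q, Vb q) → H → Prop}

/-- An equation which in local coordinates is a linear differential equation along `X`. -/
def IsLinearTransport (V : Type*) [NormedAddCommGroup V] [NormedSpace ℝ V]
    (X : Π p : H, TangentSpace 𝓘(ℝ, E) p) (Sm Eq : (Π q, Vb q) → H → Prop) : Prop :=
  ∀ p₀ : H, ∃ (W : Set H) (e : Π q, Vb q → V) (e' : Π q, V → Vb q) (A : H → V →L[ℝ] V) (b : H → V),
    IsOpen W ∧ p₀ ∈ W ∧ (∀ q ∈ W, ∀ v, e q (e' q v) = v) ∧ (∀ q ∈ W, ∀ t, e' q (e q t) = t) ∧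
    (∀ q ∈ W, ContMDiffAt 𝓘(ℝ, E) 𝓘(ℝ, V →L[ℝ] V) ∞ A q ∧ ContMDiffAt 𝓘(ℝ, E) 𝓘(ℝ, V) ∞ b q) ∧
    (∀ T, ∀ q ∈ W, Sm T q ↔ ContMDiffAt 𝓘(ℝ, E) 𝓘(ℝ, V) ∞ (fun z ↦ e z (T z)) q) ∧
    ∀ T, ∀ q ∈ W, Sm T q → (Eq T q ↔
      mvfderiv 𝓘(ℝ, E) (fun z ↦ e z (T z)) q (X q) = A q (e q (T q)) + b q)

theorem contMDiffAt_ringInverse {M : H → V →L[ℝ] V} {q : H}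
    (hM : ContMDiffAt 𝓘(ℝ, E) 𝓘(ℝ, V →L[ℝ] V) ∞ M q) (h : IsUnit (M q)) :
    ContMDiffAt 𝓘(ℝ, E) 𝓘(ℝ, V →L[ℝ] V) ∞ (fun z ↦ Ring.inverse (M z)) q := by
  have : CompleteSpace V := FiniteDimensional.complete ℝ V
  obtain ⟨x, hx⟩ := h
  have h1 : ContDiffAt ℝ ∞ (Ring.inverse : (V →L[ℝ] V) → _) (M q) := by
    rw [← hx]
    exact contDiffAt_ringInverse ℝ x
  exact h1.contMDiffAt.comp q hM

/-- Linear differential equations along a vector field without zeros are transport equations. -/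
theorem IsLinearTransport.isTransport (hE : IsLinearTransport V X Sm Eq)
    (hX : ∀ p, SmoothVectorAt X p) (hX₀ : ∀ p, X p ≠ 0) :
    IsTransport V X Sm (fun T q ↦ ∀ᶠ q' in 𝓝 q, Sm T q' ∧ Eq T q') := by
  intro p₀
  have : CompleteSpace V := FiniteDimensional.complete ℝ V
  obtain ⟨W, e, e', A, b, hW, hp₀, hee', he'e, hAb, hSm, hEq⟩ := hE p₀
  -- One flow box provides a fundamental solution `M` with `M' = AM` and a particular solution `z`
  -- with `z' = Az + b`, equal to `1` and `0` at `p₀`.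
  let G : H × ((V →L[ℝ] V) × V) → (V →L[ℝ] V) × V := fun x ↦
    ((A x.1).comp x.2.1, A x.1 x.2.2 + b x.1)
  have hG : ∀ p ∈ W, ∀ w, ContMDiffAt (𝓘(ℝ, E).prod 𝓘(ℝ, (V →L[ℝ] V) × V))
      𝓘(ℝ, (V →L[ℝ] V) × V) ∞ G (p, w) := by
    intro p hp w
    have hA : ContMDiffAt (𝓘(ℝ, E).prod 𝓘(ℝ, (V →L[ℝ] V) × V)) 𝓘(ℝ, V →L[ℝ] V) ∞
        (fun x : H × ((V →L[ℝ] V) × V) ↦ A x.1) (p, w) := (hAb p hp).1.comp (p, w) contMDiffAt_fst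
    have hb : ContMDiffAt (𝓘(ℝ, E).prod 𝓘(ℝ, (V →L[ℝ] V) × V)) 𝓘(ℝ, V) ∞
        (fun x : H × ((V →L[ℝ] V) × V) ↦ b x.1) (p, w) := (hAb p hp).2.comp (p, w) contMDiffAt_fst
    have h1 : ContMDiffAt (𝓘(ℝ, E).prod 𝓘(ℝ, (V →L[ℝ] V) × V)) 𝓘(ℝ, V →L[ℝ] V) ∞
        (fun x : H × ((V →L[ℝ] V) × V) ↦ x.2.1) (p, w) :=
      (contDiff_fst.contDiffAt.contMDiffAt (x := w)).comp (p, w) contMDiffAt_snd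
    have h2 : ContMDiffAt (𝓘(ℝ, E).prod 𝓘(ℝ, (V →L[ℝ] V) × V)) 𝓘(ℝ, V) ∞
        (fun x : H × ((V →L[ℝ] V) × V) ↦ x.2.2) (p, w) :=
      (contDiff_snd.contDiffAt.contMDiffAt (x := w)).comp (p, w) contMDiffAt_snd
    exact (hA.clm_comp h1).prodMk_space ((hA.clm_apply h2).add hb)
  obtain ⟨K, ε, O, Ψ, y₀, hΨ, hy₀, hΨ0, htW, w, hw0, hw, hode⟩ :=
    exists_isFlowBox_of_ne_zero hW (fun p _ ↦ hX p) hG (1, 0) hp₀ (hX₀ p₀)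
  have hp₀t : p₀ ∈ Ψ.target := by
    rw [← hΨ0]
    refine Ψ.map_source ?_
    rw [hΨ.source_eq]
    exact ⟨⟨by simpa using hΨ.pos, hΨ.pos⟩, hy₀⟩
  have hM : ∀ q ∈ Ψ.target, ContMDiffAt 𝓘(ℝ, E) 𝓘(ℝ, V →L[ℝ] V) ∞ (fun z ↦ (w z).1) q :=
    fun q hq ↦ (contDiff_fst.contDiffAt.contMDiffAt (x := w q)).comp q (hw q hq)
  have hz : ∀ q ∈ Ψ.target, ContMDiffAt 𝓘(ℝ, E) 𝓘(ℝ, V) ∞ (fun z ↦ (w z).2) q :=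
    fun q hq ↦ (contDiff_snd.contDiffAt.contMDiffAt (x := w q)).comp q (hw q hq)
  let W' : Set H := Ψ.target ∩ (fun z ↦ (w z).1) ⁻¹' {x | IsUnit x}
  have hW' : IsOpen W' := ContinuousOn.isOpen_inter_preimage
    (fun q hq ↦ (hM q hq).continuousAt.continuousWithinAt) Ψ.open_target Units.isOpen
  have hinv : ∀ q ∈ W', ∀ v, (w q).1 (Ring.inverse (w q).1 v) = v := fun q hq v ↦ by
    have := DFunLike.congr_fun (Ring.mul_inverse_cancel (w q).1 hq.2) v
    simpa using this
  have hinv' : ∀ q ∈ W', ∀ v, Ring.inverse (w q).1 ((w q).1 v) = v := fun q hq v ↦ by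
    have := DFunLike.congr_fun (Ring.inverse_mul_cancel (w q).1 hq.2) v
    simpa using this
  -- Variation of constants: near `p₀` the operator `M` is invertible, and `M⁻¹(e - z)` is the
  -- trivialisation in which solutions are constant along `X`.
  let ε' : Π q, Vb q → V := fun q t ↦ Ring.inverse (w q).1 (e q t - (w q).2)
  have hε : ∀ q ∈ W', ∀ t, e q t = (w q).1 (ε' q t) + (w q).2 := fun q hq t ↦ by
    simp only [ε']
    rw [hinv q hq]
    abel
  have hsm : ∀ T : Π q, Vb q, ∀ q ∈ W', ContMDiffAt 𝓘(ℝ, E) 𝓘(ℝ, V) ∞ (fun z ↦ e z (T z)) q ↔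
      ContMDiffAt 𝓘(ℝ, E) 𝓘(ℝ, V) ∞ (fun z ↦ ε' z (T z)) q := by
    intro T q hq
    refine ⟨fun h ↦ (contMDiffAt_ringInverse (hM q hq.1) hq.2).clm_apply (h.sub (hz q hq.1)),
      fun h ↦ ?_⟩
    refine (((hM q hq.1).clm_apply h).add (hz q hq.1)).congr_of_eventuallyEq ?_
    filter_upwards [hW'.mem_nhds hq] with z hz
    exact hε z hz _
  have hder : ∀ T : Π q, Vb q, ∀ q ∈ W', ContMDiffAt 𝓘(ℝ, E) 𝓘(ℝ, V) ∞ (fun z ↦ e z (T z)) q →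
      mvfderiv 𝓘(ℝ, E) (fun z ↦ e z (T z)) q (X q) = A q (e q (T q)) + b q
        + (w q).1 (mvfderiv 𝓘(ℝ, E) (fun z ↦ ε' z (T z)) q (X q)) := by
    intro T q hq h
    obtain ⟨⟨s, y⟩, hsy, rfl⟩ : ∃ x ∈ Ψ.source, Ψ x = q :=
      ⟨Ψ.symm q, Ψ.map_target hq.1, Ψ.right_inv hq.1⟩
    rw [hΨ.source_eq] at hsy
    have hs := hsy.1
    have h' := (hsm T _ hq).1 h
    have d1 := hasDerivAt_comp_integralCurve (V := V) (hΨ.integral y hsy.2) hs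
      (h.mdifferentiableAt (by simp))
    have d2 := hasDerivAt_comp_integralCurve (V := V) (hΨ.integral y hsy.2) hs
      (h'.mdifferentiableAt (by simp))
    have d3 := hode y hsy.2 s hs
    have d31 : HasDerivAt (fun s ↦ (w (Ψ (s, y))).1) ((A (Ψ (s, y))).comp (w (Ψ (s, y))).1) s := by
      simpa [G] using d3.hasFDerivAt.fst.hasDerivAt
    have d32 : HasDerivAt (fun s ↦ (w (Ψ (s, y))).2)
        (A (Ψ (s, y)) (w (Ψ (s, y))).2 + b (Ψ (s, y))) s := by
      simpa [G] using d3.hasFDerivAt.snd.hasDerivAt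
    have d5 := (d31.clm_apply d2).add d32
    have hcont : ContinuousAt (fun s ↦ Ψ (s, y)) s :=
      continuousAt_integralCurve (hΨ.integral y hsy.2) hs
    have heq : (fun s ↦ e (Ψ (s, y)) (T (Ψ (s, y)))) =ᶠ[𝓝 s]
        ((fun s ↦ (w (Ψ (s, y))).1 (ε' (Ψ (s, y)) (T (Ψ (s, y))))) +
          fun s ↦ (w (Ψ (s, y))).2) := by
      filter_upwards [hcont (hW'.mem_nhds hq)] with z hz
      exact hε _ hz _
    have := d1.unique (d5.congr_of_eventuallyEq heq)
    rw [this, hε _ hq (T (Ψ (s, y)))]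
    simp only [map_add, ContinuousLinearMap.comp_apply]
    abel
  refine ⟨W', ε', fun q v ↦ e' q ((w q).1 v + (w q).2), hW', ⟨hp₀t, ?_⟩, ?_, ?_, ?_, ?_⟩
  · simp [hw0]
  · intro q hq v
    simp only [ε', hee' q (htW hq.1), add_sub_cancel_right, hinv' q hq]
  · intro q hq t
    dsimp only
    rw [← hε q hq, he'e q (htW hq.1)]
  · intro T q hq
    refine ⟨fun h ↦ ?_, fun h ↦ ?_⟩ <;> filter_upwards [h, hW'.mem_nhds hq] with z hz hzW
    · have h1 := (hSm T z (htW hzW.1)).1 hz.1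
      refine ⟨(hsm T z hzW).1 h1, ?_⟩
      have h2 := (hEq T z (htW hzW.1) hz.1).1 hz.2
      rw [hder T z hzW h1] at h2
      have h3 := congrArg (fun v ↦ Ring.inverse (w z).1 v) (add_eq_left.1 h2)
      simpa only [hinv' z hzW, map_zero] using h3
    · have h1 := (hsm T z hzW).2 hz.1
      have h2 := (hSm T z (htW hzW.1)).2 h1
      refine ⟨h2, (hEq T z (htW hzW.1) h2).2 ?_⟩
      rw [hder T z hzW h1, hz.2, map_zero, add_zero]
  · intro T q hq h
    exact (hsm T q hq).1 ((hSm T q (htW hq.1)).1 h)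

/-- Two solutions of a linear transport equation which agree on a slice are equal. -/
theorem IsLinearTransport.eq_of_eqOn (hE : IsLinearTransport V X Sm Eq)
    (hX : ∀ p, SmoothVectorAt X p) (hX₀ : ∀ p, X p ≠ 0) {R : Set H} (hR : IsSlice X R)
    {T T' : Π q, Vb q} (hT : ∀ q, Sm T q ∧ Eq T q) (hT' : ∀ q, Sm T' q ∧ Eq T' q)
    (h : ∀ q ∈ R, T q = T' q) (q : H) : T q = T' q := by
  obtain ⟨a, b, c, ha, hb, hc0, hc, t, ht, htR⟩ := hR.meets q
  rw [← hc0]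
  exact (hE.isTransport hX hX₀).eq_along hc ht ⟨ha, hb⟩
    (fun s _ ↦ ⟨Eventually.of_forall hT, Eventually.of_forall hT'⟩) (h _ htR)

end LinearTransport

/-! ### Linear equations `L_X T = φ T + B` for tensor fields. -/

section TensorTransport

variable {d : ℕ} {M : Type*} [TopologicalSpace M] [ChartedSpace (EuclideanSpace ℝ (Fin d)) M]
  [IsManifold (𝓡 d) ∞ M]

/-- The bilinear forms on a tangent space. -/
abbrev TwoForms (d : ℕ) {M : Type*} [TopologicalSpace M]
    [ChartedSpace (EuclideanSpace ℝ (Fin d)) M] (q : M) : Type _ :=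
  TangentSpace (𝓡 d) q →L[ℝ] TangentSpace (𝓡 d) q →L[ℝ] ℝ

/-- A bilinear map on a tangent space as a continuous bilinear map. -/
noncomputable def toTwoForms {q : M} (b : TangentSpace (𝓡 d) q → TangentSpace (𝓡 d) q → ℝ)
    (h₁ : ∀ v v' w, b (v + v') w = b v w + b v' w) (h₂ : ∀ (c : ℝ) v w, b (c • v) w = c * b v w)
    (h₃ : ∀ v w w', b v (w + w') = b v w + b v w') (h₄ : ∀ (c : ℝ) v w, b v (c • w) = c * b v w) :
    TwoForms d q :=
  LinearMap.toContinuousLinearMap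
    { toFun := fun v ↦ LinearMap.toContinuousLinearMap
        { toFun := b v, map_add' := h₃ v, map_smul' := fun c w ↦ h₄ c v w }
      map_add' := fun v v' ↦ by ext w; exact h₁ v v' w
      map_smul' := fun c v ↦ by ext w; exact h₂ c v w }

/-- In finite dimension a bilinear formula is automatically continuous, so smoothness on smooth
fields is all that has to be supplied. -/
theorem exists_twoTensor (b : Π q : M, TangentSpace (𝓡 d) q → TangentSpace (𝓡 d) q → ℝ)
    (h₁ : ∀ q v v' w, b q (v + v') w = b q v w + b q v' w)
    (h₂ : ∀ q (c : ℝ) v w, b q (c • v) w = c * b q v w)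
    (h₃ : ∀ q v w w', b q v (w + w') = b q v w + b q v w')
    (h₄ : ∀ q (c : ℝ) v w, b q v (c • w) = c * b q v w)
    (h : ∀ (p : M) (V W : Π q : M, TangentSpace (𝓡 d) q), SmoothVectorAt V p → SmoothVectorAt W p →
      SmoothFnAt d (fun q ↦ b q (V q) (W q)) p) :
    ∃ T : TwoTensor d M, ∀ p v w, T p v w = b p v w :=
  ⟨⟨fun q ↦ toTwoForms (b q) (h₁ q) (h₂ q) (h₃ q) (h₄ q), fun p ↦
    smoothTwoAt_of_apply (T := fun q ↦ toTwoForms (b q) (h₁ q) (h₂ q) (h₃ q) (h₄ q)) (h p)⟩,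
    fun _ _ _ ↦ rfl⟩

theorem exists_oneForm (b : Π q : M, TangentSpace (𝓡 d) q → ℝ)
    (h₁ : ∀ q v v', b q (v + v') = b q v + b q v')
    (h₂ : ∀ q (c : ℝ) v, b q (c • v) = c * b q v)
    (h : ∀ (p : M) (V : Π q : M, TangentSpace (𝓡 d) q), SmoothVectorAt V p →
      SmoothFnAt d (fun q ↦ b q (V q)) p) :
    ∃ θ : OneForm d M, ∀ p v, θ p v = b p v := by
  let θ : Π q : M, TangentSpace (𝓡 d) q →L[ℝ] ℝ := fun q ↦ LinearMap.toContinuousLinearMap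
    { toFun := b q, map_add' := h₁ q, map_smul' := h₂ q }
  exact ⟨⟨θ, fun p ↦ smoothOneAt_of_apply (θ := θ) (h p)⟩, fun _ _ ↦ rfl⟩

/-- The bilinear form with given components in the chart at `p₀`. -/
noncomputable def ofComponents (p₀ q : M) (a : Fin d → Fin d → ℝ) : TwoForms d q :=
  toTwoForms (fun v w ↦ ∑ i, ∑ j, a i j * (coordCoeff p₀ i q v * coordCoeff p₀ j q w))
    (fun v v' w ↦ by simp [← Finset.sum_add_distrib, add_mul, mul_add])
    (fun c v w ↦ by
      simp only [map_smul, smul_eq_mul, Finset.mul_sum]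
      exact Finset.sum_congr rfl fun i _ ↦ Finset.sum_congr rfl fun j _ ↦ by ring)
    (fun v w w' ↦ by simp [← Finset.sum_add_distrib, mul_add])
    (fun c v w ↦ by
      simp only [map_smul, smul_eq_mul, Finset.mul_sum]
      exact Finset.sum_congr rfl fun i _ ↦ Finset.sum_congr rfl fun j _ ↦ by ring)

/-- The components of a bilinear form in the chart at `p₀`. -/
noncomputable def components (p₀ q : M) (T : TwoForms d q) : Fin d → Fin d → ℝ := fun i j ↦
  T (coordFrame p₀ i q) (coordFrame p₀ j q)

theorem ofComponents_apply (p₀ q : M) (a : Fin d → Fin d → ℝ) (v w : TangentSpace (𝓡 d) q) :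
    ofComponents p₀ q a v w
      = ∑ i, ∑ j, a i j * (coordCoeff p₀ i q v * coordCoeff p₀ j q w) := rfl

theorem components_ofComponents {p₀ q : M}
    (hq : q ∈ (chartAt (EuclideanSpace ℝ (Fin d)) p₀).source) (a : Fin d → Fin d → ℝ) :
    components p₀ q (ofComponents p₀ q a) = a := by
  ext i j
  simp [components, ofComponents_apply, coordCoeff_coordFrame p₀ hq]

theorem ext_of_coordFrame {p₀ q : M} (hq : q ∈ (chartAt (EuclideanSpace ℝ (Fin d)) p₀).source)
    {b b' : TangentSpace (𝓡 d) q →ₗ[ℝ] TangentSpace (𝓡 d) q →ₗ[ℝ] ℝ}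
    (h : ∀ i j, b (coordFrame p₀ i q) (coordFrame p₀ j q)
      = b' (coordFrame p₀ i q) (coordFrame p₀ j q)) : b = b' := by
  refine (coordBasis p₀ hq).ext fun i ↦ (coordBasis p₀ hq).ext fun j ↦ ?_
  rw [coordBasis_apply, coordBasis_apply]
  exact h i j

/-- The underlying bilinear map. -/
noncomputable def toBilin {q : M} (T : TwoForms d q) : TangentSpace (𝓡 d) q →ₗ[ℝ] TangentSpace (𝓡 d) q →ₗ[ℝ] ℝ :=
  LinearMap.mk₂ ℝ (fun v w ↦ T v w) (by simp) (by simp) (by simp) (by simp)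

theorem ofComponents_components {p₀ q : M}
    (hq : q ∈ (chartAt (EuclideanSpace ℝ (Fin d)) p₀).source) (T : TwoForms d q) :
    ofComponents p₀ q (components p₀ q T) = T := by
  have h : toBilin (ofComponents p₀ q (components p₀ q T)) = toBilin T :=
    ext_of_coordFrame hq fun i j ↦
      congrFun (congrFun (components_ofComponents hq (components p₀ q T)) i) j
  ext v w
  exact DFunLike.congr_fun (DFunLike.congr_fun h v) w

theorem exists_lieDeriv_hom {X : Π q : M, TangentSpace (𝓡 d) q} {p : M}
    {T : Π q : M, TwoForms d q} (hT : SmoothTwoAt T p) :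
    ∃ L : TwoForms d p, ∀ v w, L v w = lieDeriv X (fun q v w ↦ T q v w) p v w := by
  refine ⟨TensorialAt.mkHom₂ (fun V W ↦ lieExpr X (fun q ↦ T q) V W p) p
      (fun _ hW ↦ lieExpr_tensorial₁ hT hW) (fun _ hV ↦ lieExpr_tensorial₂ hT hV), fun v w ↦ ?_⟩
  have h := TensorialAt.mkHom₂_apply (fun _ hW ↦ lieExpr_tensorial₁ (X := X) hT hW)
      (fun _ hV ↦ lieExpr_tensorial₂ hT hV) (MetricHypersurfaceData.diffAt_ext v)
      (MetricHypersurfaceData.diffAt_ext w)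
  have h' := lieDeriv_apply (X := X) hT (MetricHypersurfaceData.diffAt_ext v)
      (MetricHypersurfaceData.diffAt_ext w)
  rw [MetricHypersurfaceData.ext_self, MetricHypersurfaceData.ext_self] at h h'
  exact h.trans h'.symm

/-- Linear terms of order zero of a differential equation for `(0,2)` tensor fields. -/
structure IsLinearTerm
    (φ : Π q : M, TwoForms d q → TangentSpace (𝓡 d) q → TangentSpace (𝓡 d) q → ℝ) : Prop where
  map_add : ∀ q T T' v w, φ q (T + T') v w = φ q T v w + φ q T' v w
  map_smul : ∀ q (c : ℝ) T v w, φ q (c • T) v w = c * φ q T v w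
  add_left : ∀ q T v v' w, φ q T (v + v') w = φ q T v w + φ q T v' w
  smul_left : ∀ q T (c : ℝ) v w, φ q T (c • v) w = c * φ q T v w
  add_right : ∀ q T v w w', φ q T v (w + w') = φ q T v w + φ q T v w'
  smul_right : ∀ q T (c : ℝ) v w, φ q T v (c • w) = c * φ q T v w
  smooth : ∀ (T : Π q : M, TwoForms d q) (p : M) (V W : Π q : M, TangentSpace (𝓡 d) q),
    SmoothTwoAt T p → SmoothVectorAt V p → SmoothVectorAt W p →
      SmoothFnAt d (fun q ↦ φ q (T q) (V q) (W q)) p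

theorem smoothTwoAt_ofComponents {p₀ p : M}
    (hp : p ∈ (chartAt (EuclideanSpace ℝ (Fin d)) p₀).source) (a : Fin d → Fin d → ℝ) :
    SmoothTwoAt (fun q ↦ ofComponents p₀ q a) p := by
  refine smoothTwoAt_of_coordFrame hp fun i j ↦ ?_
  refine (contMDiffAt_const (c := a i j)).congr_of_eventuallyEq ?_
  filter_upwards [(chartAt (EuclideanSpace ℝ (Fin d)) p₀).open_source.mem_nhds hp] with q hq
  exact congrFun (congrFun (components_ofComponents hq a) i) j

theorem smoothTwoAt_iff_components {p₀ p : M} {T : Π q : M, TwoForms d q}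
    (hp : p ∈ (chartAt (EuclideanSpace ℝ (Fin d)) p₀).source) :
    SmoothTwoAt T p ↔
      ContMDiffAt (𝓡 d) 𝓘(ℝ, Fin d → Fin d → ℝ) ∞ (fun q ↦ components p₀ q (T q)) p := by
  simp only [contMDiffAt_pi_space]
  exact ⟨fun h i j ↦ h.apply (smoothVectorAt_coordFrame p₀ hp i) (smoothVectorAt_coordFrame p₀ hp j),
    fun h ↦ smoothTwoAt_of_coordFrame hp h⟩

/-- A component of a matrix. -/
def entry (k l : Fin d) : (Fin d → Fin d → ℝ) →L[ℝ] ℝ :=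
  (ContinuousLinearMap.proj (R := ℝ) (φ := fun _ : Fin d ↦ ℝ) l).comp
    (ContinuousLinearMap.proj (R := ℝ) (φ := fun _ : Fin d ↦ Fin d → ℝ) k)

theorem mvfderiv_pi_apply {u : M → Fin d → Fin d → ℝ} {p : M}
    (hu : MDifferentiableAt (𝓡 d) 𝓘(ℝ, Fin d → Fin d → ℝ) u p) (v : TangentSpace (𝓡 d) p)
    (i j : Fin d) : mvfderiv (𝓡 d) u p v i j = dirDeriv (fun q ↦ u q i j) p v := by
  let L : (Fin d → Fin d → ℝ) →L[ℝ] ℝ := entry i j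
  have h := mvfderiv_comp_apply (I' := 𝓡 d) (I := 𝓘(ℝ, Fin d → Fin d → ℝ)) (g := L)
    (f := u) p (L.differentiableAt (x := u p)).mdifferentiableAt hu v
  refine Eq.trans ?_ h.symm
  have h2 : mvfderiv 𝓘(ℝ, Fin d → Fin d → ℝ) L (u p) = L := by
    have := L.hasFDerivAt (x := u p)
    exact this.hasMFDerivAt.mfderiv
  rw [h2]
  rfl

/-- The linear map on matrices with given components. -/
noncomputable def matrixMap (a : Fin d → Fin d → Fin d → Fin d → ℝ) :
    (Fin d → Fin d → ℝ) →L[ℝ] (Fin d → Fin d → ℝ) :=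
  ContinuousLinearMap.pi fun i ↦ ContinuousLinearMap.pi fun j ↦ ∑ k, ∑ l,
    a i j k l • entry k l

theorem matrixMap_apply (a : Fin d → Fin d → Fin d → Fin d → ℝ) (v : Fin d → Fin d → ℝ)
    (i j : Fin d) : matrixMap a v i j = ∑ k, ∑ l, a i j k l * v k l := by
  simp [matrixMap, entry]

theorem contMDiffAt_matrixMap {a : M → Fin d → Fin d → Fin d → Fin d → ℝ} {p : M}
    (ha : ∀ i j k l, SmoothFnAt d (fun q ↦ a q i j k l) p) :
    ContMDiffAt (𝓡 d) 𝓘(ℝ, (Fin d → Fin d → ℝ) →L[ℝ] (Fin d → Fin d → ℝ)) ∞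
      (fun q ↦ matrixMap (a q)) p := by
  let L : (Fin d → Fin d → Fin d → Fin d → ℝ) →ₗ[ℝ]
      (Fin d → Fin d → ℝ) →L[ℝ] (Fin d → Fin d → ℝ) :=
    { toFun := matrixMap
      map_add' := fun a b ↦ by
        ext v i j
        simp only [matrixMap_apply, add_apply, Pi.add_apply, add_mul,
          Finset.sum_add_distrib]
      map_smul' := fun c a ↦ by
        ext v i j
        simp only [matrixMap_apply, smul_apply, Pi.smul_apply, smul_eq_mul,
          RingHom.id_apply, Finset.mul_sum, mul_assoc] }
  have h1 : ContMDiffAt (𝓡 d) 𝓘(ℝ, Fin d → Fin d → Fin d → Fin d → ℝ) ∞ a p := by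
    simp only [contMDiffAt_pi_space]
    exact ha
  exact (L.toContinuousLinearMap.contDiff.contDiffAt.contMDiffAt).comp p h1

variable [T2Space M] {X : Π q : M, TangentSpace (𝓡 d) q}
  {φ : Π q : M, TwoForms d q → TangentSpace (𝓡 d) q → TangentSpace (𝓡 d) q → ℝ}

/-- The matrix with one entry `1`. -/
def unitMatrix (k l : Fin d) : Fin d → Fin d → ℝ := fun i j ↦ if i = k ∧ j = l then 1 else 0

theorem IsLinearTerm.eq_sum (hφ : IsLinearTerm φ) {p₀ q : M} (a : Fin d → Fin d → ℝ)
    (v w : TangentSpace (𝓡 d) q) :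
    φ q (ofComponents p₀ q a) v w
      = ∑ k, ∑ l, φ q (ofComponents p₀ q (unitMatrix k l)) v w * a k l := by
  let L : (Fin d → Fin d → ℝ) →ₗ[ℝ] ℝ :=
    { toFun := fun a ↦ φ q (ofComponents p₀ q a) v w
      map_add' := fun a b ↦ by
        rw [← hφ.map_add]
        congr 1
        ext v w
        simp [ofComponents_apply, add_mul, Finset.sum_add_distrib]
      map_smul' := fun c a ↦ by
        rw [RingHom.id_apply, smul_eq_mul, ← hφ.map_smul]
        congr 1
        ext v w
        simp [ofComponents_apply, Finset.mul_sum, mul_assoc] }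
  have ha : a = ∑ k, ∑ l, a k l • unitMatrix k l := by
    ext i j
    simp [Finset.sum_apply, unitMatrix, ite_and]
  change L a = ∑ k, ∑ l, L _ * a k l
  conv_lhs => rw [ha]
  simp only [map_sum, L.map_smul, smul_eq_mul, mul_comm]

/-- The equation `L_X T = φ T + B` is a linear transport equation. -/
theorem isLinearTransport_twoTensor (hX : ∀ p, SmoothVectorAt X p) (hφ : IsLinearTerm φ)
    (B : TwoTensor d M) :
    IsLinearTransport (Fin d → Fin d → ℝ) X (Vb := fun q ↦ TwoForms d q)
      (fun T q ↦ SmoothTwoAt T q)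
      (fun T q ↦ ∀ v w, lieDeriv X (fun q v w ↦ T q v w) q v w = φ q (T q) v w + B q v w) := by
  intro p₀
  let W := (chartAt (EuclideanSpace ℝ (Fin d)) p₀).source
  have hW : IsOpen W := (chartAt (EuclideanSpace ℝ (Fin d)) p₀).open_source
  -- In the frame `e_i` one has `X(T_ij) = (L_X T)_ij + T([X, e_i], e_j) + T(e_i, [X, e_j])`. The
  -- coefficients collect the two bracket terms and `φ`.
  let a : M → Fin d → Fin d → Fin d → Fin d → ℝ := fun q i j k l ↦
    coordCoeff p₀ k q (bracket X (coordFrame p₀ i) q) * (if l = j then 1 else 0)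
      + (if k = i then 1 else 0) * coordCoeff p₀ l q (bracket X (coordFrame p₀ j) q)
      + φ q (ofComponents p₀ q (unitMatrix k l)) (coordFrame p₀ i q) (coordFrame p₀ j q)
  have hfr : ∀ {q}, q ∈ W → ∀ i, SmoothVectorAt (coordFrame p₀ i) q :=
    fun hq i ↦ smoothVectorAt_coordFrame p₀ hq i
  have ha : ∀ q ∈ W, ∀ i j k l, SmoothFnAt d (fun z ↦ a z i j k l) q := fun q hq i j k l ↦
    ((((smoothVectorAt_iff_coordCoeff p₀ hq).1 ((hX q).bracket (hfr hq i)) k).mul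
      contMDiffAt_const).add (contMDiffAt_const.mul
        ((smoothVectorAt_iff_coordCoeff p₀ hq).1 ((hX q).bracket (hfr hq j)) l))).add
          (hφ.smooth _ q _ _ (smoothTwoAt_ofComponents hq _) (hfr hq i) (hfr hq j))
  refine ⟨W, components p₀, ofComponents p₀, fun q ↦ matrixMap (a q),
    fun q ↦ components p₀ q (B q), hW, mem_chart_source _ p₀,
    fun q hq ↦ components_ofComponents hq, fun q hq ↦ ofComponents_components hq, fun q hq ↦
      ⟨contMDiffAt_matrixMap (ha q hq), (smoothTwoAt_iff_components hq).1 (B.contMDiff q)⟩,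
    fun T q hq ↦ smoothTwoAt_iff_components hq, fun T q hq hT ↦ ?_⟩
  obtain ⟨L, hL⟩ := exists_lieDeriv_hom (X := X) hT
  let Φ : TangentSpace (𝓡 d) q →ₗ[ℝ] TangentSpace (𝓡 d) q →ₗ[ℝ] ℝ :=
    LinearMap.mk₂ ℝ (fun v w ↦ φ q (T q) v w + B q v w)
      (fun v v' w ↦ by simp [hφ.add_left]; ring) (fun c v w ↦ by simp [hφ.smul_left]; ring)
      (fun v w w' ↦ by simp [hφ.add_right]; ring) (fun c v w ↦ by simp [hφ.smul_right]; ring)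
  have key : ∀ i j, mvfderiv (𝓡 d) (fun z ↦ components p₀ z (T z)) q (X q) i j
      = L (coordFrame p₀ i q) (coordFrame p₀ j q) + T q (bracket X (coordFrame p₀ i) q)
          (coordFrame p₀ j q) + T q (coordFrame p₀ i q) (bracket X (coordFrame p₀ j) q) := by
    intro i j
    rw [mvfderiv_pi_apply
      (((smoothTwoAt_iff_components hq).1 hT).mdifferentiableAt (by simp)), hL,
      lieDeriv_apply hT (hfr hq i).diffAt (hfr hq j).diffAt, lieExpr]
    simp only [components]
    ring
  have hA : ∀ i j, (matrixMap (a q) (components p₀ q (T q)) + components p₀ q (B q)) i j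
      = Φ (coordFrame p₀ i q) (coordFrame p₀ j q) + T q (bracket X (coordFrame p₀ i) q)
          (coordFrame p₀ j q) + T q (coordFrame p₀ i q) (bracket X (coordFrame p₀ j) q) := by
    intro i j
    have h1 : Φ (coordFrame p₀ i q) (coordFrame p₀ j q)
        = ∑ k, ∑ l, φ q (ofComponents p₀ q (unitMatrix k l)) (coordFrame p₀ i q)
          (coordFrame p₀ j q) * components p₀ q (T q) k l
          + B q (coordFrame p₀ i q) (coordFrame p₀ j q) := by
      rw [← hφ.eq_sum, ofComponents_components hq]
      rfl
    have h2 : T q (bracket X (coordFrame p₀ i) q) (coordFrame p₀ j q)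
        = ∑ k, ∑ l, coordCoeff p₀ k q (bracket X (coordFrame p₀ i) q) * (if l = j then 1 else 0)
          * components p₀ q (T q) k l := by
      conv_lhs => rw [eq_sum_coordCoeff p₀ hq (bracket X (coordFrame p₀ i) q)]
      simp [components]
    have h3 : T q (coordFrame p₀ i q) (bracket X (coordFrame p₀ j) q)
        = ∑ k, ∑ l, (if k = i then 1 else 0) * coordCoeff p₀ l q (bracket X (coordFrame p₀ j) q)
          * components p₀ q (T q) k l := by
      conv_lhs => rw [eq_sum_coordCoeff p₀ hq (bracket X (coordFrame p₀ j) q)]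
      simp [components]
    rw [h1, h2, h3]
    simp only [Pi.add_apply, matrixMap_apply, a, add_mul, Finset.sum_add_distrib]
    simp only [components]
    ring
  have hcomp : mvfderiv (𝓡 d) (fun z ↦ components p₀ z (T z)) q (X q)
        = matrixMap (a q) (components p₀ q (T q)) + components p₀ q (B q) ↔
      ∀ i j, L (coordFrame p₀ i q) (coordFrame p₀ j q)
        = Φ (coordFrame p₀ i q) (coordFrame p₀ j q) := by
    rw [funext_iff]
    refine forall_congr' fun i ↦ ?_
    rw [funext_iff]
    refine forall_congr' fun j ↦ ?_
    rw [hA]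
    refine (Eq.congr_left (key i j)).trans ?_
    rw [add_left_inj, add_left_inj]
  refine Iff.trans ?_ hcomp.symm
  constructor
  · intro h i j
    rw [hL]
    exact h _ _
  · intro h v w
    have : toBilin L = Φ := ext_of_coordFrame hq h
    rw [← hL]
    exact DFunLike.congr_fun (DFunLike.congr_fun this v) w

end TensorTransport

/-! ### Initial value problems on a cross-section. -/

section CrossSection

variable {m : ℕ} {H : Type*} [TopologicalSpace H] [T2Space H]
  [ChartedSpace (EuclideanSpace ℝ (Fin (m + 1))) H] [IsManifold (𝓡 (m + 1)) ∞ H]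
  {S : Type*} [TopologicalSpace S] [ChartedSpace (EuclideanSpace ℝ (Fin m)) S]
  [IsManifold (𝓡 m) ∞ S] {X : Π p : H, TangentSpace (𝓡 (m + 1)) p} {ι : S → H}
  {φ : Π q : H, TwoForms (m + 1) q → TangentSpace (𝓡 (m + 1)) q →
    TangentSpace (𝓡 (m + 1)) q → ℝ}

theorem IsCrossSection.isSlice (hι : IsCrossSection X ι) : IsSlice X (range ι) :=
  ⟨hι.meets, hι.meets_once⟩

theorem IsCrossSection.contMDiff (hι : IsCrossSection X ι) : ContMDiff (𝓡 m) (𝓡 (m + 1)) ∞ ι :=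
  hι.isSmoothEmbedding.contMDiff

/-- The vector field is transversal to the image of `ι`. -/
def IsTransversal (X : Π p : H, TangentSpace (𝓡 (m + 1)) p) (ι : S → H) : Prop :=
  ∀ (x : S) (a : ℝ) (v : TangentSpace (𝓡 m) x),
    a • X (ι x) + mfderiv (𝓡 m) (𝓡 (m + 1)) ι x v = 0 → a = 0 ∧ v = 0

/-- The slices of flow boxes are parametrised by a vector space. The inverse chart has invertible
derivative, so transversality passes to the parametrisation. -/
theorem IsTransversal.comp_chart_symm (hι : IsCrossSection X ι) (h : IsTransversal X ι) (x : S)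
    (a : ℝ) (y : EuclideanSpace ℝ (Fin m))
    (hy : a • X ((ι ∘ (chartAt (EuclideanSpace ℝ (Fin m)) x).symm)
        (chartAt (EuclideanSpace ℝ (Fin m)) x x))
      + mfderiv (𝓡 m) (𝓡 (m + 1)) (ι ∘ (chartAt (EuclideanSpace ℝ (Fin m)) x).symm)
        (chartAt (EuclideanSpace ℝ (Fin m)) x x) y = 0) : a = 0 ∧ y = 0 := by
  let c := chartAt (EuclideanSpace ℝ (Fin m)) x
  have hx : x ∈ c.source := mem_chart_source _ x
  have hcx : c.symm (c x) = x := c.left_inv hx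
  have hc := contMDiffAt_chartAt_symm (E := EuclideanSpace ℝ (Fin m)) x (c.map_source hx)
  have h1 : mfderiv (𝓡 m) (𝓡 (m + 1)) (ι ∘ c.symm) (c x)
      = (mfderiv (𝓡 m) (𝓡 (m + 1)) ι (c.symm (c x))).comp (mfderiv (𝓡 m) (𝓡 m) c.symm (c x)) :=
    mfderiv_comp _ ((hι.contMDiff _).mdifferentiableAt (by simp)) (hc.mdifferentiableAt (by simp))
  have h2 := h (c.symm (c x)) a (mfderiv (𝓡 m) (𝓡 m) c.symm (c x) y)
    (by rw [h1] at hy; exact hy)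
  refine ⟨h2.1, ?_⟩
  have h3 := (mdifferentiable_chart (I := 𝓡 m) x).comp_symm_deriv (c.map_source hx)
  have h4 := DFunLike.congr_fun h3 y
  refine h4.symm.trans ?_
  exact (congrArg (fun z ↦ mfderiv (𝓡 m) (𝓡 m) c (c.symm (c x)) z) h2.2).trans
    (ContinuousLinearMap.map_zero _)

/-- Existence for linear transport equations with initial data on a cross-section. -/
theorem exists_twoTensor_solution (hX : ∀ p, SmoothVectorAt X p) (hX₀ : ∀ p, X p ≠ 0)
    (hι : IsCrossSection X ι) (htr : IsTransversal X ι) (hφ : IsLinearTerm φ)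
    (B : TwoTensor (m + 1) H) (T₀ : Π q : H, TwoForms (m + 1) q)
    (hT₀ : ∀ x : S, ∃ T₁ : Π q : H, TwoForms (m + 1) q,
      (∀ᶠ q in 𝓝 (ι x), SmoothTwoAt T₁ q) ∧ ∀ᶠ x' in 𝓝 x, T₁ (ι x') = T₀ (ι x')) :
    ∃ T : TwoTensor (m + 1) H,
      (∀ p v w, lieDeriv X (fun q v w ↦ T q v w) p v w = φ p (T p) v w + B p v w) ∧
      ∀ x, T (ι x) = T₀ (ι x) := by
  have hP := (isLinearTransport_twoTensor hX hφ B).isTransport hX hX₀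
  have hR := hι.isSlice
  obtain ⟨T, hT, hT'⟩ := hP.exists_solution (T₀ := T₀) hX hX₀ hR (by
    rintro _ ⟨x, rfl⟩
    -- `T₀` carries only pointwise values; smoothness comes from a local field `T₁` that agrees with
    -- it on the section near `x`.
    obtain ⟨T₁, h1, h2⟩ := hT₀ x
    let c := chartAt (EuclideanSpace ℝ (Fin m)) x
    have hx : x ∈ c.source := mem_chart_source _ x
    have hcx : c.symm (c x) = x := c.left_inv hx
    have hc := contMDiffAt_chartAt_symm (E := EuclideanSpace ℝ (Fin m)) x (c.map_source hx)
    obtain ⟨W, T', hW, hW'⟩ := hP.exists_isPartialSolution (T₀ := T₀) hX hR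
      (j := ι ∘ c.symm) (y₀ := c x) (T₁ := T₁) (by
        have hcont := hc.continuousAt
        rw [ContinuousAt, hcx] at hcont
        filter_upwards [c.open_target.mem_nhds (c.map_source hx), hcont.eventually h2]
          with y hy hy'
        exact ⟨(hι.contMDiff _).comp y (contMDiffAt_chartAt_symm x hy), mem_range_self _, hy'⟩)
      (by simp) (fun a y h ↦ htr.comp_chart_symm hι x a y h)
      (by rwa [Function.comp_apply, hcx])
    refine ⟨W, T', hW, ?_⟩
    rwa [Function.comp_apply, hcx] at hW')
  refine ⟨⟨T, fun p ↦ (hT p).self_of_nhds.1⟩, fun p ↦ (hT p).self_of_nhds.2,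
    fun x ↦ hT' _ (mem_range_self x)⟩

/-- Uniqueness for linear transport equations with initial data on a cross-section. -/
theorem twoTensor_solution_unique (hX : ∀ p, SmoothVectorAt X p) (hX₀ : ∀ p, X p ≠ 0)
    (hι : IsCrossSection X ι) (hφ : IsLinearTerm φ) (B : TwoTensor (m + 1) H)
    {T T' : TwoTensor (m + 1) H}
    (hT : ∀ p v w, lieDeriv X (fun q v w ↦ T q v w) p v w = φ p (T p) v w + B p v w)
    (hT' : ∀ p v w, lieDeriv X (fun q v w ↦ T' q v w) p v w = φ p (T' p) v w + B p v w)
    (h : ∀ x, T (ι x) = T' (ι x)) : T = T' := by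
  ext1 q
  refine (isLinearTransport_twoTensor hX hφ B).eq_of_eqOn hX hX₀ hι.isSlice
    (T := fun q ↦ T q) (T' := fun q ↦ T' q) (fun q ↦ ⟨T.contMDiff q, hT q⟩)
    (fun q ↦ ⟨T'.contMDiff q, hT' q⟩) ?_ q
  rintro _ ⟨x, rfl⟩
  exact h x

/-- A solution of a homogeneous linear equation along `X` which vanishes on a cross-section
is zero. -/
theorem eq_zero_of_dirDeriv_eq_mul (hX : ∀ p, SmoothVectorAt X p) (hX₀ : ∀ p, X p ≠ 0)
    (hι : IsCrossSection X ι) {a ρ : H → ℝ} (ha : ∀ p, SmoothFnAt (m + 1) a p)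
    (hρ : ∀ p, SmoothFnAt (m + 1) ρ p) (h : ∀ p, dirDeriv ρ p (X p) = a p * ρ p)
    (h₀ : ∀ x, ρ (ι x) = 0) (p : H) : ρ p = 0 := by
  have hE : IsLinearTransport ℝ X (Vb := fun _ ↦ ℝ) (fun u q ↦ SmoothFnAt (m + 1) u q)
      (fun u q ↦ dirDeriv u q (X q) = a q * u q) := by
    refine fun p₀ ↦ ⟨univ, fun _ t ↦ t, fun _ t ↦ t,
      fun q ↦ a q • ContinuousLinearMap.id ℝ ℝ, fun _ ↦ 0, isOpen_univ, mem_univ _,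
      fun _ _ _ ↦ rfl, fun _ _ _ ↦ rfl, fun q _ ↦ ⟨(ha q).smul contMDiffAt_const,
        contMDiffAt_const⟩, fun _ _ _ ↦ Iff.rfl, fun u q _ _ ↦ ?_⟩
    simp [dirDeriv]
  refine hE.eq_of_eqOn hX hX₀ hι.isSlice (T := ρ) (T' := fun _ ↦ 0) (fun q ↦ ⟨hρ q, h q⟩)
    (fun q ↦ ⟨contMDiffAt_const, ?_⟩) ?_ p
  · rw [dirDeriv_const, mul_zero]
  · rintro _ ⟨x, rfl⟩
    exact h₀ x

end CrossSection

/-! ### Raising indices and traces with `P`. -/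

section Trace

variable {d : ℕ} {M : Type*} [TopologicalSpace M] [ChartedSpace (EuclideanSpace ℝ (Fin d)) M]
  [IsManifold (𝓡 d) ∞ M]

namespace MetricHypersurfaceData

variable (D : MetricHypersurfaceData d M)

theorem ambientForm_comm {p : M} (x y : TangentSpace (𝓡 d) p × ℝ) :
    ambientForm (D.γ p) (D.ℓ p) (D.ℓ2 p) x y = ambientForm (D.γ p) (D.ℓ p) (D.ℓ2 p) y x := by
  simp only [ambientForm, LinearMap.mk₂_apply]
  rw [D.symm p x.1 y.1]
  ring

/-- The inverse of a symmetric form is symmetric. -/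
theorem raise_comm {p : M} (α β : TangentSpace (𝓡 d) p →ₗ[ℝ] ℝ) :
    β (D.raise α) = α (D.raise β) := by
  have h1 := D.ambientForm_sharp (covector α 0) (D.sharp p (covector β 0))
  have h2 := D.ambientForm_sharp (covector β 0) (D.sharp p (covector α 0))
  rw [ambientForm_comm, h2] at h1
  simpa [covector, raise] using h1

theorem raise_add {p : M} (α β : TangentSpace (𝓡 d) p →ₗ[ℝ] ℝ) :
    D.raise (α + β) = D.raise α + D.raise β := by
  have : covector (p := p) (α + β) 0 = covector α 0 + covector β 0 := by
    ext <;> simp [covector]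
  rw [raise, this, map_add]
  rfl

theorem raise_smul {p : M} (c : ℝ) (α : TangentSpace (𝓡 d) p →ₗ[ℝ] ℝ) :
    D.raise (c • α) = c • D.raise α := by
  have : covector (p := p) (c • α) 0 = c • covector α 0 := by
    ext <;> simp [covector]
  rw [raise, this, map_smul]
  rfl

/-- Raising an index is linear. -/
noncomputable def raiseHom (p : M) : (TangentSpace (𝓡 d) p →ₗ[ℝ] ℝ) →ₗ[ℝ] TangentSpace (𝓡 d) p where
  toFun := D.raise
  map_add' := D.raise_add
  map_smul' := D.raise_smul

/-- Converts the index contractions in the constraint tensor into expressions free of frames. -/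
theorem sum_Pc_mul_mul {p : M} (α β : TangentSpace (𝓡 d) p →ₗ[ℝ] ℝ) :
    ∑ c, ∑ e, D.Pc p c e * (α (frame p e) * β (frame p c)) = β (D.raise α) := by
  have hα : α = ∑ e, α (frame p e) • (frame p).coord e := by
    refine (frame p).ext fun i ↦ ?_
    simp
  have h1 : β (D.raise α) = ∑ e, α (frame p e) * β (D.raise ((frame p).coord e)) := by
    change (β ∘ₗ D.raiseHom p) α = _
    conv_lhs => rw [hα]
    simp only [map_sum, map_smul, smul_eq_mul]
    rfl
  rw [h1, Finset.sum_comm]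
  refine Finset.sum_congr rfl fun e _ ↦ ?_
  rw [← (frame p).sum_repr (D.raise ((frame p).coord e)), map_sum, Finset.mul_sum]
  refine Finset.sum_congr rfl fun c _ ↦ ?_
  rw [Pc, P_eq_raise, raise_comm, map_smul, smul_eq_mul, Module.Basis.coord_apply]
  ring

/-- The trace `P^{ab} T_{ab}` of a bilinear form. -/
noncomputable def trForm {p : M} (T : TwoForms d p) : ℝ :=
  ∑ a, ∑ b, D.Pc p a b * T (frame p a) (frame p b)

theorem trP_eq_trForm (T : TwoTensor d M) (p : M) :
    D.trP (fun q v w ↦ T q v w) p = D.trForm (T p) := rfl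

/-- The endomorphism `T^a_b`. -/
noncomputable def raiseMap {p : M} (T : TwoForms d p) :
    TangentSpace (𝓡 d) p →ₗ[ℝ] TangentSpace (𝓡 d) p :=
  D.raiseHom p ∘ₗ (toBilin T).flip

theorem raiseMap_apply {p : M} (T : TwoForms d p) (v : TangentSpace (𝓡 d) p) :
    D.raiseMap T v = D.raise ((toBilin T).flip v) := rfl

theorem Pc_comm (p : M) (a b : Fin d) : D.Pc p a b = D.Pc p b a := by
  rw [Pc, Pc, P_eq_raise, P_eq_raise, raise_comm]

/-- As the trace of an endomorphism, `tr_P` can be computed in any basis; smoothness and the value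
on `γ` follow from this. -/
theorem trForm_eq_trace {p : M} (T : TwoForms d p) :
    D.trForm T = LinearMap.trace ℝ _ (D.raiseMap T) := by
  rw [← sum_coord_eq_trace (frame p), trForm, Finset.sum_comm]
  refine Finset.sum_congr rfl fun c _ ↦ ?_
  rw [raiseMap_apply, ← sum_Pc_mul_mul]
  simp [Finsupp.single_apply, D.Pc_comm p c, toBilin]

theorem trForm_add {p : M} (T T' : TwoForms d p) : D.trForm (T + T') = D.trForm T + D.trForm T' := by
  simp [trForm, mul_add, Finset.sum_add_distrib]

theorem trForm_smul {p : M} (c : ℝ) (T : TwoForms d p) : D.trForm (c • T) = c * D.trForm T := by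
  simp only [trForm, Finset.mul_sum, smul_apply, smul_eq_mul]
  exact Finset.sum_congr rfl fun a _ ↦ Finset.sum_congr rfl fun b _ ↦ by ring

theorem trForm_flip {p : M} {T T' : TwoForms d p} (h : ∀ v w, T v w = T' w v) :
    D.trForm T = D.trForm T' := by
  rw [trForm, trForm, Finset.sum_comm]
  refine Finset.sum_congr rfl fun a _ ↦ Finset.sum_congr rfl fun b _ ↦ ?_
  rw [Pc_comm, h]

theorem smoothFnAt_trForm {T : Π q : M, TwoForms d q} {p : M} (hT : SmoothTwoAt T p) :
    SmoothFnAt d (fun q ↦ D.trForm (T q)) p := by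
  have hp := mem_chart_source (EuclideanSpace ℝ (Fin d)) p
  have h1 : ∀ i, SmoothOneAt (fun q ↦ LinearMap.toContinuousLinearMap
      ((toBilin (T q)).flip (coordFrame p i q))) p := fun i ↦
    smoothOneAt_of_apply fun V hV ↦ hT.apply hV (smoothVectorAt_coordFrame p hp i)
  have h2 : SmoothFnAt d (fun q ↦ ∑ i, coordCoeff p i q
      (D.raise ((toBilin (T q)).flip (coordFrame p i q)))) p :=
    ContMDiffAt.sum fun i _ ↦ (smoothVectorAt_iff_coordCoeff p hp).1
      (D.smoothVectorAt_raise (h1 i)) i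
  refine h2.congr_of_eventuallyEq ?_
  filter_upwards [eventually_mem_chartAt_source (d := d) p] with q hq
  rw [trForm_eq_trace, ← sum_coord_eq_trace (coordBasis p hq)]
  refine Finset.sum_congr rfl fun c _ ↦ ?_
  rw [coordBasis_apply, Module.Basis.coord_apply, coordBasis_repr]
  rfl

variable {D}

theorem sharp_n (hD : D.IsNull) (p : M) : D.sharp p (covector 0 1) = (D.n p, 0) :=
  Prod.ext rfl (hD p)

theorem ℓ_n (hD : D.IsNull) (p : M) : D.ℓ p (D.n p) = 1 := by
  have h := D.ambientForm_sharp (p := p) (covector 0 1) (0, 1)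
  rw [sharp_n hD] at h
  simpa [ambientForm, covector] using h

theorem n_ne_zero (hD : D.IsNull) (p : M) : D.n p ≠ 0 := by
  intro h
  have := ℓ_n hD p
  rw [h, map_zero] at this
  exact zero_ne_one this

theorem sharp_covector (hD : D.IsNull) {p : M} (α : TangentSpace (𝓡 d) p →ₗ[ℝ] ℝ) (a : ℝ) :
    (D.sharp p (covector α a)).1 = D.raise α + a • D.n p := by
  have : covector (p := p) α a = covector α 0 + a • covector 0 1 := by
    ext <;> simp [covector]
  rw [this, map_add, map_smul, sharp_n hD]
  rfl

/-- `A((v, 0), ·)` is the covector `(γ(v,·), ℓ(v))`. Applying `A♯` gives `v = γ(v,·)♯ + ℓ(v) n`. -/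
theorem raise_γ (hD : D.IsNull) {p : M} (v : TangentSpace (𝓡 d) p) :
    D.raise (D.γ p v).toLinearMap = v - D.ℓ p v • D.n p := by
  have h : D.sharp p (covector (D.γ p v).toLinearMap (D.ℓ p v)) = (v, 0) := by
    refine D.ambientForm_injective fun w b ↦ ?_
    rw [ambientForm_sharp]
    simp [covector, ambientForm]
    ring
  have h2 := sharp_covector hD (D.γ p v).toLinearMap (D.ℓ p v)
  rw [h] at h2
  rw [eq_sub_iff_add_eq]
  exact h2.symm

/-- Raising an index of `γ` gives the projection `id - ℓ ⊗ n`, whose trace is `d - ℓ(n)`. -/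
theorem trForm_γ (hD : D.IsNull) (p : M) : D.trForm (D.γ p) = d - 1 := by
  have h : D.raiseMap (D.γ p) = LinearMap.id - (D.ℓ p).toLinearMap.smulRight (D.n p) := by
    ext1 v
    have : (toBilin (D.γ p)).flip v = (D.γ p v).toLinearMap := by
      ext w
      exact D.symm p w v
    rw [raiseMap_apply, this, raise_γ hD]
    rfl
  have hd : Module.finrank ℝ (TangentSpace (𝓡 d) p) = d :=
    finrank_euclideanSpace_fin (𝕜 := ℝ) (n := d)
  rw [trForm_eq_trace, h, map_sub, LinearMap.trace_id, hd, LinearMap.trace_smulRight]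
  exact congrArg _ (ℓ_n hD p)

end MetricHypersurfaceData

end Trace

/-! ### The tensors `U`, `F`, `s` and the derivative of `n`. -/

section NullTensors

variable {d : ℕ} {M : Type*} [TopologicalSpace M] [ChartedSpace (EuclideanSpace ℝ (Fin d)) M]
  [IsManifold (𝓡 d) ∞ M]

theorem OneForm.smoothOneAt (θ : OneForm d M) (p : M) : SmoothOneAt (fun q ↦ θ q) p :=
  θ.contMDiff p

theorem TwoTensor.smoothTwoAt (T : TwoTensor d M) (p : M) : SmoothTwoAt (fun q ↦ T q) p :=
  T.contMDiff p

theorem bracket_self (V : Π q : M, TangentSpace (𝓡 d) q) (p : M) : bracket V V p = 0 :=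
  by
  simp [bracket]

namespace MetricHypersurfaceData

variable (D : MetricHypersurfaceData d M)

theorem exists_half (T : TwoTensor d M) : ∃ T' : TwoTensor d M, ∀ p v w, T' p v w = 1 / 2 * T p v w :=
  exists_twoTensor _ (by simp [mul_add]) (by simp [mul_left_comm]) (by simp [mul_add])
    (by simp [mul_left_comm]) fun p _ _ hV hW ↦ contMDiffAt_const.mul ((T.smoothTwoAt p).apply hV hW)

theorem exists_U : ∃ T : TwoTensor d M, ∀ p v w, T p v w = D.U p v w := by
  obtain ⟨L, hL⟩ := exists_lieDeriv D.smoothVectorAt_n D.γ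
  obtain ⟨T, hT⟩ := exists_half L
  exact ⟨T, fun p v w ↦ by rw [hT, hL, U]⟩

theorem exists_F : ∃ T : TwoTensor d M, ∀ p v w, T p v w = D.F p v w := by
  obtain ⟨L, hL⟩ := exists_extDeriv D.ℓ
  obtain ⟨T, hT⟩ := exists_half L
  exact ⟨T, fun p v w ↦ by rw [hT, hL, F]⟩

/-- The tensor field `U`. -/
noncomputable def UT : TwoTensor d M := D.exists_U.choose

theorem UT_apply (p : M) (v w : TangentSpace (𝓡 d) p) : D.UT p v w = D.U p v w :=
  D.exists_U.choose_spec p v w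

/-- The two-form `F`. -/
noncomputable def FT : TwoTensor d M := D.exists_F.choose

theorem FT_apply (p : M) (v w : TangentSpace (𝓡 d) p) : D.FT p v w = D.F p v w :=
  D.exists_F.choose_spec p v w

theorem exists_contract (T : TwoTensor d M) : ∃ θ : OneForm d M, ∀ p v, θ p v = T p (D.n p) v :=
  exists_oneForm _ (by simp) (by simp) fun p _ hV ↦ (T.smoothTwoAt p).apply (D.smoothVectorAt_n p) hV

/-- The contraction `T(n, ·)`. -/
noncomputable def contract (T : TwoTensor d M) : OneForm d M := (D.exists_contract T).choose

theorem contract_apply (T : TwoTensor d M) (p : M) (v : TangentSpace (𝓡 d) p) :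
    D.contract T p v = T p (D.n p) v := (D.exists_contract T).choose_spec p v

/-- The one-form `s`. -/
noncomputable def sT : OneForm d M := D.contract D.FT

theorem sT_apply (p : M) (v : TangentSpace (𝓡 d) p) : D.sT p v = D.s p v := by
  rw [sT, contract_apply, FT_apply]
  rfl

/-- The Ricci tensor of the connection. -/
noncomputable def ricT : TwoTensor d M :=
  (exists_ricci (cov := D.connection) D.smoothVectorAt_connection).choose

theorem ricT_apply (p : M) (v w : TangentSpace (𝓡 d) p) :
    D.ricT p v w = ricci D.connection p v w :=
  (exists_ricci (cov := D.connection) D.smoothVectorAt_connection).choose_spec p v w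

/-- The covariant derivative of a one-form. -/
noncomputable def nabla (θ : OneForm d M) : TwoTensor d M :=
  (exists_covDeriv D.connection D.smoothVectorAt_connection θ).choose

theorem nabla_apply (θ : OneForm d M) (p : M) (v w : TangentSpace (𝓡 d) p) :
    D.nabla θ p v w = covDeriv D.connection (fun q x ↦ θ q x) p v w :=
  (exists_covDeriv D.connection D.smoothVectorAt_connection θ).choose_spec p v w

theorem U_comm (p : M) (v w : TangentSpace (𝓡 d) p) : D.U p v w = D.U p w v := by
  have h : ∀ q (v w : TangentSpace (𝓡 d) q), D.γ q v w = D.γ q w v := D.symm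
  simp only [U, lieDeriv]
  rw [h p v, h p _ w]
  simp_rw [h _ (ext v _)]
  ring

theorem F_antisymm (p : M) (v w : TangentSpace (𝓡 d) p) : D.F p v w = -D.F p w v := by
  simp only [F, extDeriv, bracket_swap (ext v) (ext w), map_neg]
  ring

theorem s_n (p : M) : D.s p (D.n p) = 0 := by
  have := D.F_antisymm p (D.n p) (D.n p)
  rw [s]
  linarith

/-- The endomorphism `U^a_b`. -/
noncomputable def shape (p : M) : TangentSpace (𝓡 d) p →ₗ[ℝ] TangentSpace (𝓡 d) p :=
  D.raiseMap (D.UT p)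

theorem shape_apply (p : M) (v : TangentSpace (𝓡 d) p) :
    D.shape p v = D.raise (toBilin (D.UT p) v) := by
  rw [shape, raiseMap_apply]
  congr 1
  ext w
  change D.UT p w v = D.UT p v w
  rw [UT_apply, UT_apply, U_comm]

theorem smoothVectorAt_shape {V : Π q : M, TangentSpace (𝓡 d) q} {p : M} (hV : SmoothVectorAt V p) :
    SmoothVectorAt (fun q ↦ D.shape q (V q)) p := by
  simp only [shape_apply]
  exact D.smoothVectorAt_raise (θ := fun q ↦ D.UT q (V q))
    (smoothOneAt_of_apply fun W hW ↦ (D.UT.smoothTwoAt p).apply hV hW)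

theorem sum_Pc_U {p : M} (v : TangentSpace (𝓡 d) p) (β : TangentSpace (𝓡 d) p →ₗ[ℝ] ℝ) :
    ∑ c, ∑ e, D.Pc p c e * (D.U p (frame p e) v * β (frame p c)) = β (D.shape p v) := by
  rw [shape_apply, ← sum_Pc_mul_mul]
  refine Finset.sum_congr rfl fun c _ ↦ Finset.sum_congr rfl fun e _ ↦ ?_
  rw [U_comm]
  change _ = _ * (D.UT p v _ * _)
  rw [UT_apply]

theorem U_shape_comm (p : M) (v w : TangentSpace (𝓡 d) p) :
    D.U p (D.shape p v) w = D.U p (D.shape p w) v := by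
  have h := D.raise_comm (toBilin (D.UT p) v) (toBilin (D.UT p) w)
  rw [← shape_apply, ← shape_apply] at h
  change D.UT p w _ = D.UT p v _ at h
  rw [UT_apply, UT_apply] at h
  rw [U_comm, h, U_comm]

theorem trP_U (p : M) : D.trP D.U p = LinearMap.trace ℝ _ (D.shape p) := by
  rw [shape, ← trForm_eq_trace]
  simp only [trP, trForm, UT_apply]

theorem smoothFnAt_trP_U (p : M) : SmoothFnAt d (D.trP D.U) p := by
  have h : D.trP D.U = fun q ↦ D.trForm (D.UT q) := by
    funext q
    rw [trP_U, trForm_eq_trace]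
    rfl
  rw [h]
  exact D.smoothFnAt_trForm (D.UT.smoothTwoAt p)

/-- Identifies the quadratic term of the equation for `f` with the trace of `U♯ ∘ U♯` produced by
the curvature computation. -/
theorem sum_Pc_Pc_U (p : M) : ∑ a, ∑ b, ∑ c, ∑ e, D.Pc p a b * D.Pc p c e
      * D.U p (frame p a) (frame p c) * D.U p (frame p b) (frame p e)
    = LinearMap.trace ℝ _ (D.shape p ∘ₗ D.shape p) := by
  rw [← sum_coord_eq_trace (frame p)]
  refine Finset.sum_congr rfl fun a _ ↦ ?_
  rw [LinearMap.comp_apply, D.shape_apply p (D.shape p _), ← sum_Pc_mul_mul]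
  have h : ∀ b, ∑ c, ∑ e, D.Pc p a b * D.Pc p c e
      * D.U p (frame p a) (frame p c) * D.U p (frame p b) (frame p e)
      = D.Pc p a b * D.U p (D.shape p (frame p a)) (frame p b) := fun b ↦ by
    have h1 := D.sum_Pc_U (frame p b) (toBilin (D.UT p) (frame p a))
    have h2 : ∀ w, toBilin (D.UT p) (frame p a) w = D.U p (frame p a) w := fun w ↦ D.UT_apply _ _ _
    simp only [h2] at h1
    rw [U_shape_comm, U_comm, ← h1, Finset.mul_sum]
    refine Finset.sum_congr rfl fun c _ ↦ ?_
    rw [Finset.mul_sum]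
    refine Finset.sum_congr rfl fun e _ ↦ ?_
    rw [D.U_comm p (frame p b)]
    ring
  simp only [h]
  have h3 : ∀ w, toBilin (D.UT p) (D.shape p (frame p a)) w = D.U p (D.shape p (frame p a)) w :=
    fun w ↦ D.UT_apply _ _ _
  simp [h3, Finsupp.single_apply]

variable {D}

/-- Each term of `(L_n γ)(n, ·)` contains `γ(n, ·) = 0` or `[n, n] = 0`. -/
theorem U_n (hD : D.IsNull) (p : M) (v : TangentSpace (𝓡 d) p) : D.U p (D.n p) v = 0 := by
  have h := lieDeriv_apply (X := D.n) (D.smoothTwoAt_γ p) (D.smoothVectorAt_n p).diffAt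
    (diffAt_ext v)
  rw [ext_self] at h
  rw [U, h, lieExpr, bracket_self]
  have h1 : ∀ q (w : TangentSpace (𝓡 d) q), D.γ q (D.n q) w = 0 := fun q w ↦ by
    rw [D.symm, D.γ_n hD]
  simp [h1, dirDeriv_const]

theorem shape_n (hD : D.IsNull) (p : M) : D.shape p (D.n p) = 0 := by
  have : toBilin (D.UT p) (D.n p) = 0 := by
    ext w
    change D.UT p _ _ = 0
    rw [UT_apply, U_n hD]
  rw [shape_apply, this]
  exact (D.raiseHom p).map_zero

/-- `∇_v n = U(v)^♯ + s(v) n`. -/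
theorem connection_n (hD : D.IsNull) (p : M) (v : TangentSpace (𝓡 d) p) :
    D.connection D.n p v = D.shape p v + D.s p v • D.n p := by
  have hn := (D.smoothVectorAt_n p).diffAt
  -- With `n` as second argument, `γ(n,·) = 0` reduces the Koszul form to `U`; likewise `ℓ(n) = 1`
  -- reduces the scalar part to `s`.
  have h1 : ∀ w : TangentSpace (𝓡 d) p, D.koszul (ext v) D.n (ext w) p = D.U p v w := by
    intro w
    have h1 : ∀ q (w : TangentSpace (𝓡 d) q), D.γ q (D.n q) w = 0 := fun q w ↦ by
      rw [D.symm, D.γ_n hD]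
    simp only [koszul, h1, D.γ_n hD, dirDeriv_const, U, lieDeriv, ext_self,
      bracket_swap (ext v) D.n, map_neg, neg_apply]
    rw [D.symm p v]
    ring
  have h2 : D.koszulScalar (ext v) D.n p = D.s p v := by
    have h := extDeriv_apply (D.smoothOneAt_ℓ p) hn (diffAt_ext v)
    rw [ext_self] at h
    simp only [koszulScalar, s, F, h, extDerivExpr, ℓ_n hD, dirDeriv_const, ext_self,
      bracket_swap (ext v) D.n, map_neg]
    ring
  have h3 : D.koszulSharp D.n p hn v
      = D.sharp p (covector (toBilin (D.UT p) v) (D.s p v)) := by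
    refine D.ambientForm_injective fun w b ↦ ?_
    rw [D.ambientForm_koszulSharp', ambientForm_sharp, h1, h2, ← UT_apply]
    simp [covector, toBilin]
    ring
  rw [D.connection_apply hn, h3, sharp_covector hD, shape_apply]

end MetricHypersurfaceData

end NullTensors

/-! ### The Raychaudhuri equation for the connection of the data. -/

section NullRicci

variable {d : ℕ} {M : Type*} [TopologicalSpace M] [ChartedSpace (EuclideanSpace ℝ (Fin d)) M]
  [IsManifold (𝓡 d) ∞ M]

theorem smoothVectorAt_zero (p : M) : SmoothVectorAt (fun q : M ↦ (0 : TangentSpace (𝓡 d) q)) p := by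
  have := SmoothVectorAt.sum (p := p) (s := ∅) (V := fun i ↦ coordFrame (d := d) p i)
    fun i ↦ smoothVectorAt_coordFrame p (mem_chart_source _ p) i
  simpa using this

theorem cov_zero (cov : CovariantDerivative (𝓡 d) (EuclideanSpace ℝ (Fin d))
      (fun p : M ↦ TangentSpace (𝓡 d) p)) (p : M) (v : TangentSpace (𝓡 d) p) :
    cov (fun _ ↦ 0) p v = 0 := by
  have h0 := (smoothVectorAt_zero (d := d) p).diffAt
  have h := cov_add cov h0 h0 v
  have h1 : ((fun q ↦ 0) + fun q ↦ 0 : Π q : M, TangentSpace (𝓡 d) q) = fun q ↦ 0 := by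
    funext q
    exact add_zero _
  rw [h1] at h
  exact left_eq_add.1 h

theorem dirDeriv_sum {κ : Type*} (t : Finset κ) {p : M} {a : κ → M → ℝ}
    (ha : ∀ i, SmoothFnAt d (a i) p) (v : TangentSpace (𝓡 d) p) :
    dirDeriv (fun q ↦ ∑ i ∈ t, a i q) p v = ∑ i ∈ t, dirDeriv (a i) p v := by
  classical
  induction t using Finset.induction_on with
  | empty => simp [dirDeriv_const]
  | insert i t hi ih =>
    have hs : SmoothFnAt d (fun q ↦ ∑ j ∈ t, a j q) p := ContMDiffAt.sum fun j _ ↦ ha j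
    have h := dirDeriv_add (ha i).mdifferentiableAt hs.mdifferentiableAt v
    simp only [Finset.sum_insert hi]
    rw [h, ih]

theorem bracket_sum_smul {κ : Type*} (t : Finset κ) {X : Π q : M, TangentSpace (𝓡 d) q} {p : M}
    {a : κ → M → ℝ} {V : κ → Π q : M, TangentSpace (𝓡 d) q} (ha : ∀ i, SmoothFnAt d (a i) p)
    (hV : ∀ i, SmoothVectorAt (V i) p) :
    bracket X (fun q ↦ ∑ i ∈ t, (a i • V i) q) p
      = ∑ i ∈ t, (dirDeriv (a i) p (X p) • V i p + a i p • bracket X (V i) p) := by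
  classical
  induction t using Finset.induction_on with
  | empty =>
    have h := bracket_smul_right (V := X) (f := fun _ ↦ 0) (p := p) mdifferentiableAt_const
      (smoothVectorAt_zero (d := d) p).diffAt
    have h1 : ((fun _ ↦ 0 : M → ℝ) • (fun q ↦ 0 : Π q : M, TangentSpace (𝓡 d) q))
        = fun q ↦ 0 := by
      funext q
      exact smul_zero (0 : ℝ)
    rw [h1, dirDeriv_const, zero_smul, zero_smul, add_zero] at h
    simpa using h
  | insert i t hi ih =>
    have h1 : (fun q ↦ ∑ j ∈ insert i t, (a j • V j) q)
        = (a i • V i) + fun q ↦ ∑ j ∈ t, (a j • V j) q := by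
      funext q
      exact Finset.sum_insert hi
    rw [h1, bracket_add_right ((hV i).smul' (ha i)).diffAt
      (SmoothVectorAt.sum fun j ↦ (hV j).smul' (ha j)).diffAt, ih, Finset.sum_insert hi,
      bracket_smul_right (ha i).mdifferentiableAt (hV i).diffAt]

namespace MetricHypersurfaceData

variable {D : MetricHypersurfaceData d M}

/-- Torsion-freeness for arbitrary fields differentiable at the point, beyond the extensions `ext`
covered by `connection_torsion`. -/
theorem connection_sub_connection {p : M} {V W : Π q : M, TangentSpace (𝓡 d) q}
    (hV : DiffAt V p) (hW : DiffAt W p) :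
    D.connection W p (V p) - D.connection V p (W p) = bracket V W p := by
  rw [D.connection_apply hW, D.connection_apply hV]
  have : D.koszulSharp W p hW (V p) - D.koszulSharp V p hV (W p) = (bracket V W p, (0 : ℝ)) := by
    refine D.ambientForm_injective fun z b ↦ ?_
    have hγ (q : M) : D.γ q (W q) (V q) = D.γ q (V q) (W q) := D.symm _ _ _
    have h1 := D.ambientForm_koszulSharp hV hW (diffAt_ext z) b
    have h2 := D.ambientForm_koszulSharp hW hV (diffAt_ext z) b
    rw [ext_self] at h1 h2
    rw [map_sub, LinearMap.sub_apply, h1, h2]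
    simp [koszul, koszulScalar, ambientForm, bracket, ext_self, hγ,
      VectorField.mlieBracket_swap_apply (V := W) (W := V)]
    ring
  exact congrArg Prod.fst this

theorem trace_connection_n (hD : D.IsNull) (p : M) :
    LinearMap.trace ℝ _ (D.connection D.n p).toLinearMap = D.trP D.U p := by
  have h : (D.connection D.n p).toLinearMap
      = D.shape p + (D.sT p).toLinearMap.smulRight (D.n p) := by
    ext1 v
    rw [ContinuousLinearMap.coe_coe, connection_n hD]
    simp [sT_apply]
  have h1 : D.sT p (D.n p) = 0 := by rw [sT_apply, s_n]
  rw [h, map_add, LinearMap.trace_smulRight, trP_U]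
  simp [h1]

/-- Since `U♯ n = 0` and `s(n) = 0`, the square of `U♯ + s ⊗ n` differs from that of `U♯` by `(s ∘
U♯) ⊗ n`, whose trace is `s(U♯ n) = 0`. -/
theorem trace_connection_n_sq (hD : D.IsNull) (p : M) :
    LinearMap.trace ℝ _ ((D.connection D.n p).toLinearMap ∘ₗ (D.connection D.n p).toLinearMap)
      = LinearMap.trace ℝ _ (D.shape p ∘ₗ D.shape p) := by
  have h : (D.connection D.n p).toLinearMap ∘ₗ (D.connection D.n p).toLinearMap
      = D.shape p ∘ₗ D.shape p
        + ((D.sT p).toLinearMap ∘ₗ D.shape p).smulRight (D.n p) := by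
    ext1 v
    simp only [LinearMap.comp_apply, ContinuousLinearMap.coe_coe, connection_n hD, map_add,
      map_smul, shape_n hD, ← sT_apply]
    simp [sT_apply, s_n]
  rw [h, map_add, LinearMap.trace_smulRight]
  simp [shape_n hD]

theorem connection_n_n (hD : D.IsNull) (p : M) : D.connection D.n p (D.n p) = 0 := by
  rw [connection_n hD, shape_n hD, s_n, zero_smul, add_zero]

/-- The Raychaudhuri equation `Ric(n, n) = -n(tr U) - |U|²`. -/
theorem ricci_n_n (hD : D.IsNull) (p : M) :
    ricci D.connection p (D.n p) (D.n p) = -dirDeriv (D.trP D.U) p (D.n p)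
      - LinearMap.trace ℝ _ (D.shape p ∘ₗ D.shape p) := by
  have hp := mem_chart_source (EuclideanSpace ℝ (Fin d)) p
  have hn := D.smoothVectorAt_n p
  have he := fun i ↦ smoothVectorAt_coordFrame p hp i
  let Z : Fin d → Π q : M, TangentSpace (𝓡 d) q := fun c q ↦ D.connection D.n q (coordFrame p c q)
  have hZ : ∀ c, SmoothVectorAt (Z c) p := fun c ↦
    D.smoothVectorAt_connection p (coordFrame p c) D.n (he c) hn
  let b : Fin d → Fin d → M → ℝ := fun a c q ↦ coordCoeff p a q (Z c q)
  have hb : ∀ a c, SmoothFnAt d (b a c) p := fun a c ↦ (smoothVectorAt_iff_coordCoeff p hp).1 (hZ c) a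
  have hZsum : ∀ c, Z c =ᶠ[𝓝 p] fun q ↦ ∑ a, (b a c • coordFrame p a) q := fun c ↦ by
    filter_upwards [eventually_mem_chartAt_source (d := d) p] with q hq
    exact eq_sum_coordCoeff p hq _
  have hbr : ∀ c, bracket D.n (Z c) p = ∑ a, (dirDeriv (b a c) p (D.n p) • coordFrame p a p
      + b a c p • bracket D.n (coordFrame p a) p) := fun c ↦ by
    exact (bracket_congr (X := D.n) EventuallyEq.rfl (hZsum c)).trans
      (bracket_sum_smul _ (fun a ↦ hb a c) he)
  -- `∇_n n = 0` removes the first term of the curvature, and torsion-freeness replaces `∇_n Z` by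
  -- `[n, Z] + ∇_Z n` for `Z = ∇_{e_c} n`.
  have hcurv : ∀ c, curvature D.connection (coordFrame p c) D.n D.n p
      = -bracket D.n (Z c) p - D.connection D.n p (Z c p)
        + D.connection D.n p (bracket D.n (coordFrame p c) p) := fun c ↦ by
    have h1 : (fun q ↦ D.connection D.n q (D.n q)) = fun q ↦ 0 := by
      funext q
      exact connection_n_n hD q
    have h2 := connection_sub_connection (D := D) hn.diffAt (hZ c).diffAt
    rw [curvature, h1, cov_zero, bracket_swap (coordFrame p c), map_neg, ← h2]
    abel
  rw [ricci_eq_sum (cov := D.connection) D.smoothVectorAt_connection (coordBasis p hp) hn hn he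
    fun c ↦ (coordBasis_apply p hp c).symm]
  have htr : ∀ᶠ q in 𝓝 p, D.trP D.U q = ∑ c, b c c q := by
    filter_upwards [eventually_mem_chartAt_source (d := d) p] with q hq
    rw [← trace_connection_n hD, ← sum_coord_eq_trace (coordBasis p hq)]
    refine Finset.sum_congr rfl fun c _ ↦ ?_
    rw [Module.Basis.coord_apply, coordBasis_repr, coordBasis_apply]
    rfl
  have hdtr : dirDeriv (D.trP D.U) p (D.n p) = ∑ c, dirDeriv (b c c) p (D.n p) := by
    rw [dirDeriv_congr htr, dirDeriv_sum _ fun c ↦ hb c c]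
  rw [← trace_connection_n_sq hD, ← sum_coord_eq_trace (coordBasis p hp), hdtr]
  simp only [hcurv, hbr, Module.Basis.coord_apply, coordBasis_repr, coordBasis_apply]
  have h1 : ∀ c, coordCoeff p c p (D.connection D.n p (bracket D.n (coordFrame p c) p))
      = ∑ a, coordCoeff p a p (bracket D.n (coordFrame p c) p) * b c a p := fun c ↦ by
    conv_lhs => rw [eq_sum_coordCoeff p hp (bracket D.n (coordFrame p c) p)]
    simp [b, Z]
  -- The frame need not commute with `n`; the resulting bracket terms cancel in the trace after
  -- exchanging the summation indices.
  have h2 : ∑ c, ∑ a, b a c p * coordCoeff p c p (bracket D.n (coordFrame p a) p)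
      = ∑ c, ∑ a, coordCoeff p a p (bracket D.n (coordFrame p c) p) * b c a p := by
    rw [Finset.sum_comm]
    simp only [mul_comm]
  simp only [map_add, map_sub, map_neg, map_sum, map_smul, smul_eq_mul, h1,
    coordCoeff_coordFrame p hp, Finset.sum_add_distrib, Finset.sum_sub_distrib,
    Finset.sum_neg_distrib, h2]
  simp only [mul_ite, mul_one, mul_zero, Finset.sum_ite_eq', Finset.mem_univ, if_true,
    LinearMap.comp_apply, ContinuousLinearMap.coe_coe, Z]
  ring

end MetricHypersurfaceData

end NullRicci

/-! ### The constraint tensor and its contraction with `n`. -/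

section Contraction

variable {d : ℕ} {M : Type*} [TopologicalSpace M] [ChartedSpace (EuclideanSpace ℝ (Fin d)) M]
  [IsManifold (𝓡 d) ∞ M]

/-- Cartan's formula `L_X θ = dθ(X, ·) + d(θ(X))` yields the Lie derivative of a one-form from
operations already known to be smooth. -/
theorem exists_lieOne {X : Π q : M, TangentSpace (𝓡 d) q} (hX : ∀ p, SmoothVectorAt X p)
    (θ : OneForm d M) :
    ∃ L : OneForm d M, ∀ p v, L p v
      = extDeriv (fun q v ↦ θ q v) p (X p) v + dirDeriv (fun q ↦ θ q (X q)) p v := by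
  obtain ⟨L, hL⟩ := exists_extDeriv θ
  simp only [← hL]
  refine exists_oneForm _ (fun q v v' ↦ ?_) (fun q c v ↦ ?_) fun p V hV ↦
    ((L.smoothTwoAt p).apply (hX p) hV).add (((θ.smoothOneAt p).apply (hX p)).dirDeriv hV)
  · rw [map_add, dirDeriv_add_vec]
    ring
  · rw [map_smul, dirDeriv_smul_vec, smul_eq_mul]
    ring

namespace MetricHypersurfaceData

variable (D : MetricHypersurfaceData d M)

/-- The Lie derivative of a one-form along `n`. -/
noncomputable def lieOne (θ : OneForm d M) : OneForm d M :=
  (exists_lieOne D.smoothVectorAt_n θ).choose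

theorem lieOne_apply (θ : OneForm d M) {p : M} {W : Π q : M, TangentSpace (𝓡 d) q}
    (hW : DiffAt W p) : D.lieOne θ p (W p)
      = dirDeriv (fun q ↦ θ q (W q)) p (D.n p) - θ p (bracket D.n W p) := by
  rw [lieOne, (exists_lieOne D.smoothVectorAt_n θ).choose_spec,
    extDeriv_apply (θ.smoothOneAt p) (D.smoothVectorAt_n p).diffAt hW, extDerivExpr]
  ring

theorem lieOne_n (θ : OneForm d M) (p : M) :
    D.lieOne θ p (D.n p) = dirDeriv (fun q ↦ θ q (D.n q)) p (D.n p) := by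
  rw [D.lieOne_apply θ (D.smoothVectorAt_n p).diffAt, bracket_self, map_zero, sub_zero]

/-- Because `[n, n] = 0`, the Lie derivative along `n` commutes with contraction by `n`. -/
theorem lieDeriv_contract (T : TwoTensor d M) (p : M) (w : TangentSpace (𝓡 d) p) :
    lieDeriv D.n (fun q v w ↦ T q v w) p (D.n p) w = D.lieOne (D.contract T) p w := by
  have h := D.lieOne_apply (D.contract T) (diffAt_ext w)
  have h' := lieDeriv_apply (X := D.n) (T.smoothTwoAt p) (D.smoothVectorAt_n p).diffAt
    (diffAt_ext w)
  rw [ext_self] at h h'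
  rw [h, h', lieExpr, bracket_self]
  simp only [contract_apply]
  simp

theorem exists_tmul (θ η : OneForm d M) : ∃ T : TwoTensor d M, ∀ p v w, T p v w = θ p v * η p w :=
  exists_twoTensor _ (by simp [add_mul]) (by simp [mul_assoc]) (by simp [mul_add])
    (by simp [mul_left_comm]) fun p _ _ hV hW ↦
      ((θ.smoothOneAt p).apply hV).mul ((η.smoothOneAt p).apply hW)

theorem lieDeriv_tmul {θ η : OneForm d M} {T : TwoTensor d M}
    (hT : ∀ p v w, T p v w = θ p v * η p w) (p : M) (v w : TangentSpace (𝓡 d) p) :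
    lieDeriv D.n (fun q v w ↦ T q v w) p v w
      = D.lieOne θ p v * η p w + θ p v * D.lieOne η p w := by
  have hv := D.lieOne_apply θ (diffAt_ext v)
  have hw := D.lieOne_apply η (diffAt_ext w)
  have h' := lieDeriv_apply (X := D.n) (T.smoothTwoAt p) (diffAt_ext v) (diffAt_ext w)
  rw [ext_self] at hv hw
  rw [ext_self, ext_self] at h'
  rw [h', lieExpr, hv, hw]
  simp only [hT, ext_self]
  rw [dirDeriv_mul ((θ.smoothOneAt p).mdifferentiableAt (diffAt_ext v))
    ((η.smoothOneAt p).mdifferentiableAt (diffAt_ext w)), ext_self, ext_self]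
  ring

/-- Torsion-freeness in the form `∇_n W = [n, W] + ∇_W n`. -/
theorem nabla_n_left (θ : OneForm d M) (p : M) (w : TangentSpace (𝓡 d) p) :
    D.nabla θ p (D.n p) w = D.lieOne θ p w - θ p (D.connection D.n p w) := by
  have h := D.lieOne_apply θ (diffAt_ext w)
  have h' := connection_sub_connection (D := D) (D.smoothVectorAt_n p).diffAt (diffAt_ext w)
  rw [ext_self] at h h'
  rw [nabla_apply, covDeriv, h, ← h', map_sub]
  ring

theorem nabla_n_right (θ : OneForm d M) (p : M) (v : TangentSpace (𝓡 d) p) :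
    D.nabla θ p v (D.n p)
      = dirDeriv (fun q ↦ θ q (D.n q)) p v - θ p (D.connection D.n p v) := by
  rw [nabla_apply, covDeriv_apply _ (θ.smoothOneAt p) _ (D.smoothVectorAt_n p).diffAt]

theorem exists_rotation (r : OneForm d M) :
    ∃ θ : OneForm d M, ∀ p v, θ p v = D.s p v + 2 * r p v := by
  simp only [← sT_apply]
  exact exists_oneForm _ (fun q v v' ↦ by simp; ring) (fun q c v ↦ by simp; ring) fun p V hV ↦
    ((D.sT.smoothOneAt p).apply hV).add (contMDiffAt_const.mul ((r.smoothOneAt p).apply hV))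

/-- The one-form `s + 2 r`. -/
noncomputable def rotation (r : OneForm d M) : OneForm d M := (D.exists_rotation r).choose

theorem rotation_apply (r : OneForm d M) (p : M) (v : TangentSpace (𝓡 d) p) :
    D.rotation r p v = D.s p v + 2 * r p v := (D.exists_rotation r).choose_spec p v

theorem lieOne_rotation (r : OneForm d M) (p : M) (v : TangentSpace (𝓡 d) p) :
    D.lieOne (D.rotation r) p v = D.lieOne D.sT p v + 2 * D.lieOne r p v := by
  have h1 := D.lieOne_apply (D.rotation r) (diffAt_ext v)
  have h2 := D.lieOne_apply D.sT (diffAt_ext v)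
  have h3 := D.lieOne_apply r (diffAt_ext v)
  rw [ext_self] at h1 h2 h3
  have h4 := ((r.smoothOneAt p).apply (smoothVectorAt_ext v)).mdifferentiableAt
  have h5 := ((D.sT.smoothOneAt p).apply (smoothVectorAt_ext v)).mdifferentiableAt
  rw [h1, h2, h3]
  simp only [rotation_apply, ← sT_apply]
  have h6 : MDifferentiableAt (𝓡 d) 𝓘(ℝ, ℝ) (fun q ↦ 2 * r q (ext v q)) p :=
    mdifferentiableAt_const.mul h4
  rw [dirDeriv_add h5 h6, dirDeriv_const_mul _ h4]
  ring

theorem exists_source (r : OneForm d M) : ∃ B : TwoTensor d M, ∀ p v w, B p v w =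
    (ricci D.connection p v w + ricci D.connection p w v) / 2
    + (covDeriv D.connection (fun q x ↦ D.s q x + 2 * r q x) p v w
      + covDeriv D.connection (fun q x ↦ D.s q x + 2 * r q x) p w v) / 2
    - 2 * r p v * r p w + 2 * (r p v * D.s p w + r p w * D.s p v) - D.s p v * D.s p w
    + (D.F p w (D.shape p v) + D.F p v (D.shape p w)) := by
  simp only [← rotation_apply, ← ricT_apply, ← nabla_apply, ← FT_apply]
  simp only [← sT_apply]
  refine exists_twoTensor _ (fun q v v' w ↦ by simp; ring) (fun q c v w ↦ by simp; ring)
    (fun q v w w' ↦ by simp; ring) (fun q c v w ↦ by simp; ring) fun p V W hV hW ↦ ?_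
  have hr := fun {V : Π q : M, TangentSpace (𝓡 d) q} (hV : SmoothVectorAt V p) ↦
    (r.smoothOneAt p).apply hV
  have hs := fun {V : Π q : M, TangentSpace (𝓡 d) q} (hV : SmoothVectorAt V p) ↦
    (D.sT.smoothOneAt p).apply hV
  have hR := fun {V W : Π q : M, TangentSpace (𝓡 d) q} (hV : SmoothVectorAt V p)
    (hW : SmoothVectorAt W p) ↦ (D.ricT.smoothTwoAt p).apply hV hW
  have hN := fun {V W : Π q : M, TangentSpace (𝓡 d) q} (hV : SmoothVectorAt V p)
    (hW : SmoothVectorAt W p) ↦ ((D.nabla (D.rotation r)).smoothTwoAt p).apply hV hW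
  have hF := fun {V W : Π q : M, TangentSpace (𝓡 d) q} (hV : SmoothVectorAt V p)
    (hW : SmoothVectorAt W p) ↦ (D.FT.smoothTwoAt p).apply hV hW
  exact (((((((hR hV hW).add (hR hW hV)).div_const 2).add
    (((hN hV hW).add (hN hW hV)).div_const 2)).sub ((contMDiffAt_const.mul (hr hV)).mul (hr hW))).add
    (contMDiffAt_const.mul (((hr hV).mul (hs hW)).add ((hr hW).mul (hs hV))))).sub
    ((hs hV).mul (hs hW))).add
    ((hF hW (D.smoothVectorAt_shape hV)).add (hF hV (D.smoothVectorAt_shape hW)))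

/-- The terms of the constraint tensor which depend only on `r = Y(n, ·)`. -/
noncomputable def source (r : OneForm d M) : TwoTensor d M := (D.exists_source r).choose

theorem source_apply (r : OneForm d M) (p : M) (v w : TangentSpace (𝓡 d) p) : D.source r p v w =
    (ricci D.connection p v w + ricci D.connection p w v) / 2
    + (covDeriv D.connection (fun q x ↦ D.s q x + 2 * r q x) p v w
      + covDeriv D.connection (fun q x ↦ D.s q x + 2 * r q x) p w v) / 2
    - 2 * r p v * r p w + 2 * (r p v * D.s p w + r p w * D.s p v) - D.s p v * D.s p w
    + (D.F p w (D.shape p v) + D.F p v (D.shape p w)) := (D.exists_source r).choose_spec p v w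

theorem source_comm (r : OneForm d M) (p : M) (v w : TangentSpace (𝓡 d) p) :
    D.source r p v w = D.source r p w v := by
  rw [source_apply, source_apply]
  ring

/-- Separates the nonlinear and differentiated terms, which see `Y` only through `r`, from the
remaining ones; with `κ_n` given, these are linear in `Y`. -/
theorem constraintTensor_eq (Y : TwoTensor d M) (p : M) (v w : TangentSpace (𝓡 d) p) :
    D.constraintTensor Y p v w = D.source (D.contract Y) p v w
      - 2 * lieDeriv D.n (fun q x y ↦ Y q x y) p v w - (2 * D.κ Y p + D.trP D.U p) * Y p v w
      - D.trForm (Y p) * D.U p v w + 2 * (Y p w (D.shape p v) + Y p v (D.shape p w)) := by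
  have h := fun v w : TangentSpace (𝓡 d) p ↦ D.sum_Pc_U v ((2 : ℝ) • toBilin (Y p) w + toBilin (D.FT p) w)
  have hY : ∀ v w, toBilin (Y p) v w = Y p v w := fun _ _ ↦ rfl
  have hF : ∀ v w, toBilin (D.FT p) v w = D.F p v w := fun v w ↦ D.FT_apply p v w
  simp only [LinearMap.add_apply, LinearMap.smul_apply, hY, hF, smul_eq_mul] at h
  have h2 := h v w
  have h3 := h w v
  have hr : ∀ q x, D.r Y q x = D.contract Y q x := fun q x ↦ (D.contract_apply Y q x).symm
  rw [source_apply, constraintTensor]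
  simp only [hr, mul_add, Finset.sum_add_distrib, trP_eq_trForm] at h2 h3 ⊢
  linear_combination h2 + h3

/-- This is the inhomogeneity of the equation for `r`. It involves no part of `Y`, and that is why
the equation for `r` closes. -/
theorem exists_contractedSource (f : ContMDiffMap (𝓡 d) 𝓘(ℝ, ℝ) M ℝ ∞) :
    ∃ b : OneForm d M, ∀ p w, b p w =
      (ricci D.connection p (D.n p) w + ricci D.connection p w (D.n p)) / 2
        + D.lieOne D.sT p w / 2 - dirDeriv f p w := by
  simp only [← ricT_apply]
  refine exists_oneForm _ (fun q v v' ↦ ?_) (fun q c v ↦ ?_) fun p V hV ↦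
    (((((D.ricT.smoothTwoAt p).apply (D.smoothVectorAt_n p) hV).add
      ((D.ricT.smoothTwoAt p).apply hV (D.smoothVectorAt_n p))).div_const 2).add
      ((((D.lieOne D.sT).smoothOneAt p).apply hV).div_const 2)).sub
      (SmoothFnAt.dirDeriv (f.contMDiff p) hV)
  · rw [dirDeriv_add_vec]
    simp
    ring
  · rw [dirDeriv_smul_vec]
    simp
    ring

variable {D}

/-- The contraction of the source terms with `n`. -/
theorem source_n (hD : D.IsNull) {f : ContMDiffMap (𝓡 d) 𝓘(ℝ, ℝ) M ℝ ∞} {r : OneForm d M}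
    (hr : ∀ p, r p (D.n p) = -f p) (p : M) (w : TangentSpace (𝓡 d) p) :
    D.source r p (D.n p) w =
      (ricci D.connection p (D.n p) w + ricci D.connection p w (D.n p)) / 2
        + D.lieOne D.sT p w / 2 - dirDeriv f p w
        + D.lieOne r p w + 2 * f p * r p w - 2 * r p (D.shape p w) := by
  have h1 : ∀ q, D.rotation r q (D.n q) = -2 * f q := fun q ↦ by
    rw [rotation_apply, s_n, hr]
    ring
  have h2 : D.F p w 0 = 0 := by rw [← FT_apply, map_zero]
  have h3 : D.F p (D.n p) (D.shape p w) = D.s p (D.shape p w) := rfl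
  have h4 := SmoothFnAt.mdifferentiableAt (f.contMDiff p)
  rw [source_apply]
  simp only [← rotation_apply, ← nabla_apply]
  rw [nabla_n_left, nabla_n_right, connection_n hD, map_add, map_smul, smul_eq_mul, lieOne_rotation,
    shape_n hD, h2, h3, s_n, hr, h1]
  simp only [h1, rotation_apply]
  rw [dirDeriv_const_mul _ h4]
  ring

end MetricHypersurfaceData

end Contraction

/-! ### Solving the constraint equations for given values on the section. -/

section Evolution

variable {m : ℕ} {H : Type*} [TopologicalSpace H] [T2Space H]
  [ChartedSpace (EuclideanSpace ℝ (Fin (m + 1))) H] [IsManifold (𝓡 (m + 1)) ∞ H]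
  {S : Type*} [TopologicalSpace S] [ChartedSpace (EuclideanSpace ℝ (Fin m)) S]
  [IsManifold (𝓡 m) ∞ S] {ι : S → H}

namespace MetricHypersurfaceData

variable {D : MetricHypersurfaceData (m + 1) H}

/-- A one-form `θ` is encoded as `ℓ ⊗ θ` and recovered by contraction with `n`, since `ℓ(n) = 1`;
the theory for two-tensors then covers one-forms. The first summand comes from `L_n ℓ`. -/
theorem isLinearTerm_oneForm (D : MetricHypersurfaceData (m + 1) H) {a : H → ℝ}
    (ha : ∀ p, SmoothFnAt (m + 1) a p) (c : ℝ) :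
    IsLinearTerm (fun q (T : TwoForms (m + 1) q) v w ↦ D.lieOne D.ℓ q v * T (D.n q) w
      + D.ℓ q v * (a q * T (D.n q) w + c * T (D.n q) (D.shape q w))) where
  map_add q T T' v w := by simp; ring
  map_smul q c T v w := by simp; ring
  add_left q T v v' w := by simp; ring
  smul_left q T c v w := by simp; ring
  add_right q T v w w' := by simp; ring
  smul_right q T c v w := by simp; ring
  smooth T p V W hT hV hW :=
    have h := fun {W} (hW : SmoothVectorAt W p) ↦ hT.apply (D.smoothVectorAt_n p) hW
    (((D.lieOne D.ℓ).smoothOneAt p).apply hV |>.mul (h hW)).add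
      (((D.smoothOneAt_ℓ p).apply hV).mul (((ha p).mul (h hW)).add
        (contMDiffAt_const.mul (h (D.smoothVectorAt_shape hW)))))

theorem lieDeriv_tmul_ℓ {a : H → ℝ} {c : ℝ} {b θ : OneForm (m + 1) H} (hD : D.IsNull)
    (hθ : ∀ p w, D.lieOne θ p w = a p * θ p w + c * θ p (D.shape p w) + b p w)
    {T B : TwoTensor (m + 1) H} (hT : ∀ p v w, T p v w = D.ℓ p v * θ p w)
    (hB : ∀ p v w, B p v w = D.ℓ p v * b p w) (p : H) (v w : TangentSpace (𝓡 (m + 1)) p) :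
    lieDeriv D.n (fun q v w ↦ T q v w) p v w = D.lieOne D.ℓ p v * T p (D.n p) w
      + D.ℓ p v * (a p * T p (D.n p) w + c * T p (D.n p) (D.shape p w)) + B p v w := by
  rw [D.lieDeriv_tmul hT, hθ, hT, hT, hB, ℓ_n hD]
  ring

/-- Uniqueness for linear equations for one-forms. -/
theorem oneForm_solution_unique (hD : D.IsNull) (hι : IsCrossSection D.n ι) {a : H → ℝ}
    (ha : ∀ p, SmoothFnAt (m + 1) a p) {c : ℝ} {b θ θ' : OneForm (m + 1) H}
    (hθ : ∀ p w, D.lieOne θ p w = a p * θ p w + c * θ p (D.shape p w) + b p w)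
    (hθ' : ∀ p w, D.lieOne θ' p w = a p * θ' p w + c * θ' p (D.shape p w) + b p w)
    (h : ∀ x w, θ (ι x) w = θ' (ι x) w) : θ = θ' := by
  obtain ⟨B, hB⟩ := exists_tmul D.ℓ b
  obtain ⟨T, hT⟩ := exists_tmul D.ℓ θ
  obtain ⟨T', hT'⟩ := exists_tmul D.ℓ θ'
  have key : T = T' := twoTensor_solution_unique D.smoothVectorAt_n (n_ne_zero hD) hι
    (D.isLinearTerm_oneForm ha c) B (lieDeriv_tmul_ℓ hD hθ hT hB) (lieDeriv_tmul_ℓ hD hθ' hT' hB)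
    fun x ↦ by
      ext v w
      rw [hT, hT', h]
  ext p w
  have h1 := hT p (D.n p) w
  have h2 := hT' p (D.n p) w
  rw [ℓ_n hD, one_mul] at h1 h2
  rw [← h1, ← h2, key]

/-- Existence for linear equations for one-forms. -/
theorem exists_oneForm_solution (hD : D.IsNull) (hι : IsCrossSection D.n ι)
    (htr : IsTransversal D.n ι) {a : H → ℝ} (ha : ∀ p, SmoothFnAt (m + 1) a p) (c : ℝ)
    (b : OneForm (m + 1) H) (T₀ : Π q : H, TwoForms (m + 1) q)
    (hT₀ : ∀ x : S, ∃ T₁ : Π q : H, TwoForms (m + 1) q,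
      (∀ᶠ q in 𝓝 (ι x), SmoothTwoAt T₁ q) ∧ ∀ᶠ x' in 𝓝 x, T₁ (ι x') = T₀ (ι x')) :
    ∃ θ : OneForm (m + 1) H,
      (∀ p w, D.lieOne θ p w = a p * θ p w + c * θ p (D.shape p w) + b p w) ∧
      ∀ x w, θ (ι x) w = T₀ (ι x) (D.n (ι x)) w := by
  obtain ⟨B, hB⟩ := exists_tmul D.ℓ b
  let N : Π q : H, TwoForms (m + 1) q → TwoForms (m + 1) q := fun q T ↦
    toTwoForms (fun v w ↦ D.ℓ q v * T (D.n q) w) (by simp [add_mul]) (by simp [mul_assoc])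
      (by simp [mul_add]) (by simp [mul_left_comm])
  have hN : ∀ q T v w, N q T v w = D.ℓ q v * T (D.n q) w := fun _ _ _ _ ↦ rfl
  obtain ⟨T, hT, hT'⟩ := exists_twoTensor_solution D.smoothVectorAt_n (n_ne_zero hD) hι htr
    (D.isLinearTerm_oneForm ha c) B (fun q ↦ N q (T₀ q)) fun x ↦ by
      obtain ⟨T₁, h1, h2⟩ := hT₀ x
      refine ⟨fun q ↦ N q (T₁ q), ?_, ?_⟩
      · filter_upwards [h1] with q hq
        exact smoothTwoAt_of_apply fun V W hV hW ↦
          ((D.smoothOneAt_ℓ q).apply hV).mul (hq.apply (D.smoothVectorAt_n q) hW)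
      · filter_upwards [h2] with x' hx'
        rw [hx']
  refine ⟨D.contract T, fun p w ↦ ?_, fun x w ↦ ?_⟩
  -- `(L_n ℓ)(n) = n(ℓ(n)) = 0`, so contraction with `n` gives back the one-form equation without
  -- showing that the solution has the form `ℓ ⊗ θ`.
  · have h : D.lieOne D.ℓ p (D.n p) = 0 := by
      rw [lieOne_n]
      simp only [ℓ_n hD]
      exact dirDeriv_const 1 _
    rw [← lieDeriv_contract, hT, hB, contract_apply, contract_apply, h, ℓ_n hD]
    ring
  · rw [contract_apply, hT', hN, ℓ_n hD, one_mul]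

/-- The terms with `U♯` are symmetrised in the arguments of `T`. Nothing changes for symmetric `T`,
but now the transpose of a solution solves an equation of the same kind. -/
theorem isLinearTerm_transverse (D : MetricHypersurfaceData (m + 1) H)
    {a : H → ℝ} (ha : ∀ p, SmoothFnAt (m + 1) a p) :
    IsLinearTerm (fun q (T : TwoForms (m + 1) q) v w ↦ (a q * T v w - D.trForm T * D.UT q v w
      + (T w (D.shape q v) + T (D.shape q v) w + T v (D.shape q w) + T (D.shape q w) v)) / 2) where
  map_add q T T' v w := by simp [trForm_add]; ring
  map_smul q c T v w := by simp [trForm_smul]; ring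
  add_left q T v v' w := by simp; ring
  smul_left q T c v w := by simp; ring
  add_right q T v w w' := by simp; ring
  smul_right q T c v w := by simp; ring
  smooth T p V W hT hV hW :=
    have hv := D.smoothVectorAt_shape hV
    have hw := D.smoothVectorAt_shape hW
    ((((ha p).mul (hT.apply hV hW)).sub ((D.smoothFnAt_trForm hT).mul
      ((D.UT.smoothTwoAt p).apply hV hW))).add ((((hT.apply hW hv).add (hT.apply hv hW)).add
        (hT.apply hV hw)).add (hT.apply hw hV))).div_const 2

/-- The initial data at a point of the cross-section. -/
structure IsInitial (D : MetricHypersurfaceData (m + 1) H) (ι : S → H) (f : H → ℝ) (χ : S → ℝ)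
    (β : OneForm m S) (T : TwoTensor m S) (x : S) (Y : TwoForms (m + 1) (ι x)) : Prop where
  symm : ∀ v w, Y v w = Y w v
  n_n : Y (D.n (ι x)) (D.n (ι x)) = -f (ι x)
  n_tangent : ∀ v, Y (D.n (ι x)) (mfderiv (𝓡 m) (𝓡 (m + 1)) ι x v) = β x v
  trace : D.trForm Y = χ x
  traceFree : ∀ v w, NullData.traceFree (pullback ι D.γ x)
    (fun v w ↦ Y (mfderiv (𝓡 m) (𝓡 (m + 1)) ι x v) (mfderiv (𝓡 m) (𝓡 (m + 1)) ι x w)) v w = T x v w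

variable {f : ContMDiffMap (𝓡 (m + 1)) 𝓘(ℝ, ℝ) H ℝ ∞}

theorem contractedSource_smooth_coeff (f : ContMDiffMap (𝓡 (m + 1)) 𝓘(ℝ, ℝ) H ℝ ∞) (p : H) :
    SmoothFnAt (m + 1) (fun q ↦ -(2 * f q + D.trP D.U q)) p :=
  ((contMDiffAt_const.mul (f.contMDiff p)).add (D.smoothFnAt_trP_U p)).neg

theorem exists_evolutionSource (D : MetricHypersurfaceData (m + 1) H) (Λ : ℝ) (r : OneForm (m + 1) H) :
    ∃ B : TwoTensor (m + 1) H, ∀ p v w, B p v w = (D.source r p v w - Λ * D.γ p v w) / 2 :=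
  exists_twoTensor _ (fun q v v' w ↦ by simp; ring) (fun q c v w ↦ by simp; ring)
    (fun q v w w' ↦ by simp; ring) (fun q c v w ↦ by simp; ring) fun p _ _ hV hW ↦
    ((((D.source r).smoothTwoAt p).apply hV hW).sub
      (contMDiffAt_const.mul ((D.smoothTwoAt_γ p).apply hV hW))).div_const 2

/-- The contraction of the constraint equations with `n`. -/
theorem lieOne_contract_of_constraintTensor (hD : D.IsNull) {Λ : ℝ} {Y : TwoTensor (m + 1) H}
    (hκ : ∀ p, D.κ Y p = f p) (hR : ∀ p v w, D.constraintTensor Y p v w = Λ * D.γ p v w)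
    {b : OneForm (m + 1) H} (hb : ∀ p w, b p w =
      (ricci D.connection p (D.n p) w + ricci D.connection p w (D.n p)) / 2
        + D.lieOne D.sT p w / 2 - dirDeriv f p w) (p : H) (w : TangentSpace (𝓡 (m + 1)) p) :
    D.lieOne (D.contract Y) p w = -D.trP D.U p * D.contract Y p w
      + 0 * D.contract Y p (D.shape p w) + b p w := by
  have hr : ∀ p, D.contract Y p (D.n p) = -f p := fun p ↦ by
    rw [contract_apply, ← hκ, κ, neg_neg]
  have h := hR p (D.n p) w
  -- The terms with `tr_P Y` and `γ` vanish on `n`; `2fr` and `2r ∘ U♯` from the source cancel those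
  -- of the transport part. The zero coefficient only fits the general form of one-form equations.
  rw [constraintTensor_eq, source_n hD hr, lieDeriv_contract, hκ, U_n hD, shape_n hD, map_zero,
    D.symm, D.γ_n hD, ← contract_apply, ← contract_apply, ← hb] at h
  linear_combination -h

theorem lieDeriv_of_constraintTensor {Λ : ℝ} {Y : TwoTensor (m + 1) H}
    (hsymm : ∀ p v w, Y p v w = Y p w v) (hκ : ∀ p, D.κ Y p = f p)
    (hR : ∀ p v w, D.constraintTensor Y p v w = Λ * D.γ p v w)
    {B : TwoTensor (m + 1) H}
    (hB : ∀ p v w, B p v w = (D.source (D.contract Y) p v w - Λ * D.γ p v w) / 2)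
    (p : H) (v w : TangentSpace (𝓡 (m + 1)) p) :
    lieDeriv D.n (fun q v w ↦ Y q v w) p v w = (-(2 * f p + D.trP D.U p) * Y p v w
      - D.trForm (Y p) * D.UT p v w + (Y p w (D.shape p v) + Y p (D.shape p v) w
        + Y p v (D.shape p w) + Y p (D.shape p w) v)) / 2 + B p v w := by
  have h := hR p v w
  rw [constraintTensor_eq, hκ] at h
  rw [hB, UT_apply, hsymm p (D.shape p v), hsymm p (D.shape p w)]
  linear_combination -h / 2

/-- The solution of the constraint equations is determined by its values on a cross-section. -/
theorem constraintTensor_unique (hD : D.IsNull) (hι : IsCrossSection D.n ι) {Λ : ℝ}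
    {Y Y' : TwoTensor (m + 1) H} (hsymm : ∀ p v w, Y p v w = Y p w v)
    (hsymm' : ∀ p v w, Y' p v w = Y' p w v) (hκ : ∀ p, D.κ Y p = f p) (hκ' : ∀ p, D.κ Y' p = f p)
    (hR : ∀ p v w, D.constraintTensor Y p v w = Λ * D.γ p v w)
    (hR' : ∀ p v w, D.constraintTensor Y' p v w = Λ * D.γ p v w)
    (h : ∀ x, Y (ι x) = Y' (ι x)) : Y = Y' := by
  obtain ⟨b, hb⟩ := D.exists_contractedSource f
  -- The one-forms `r` must agree first: only then do the two tensors satisfy the same linear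
  -- equation.
  have hr : D.contract Y = D.contract Y' := oneForm_solution_unique hD hι
    (fun p ↦ (D.smoothFnAt_trP_U p).neg) (lieOne_contract_of_constraintTensor hD hκ hR hb)
    (lieOne_contract_of_constraintTensor hD hκ' hR' hb) fun x w ↦ by
      rw [contract_apply, contract_apply, h]
  obtain ⟨B, hB⟩ := D.exists_evolutionSource Λ (D.contract Y)
  exact twoTensor_solution_unique D.smoothVectorAt_n (n_ne_zero hD) hι
    (D.isLinearTerm_transverse (contractedSource_smooth_coeff f)) B
    (lieDeriv_of_constraintTensor hsymm hκ hR hB)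
    (lieDeriv_of_constraintTensor hsymm' hκ' hR' (hr ▸ hB)) h

theorem exists_transpose (Y : TwoTensor (m + 1) H) :
    ∃ Y' : TwoTensor (m + 1) H, ∀ p v w, Y' p v w = Y p w v :=
  exists_twoTensor _ (by simp) (by simp) (by simp) (by simp) fun p _ _ hV hW ↦
    (Y.smoothTwoAt p).apply hW hV

/-- By `ricci_n_n` and the equation for `f`, `ρ = r(n) + f` satisfies `n(ρ) = -(tr_P U) ρ`. It
vanishes on the section, hence everywhere. -/
theorem exists_contracted_solution (hD : D.IsNull) (hι : IsCrossSection D.n ι)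
    (htr : IsTransversal D.n ι) (hf : D.RaychaudhuriEq f)
    {b : OneForm (m + 1) H} (hb : ∀ p w, b p w =
      (ricci D.connection p (D.n p) w + ricci D.connection p w (D.n p)) / 2
        + D.lieOne D.sT p w / 2 - dirDeriv f p w)
    (T₀ : Π q : H, TwoForms (m + 1) q)
    (hT₀ : ∀ x : S, ∃ T₁ : Π q : H, TwoForms (m + 1) q,
      (∀ᶠ q in 𝓝 (ι x), SmoothTwoAt T₁ q) ∧ ∀ᶠ x' in 𝓝 x, T₁ (ι x') = T₀ (ι x'))
    (hn : ∀ x, T₀ (ι x) (D.n (ι x)) (D.n (ι x)) = -f (ι x)) :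
    ∃ r : OneForm (m + 1) H, (∀ p w, D.lieOne r p w = -D.trP D.U p * r p w + b p w) ∧
      (∀ p, r p (D.n p) = -f p) ∧ ∀ x w, r (ι x) w = T₀ (ι x) (D.n (ι x)) w := by
  obtain ⟨r, hr, hr₀⟩ := exists_oneForm_solution hD hι htr
    (fun p ↦ (D.smoothFnAt_trP_U p).neg) 0 b T₀ hT₀
  simp only [zero_mul, add_zero] at hr
  refine ⟨r, hr, ?_, hr₀⟩
  have hs : ∀ p, SmoothFnAt (m + 1) (fun q ↦ r q (D.n q)) p := fun p ↦
    (r.smoothOneAt p).apply (D.smoothVectorAt_n p)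
  have hfs : ∀ p, SmoothFnAt (m + 1) f p := fun p ↦ f.contMDiff p
  have h := eq_zero_of_dirDeriv_eq_mul D.smoothVectorAt_n (n_ne_zero hD) hι
    (a := fun q ↦ -D.trP D.U q) (ρ := fun q ↦ r q (D.n q) + f q)
    (fun p ↦ (D.smoothFnAt_trP_U p).neg) (fun p ↦ (hs p).add (hfs p)) (fun p ↦ ?_)
    (fun x ↦ by rw [hr₀, hn, neg_add_cancel])
  · exact fun p ↦ eq_neg_of_add_eq_zero_left (h p)
  · have h1 : D.lieOne D.sT p (D.n p) = 0 := by
      rw [lieOne_n]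
      simp only [sT_apply, s_n]
      exact dirDeriv_const 0 _
    have h2 := hf p
    rw [sum_Pc_Pc_U] at h2
    have h3 := hr p (D.n p)
    rw [lieOne_n, hb, ricci_n_n hD, h1] at h3
    rw [dirDeriv_add (hs p).mdifferentiableAt (hfs p).mdifferentiableAt, h3]
    linear_combination h2

/-- The transpose of `Y` solves the same equation with the same initial values. -/
theorem evolution_symm (hD : D.IsNull) (hι : IsCrossSection D.n ι) {a : H → ℝ}
    (ha : ∀ p, SmoothFnAt (m + 1) a p) {B Y : TwoTensor (m + 1) H}
    (hB : ∀ p v w, B p v w = B p w v)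
    (hY : ∀ p v w, lieDeriv D.n (fun q v w ↦ Y q v w) p v w = (a p * Y p v w
      - D.trForm (Y p) * D.UT p v w + (Y p w (D.shape p v) + Y p (D.shape p v) w
        + Y p v (D.shape p w) + Y p (D.shape p w) v)) / 2 + B p v w)
    (h : ∀ x v w, Y (ι x) v w = Y (ι x) w v) (p : H) (v w : TangentSpace (𝓡 (m + 1)) p) :
    Y p v w = Y p w v := by
  obtain ⟨Y', hY'⟩ := exists_transpose Y
  have key : Y = Y' := by
    refine twoTensor_solution_unique D.smoothVectorAt_n (n_ne_zero hD) hι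
      (D.isLinearTerm_transverse ha) B hY (fun p v w ↦ ?_) fun x ↦ ?_
    · have h1 : lieDeriv D.n (fun q v w ↦ Y' q v w) p v w
          = lieDeriv D.n (fun q v w ↦ Y q v w) p w v := by
        simp only [lieDeriv, hY']
        ring
      have h2 : D.trForm (Y' p) = D.trForm (Y p) := D.trForm_flip (hY' p)
      have h3 : D.UT p w v = D.UT p v w := by rw [UT_apply, UT_apply, D.U_comm]
      rw [h1, hY, h2, h3, hB p w v]
      simp only [hY']
      ring
    · ext v w
      rw [hY', h]
  exact (congrArg (fun Z : TwoTensor (m + 1) H ↦ Z p v w) key).trans (hY' p v w)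

/-- Both one-forms solve `L_n θ = -(f + tr_P U / 2) θ + θ ∘ U♯ + ½ source(r)(n, ·)`. For `r` this is
its own equation rewritten with `source_n`. -/
theorem contract_evolution (hD : D.IsNull) (hι : IsCrossSection D.n ι)
    {b : OneForm (m + 1) H} (hb : ∀ p w, b p w =
      (ricci D.connection p (D.n p) w + ricci D.connection p w (D.n p)) / 2
        + D.lieOne D.sT p w / 2 - dirDeriv f p w)
    {r : OneForm (m + 1) H} (hr : ∀ p w, D.lieOne r p w = -D.trP D.U p * r p w + b p w)
    (hrn : ∀ p, r p (D.n p) = -f p) {Λ : ℝ} {B Y : TwoTensor (m + 1) H}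
    (hB : ∀ p v w, B p v w = (D.source r p v w - Λ * D.γ p v w) / 2)
    (hsymm : ∀ p v w, Y p v w = Y p w v)
    (hY : ∀ p v w, lieDeriv D.n (fun q v w ↦ Y q v w) p v w
      = (-(2 * f p + D.trP D.U p) * Y p v w - D.trForm (Y p) * D.UT p v w
        + (Y p w (D.shape p v) + Y p (D.shape p v) w
        + Y p v (D.shape p w) + Y p (D.shape p w) v)) / 2 + B p v w)
    (h : ∀ x w, Y (ι x) (D.n (ι x)) w = r (ι x) w) : D.contract Y = r := by
  obtain ⟨b', hb'⟩ := exists_half (D.source r)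
  refine oneForm_solution_unique hD hι (a := fun q ↦ -(2 * f q + D.trP D.U q) / 2)
    (fun p ↦ (contractedSource_smooth_coeff f p).div_const 2) (c := 1) (b := D.contract b')
    (fun p w ↦ ?_) (fun p w ↦ ?_) fun x w ↦ ?_
  · have h1 : Y p (D.shape p w) (D.n p) = Y p (D.n p) (D.shape p w) := hsymm _ _ _
    have h2 : D.γ p (D.n p) w = 0 := by rw [D.symm, D.γ_n hD]
    have h3 : Y p (0 : TangentSpace (𝓡 (m + 1)) p) w = 0 := by simp
    have h4 : Y p w (0 : TangentSpace (𝓡 (m + 1)) p) = 0 := by simp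
    rw [← lieDeriv_contract, hY, hB, contract_apply, contract_apply, contract_apply, hb',
      UT_apply, U_n hD, shape_n hD, h1, h2, h3, h4]
    ring
  · have h := hr p w
    rw [contract_apply, hb', source_n hD hrn, ← hb]
    linear_combination h / 2
  · rw [contract_apply, h]

/-- Existence for the constraint equations with given initial values on a cross-section. -/
theorem exists_constraintTensor_eq (hD : D.IsNull) (hι : IsCrossSection D.n ι)
    (htr : IsTransversal D.n ι) (hf : D.RaychaudhuriEq f) (Λ : ℝ)
    (T₀ : Π q : H, TwoForms (m + 1) q)
    (hT₀ : ∀ x : S, ∃ T₁ : Π q : H, TwoForms (m + 1) q,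
      (∀ᶠ q in 𝓝 (ι x), SmoothTwoAt T₁ q) ∧ ∀ᶠ x' in 𝓝 x, T₁ (ι x') = T₀ (ι x'))
    (hsymm : ∀ x v w, T₀ (ι x) v w = T₀ (ι x) w v)
    (hn : ∀ x, T₀ (ι x) (D.n (ι x)) (D.n (ι x)) = -f (ι x)) :
    ∃ Y : TwoTensor (m + 1) H, (∀ p v w, Y p v w = Y p w v) ∧ (∀ p, D.κ Y p = f p) ∧
      (∀ p v w, D.constraintTensor Y p v w = Λ * D.γ p v w) ∧ ∀ x, Y (ι x) = T₀ (ι x) := by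
  obtain ⟨b, hb⟩ := D.exists_contractedSource f
  -- `r` is constructed before `Y`, so that the source, quadratic in `r` and containing its
  -- derivatives, is a known tensor in the equation for `Y`.
  obtain ⟨r, hr, hrn, hr₀⟩ := exists_contracted_solution hD hι htr hf hb T₀ hT₀ hn
  obtain ⟨B, hB⟩ := D.exists_evolutionSource Λ r
  have ha := contractedSource_smooth_coeff (D := D) f
  obtain ⟨Y, hY, hY₀⟩ := exists_twoTensor_solution D.smoothVectorAt_n (n_ne_zero hD) hι htr
    (D.isLinearTerm_transverse ha) B T₀ hT₀
  have hYsymm : ∀ p v w, Y p v w = Y p w v :=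
    evolution_symm hD hι ha (fun p v w ↦ by rw [hB, hB, D.source_comm, D.symm]) hY
      fun x v w ↦ by rw [hY₀, hsymm]
  have hyr : D.contract Y = r := contract_evolution hD hι hb hr hrn hB hYsymm hY
    fun x w ↦ by rw [hY₀, hr₀]
  have hκ : ∀ p, D.κ Y p = f p := fun p ↦ by
    rw [κ, ← contract_apply, hyr, hrn, neg_neg]
  refine ⟨Y, hYsymm, hκ, fun p v w ↦ ?_, hY₀⟩
  have h1 : Y p (D.shape p v) w = Y p w (D.shape p v) := hYsymm _ _ _
  have h2 : Y p (D.shape p w) v = Y p v (D.shape p w) := hYsymm _ _ _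
  rw [constraintTensor_eq, hκ, hyr, hY, hB, UT_apply, h1, h2]
  ring

end MetricHypersurfaceData

end Evolution

/-! ### Traces with respect to a metric. -/

section MetricTrace

variable {d : ℕ} {M : Type*} [TopologicalSpace M] [ChartedSpace (EuclideanSpace ℝ (Fin d)) M]
  [IsManifold (𝓡 d) ∞ M]

theorem metricTrace_add_mul {p : M} (h T T' : TangentSpace (𝓡 d) p → TangentSpace (𝓡 d) p → ℝ)
    (c : ℝ) : metricTrace h (fun v w ↦ T v w + c * T' v w)
      = metricTrace h T + c * metricTrace h T' := by
  simp only [metricTrace, mul_add, Finset.sum_add_distrib, Finset.mul_sum]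
  congr 1
  exact Finset.sum_congr rfl fun a _ ↦ Finset.sum_congr rfl fun b _ ↦ by ring

theorem metricTrace_self {p : M} (h : LinearMap.BilinForm ℝ (TangentSpace (𝓡 d) p))
    (hsymm : ∀ v w, h v w = h w v) (hnd : h.Nondegenerate) :
    metricTrace (fun v w ↦ h v w) (fun v w ↦ h v w) = d := by
  let A : Matrix (Fin d) (Fin d) ℝ := Matrix.of fun i j ↦ h (frame p i) (frame p j)
  have hA : A = LinearMap.BilinForm.toMatrix (frame p) h := by
    ext i j
    rw [LinearMap.BilinForm.toMatrix_apply]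
    rfl
  have hdet : IsUnit A.det := by
    rw [hA, isUnit_iff_ne_zero]
    exact (LinearMap.BilinForm.nondegenerate_iff_det_ne_zero (frame p)).1 hnd
  have h1 : Matrix.trace (A⁻¹ * A) = d := by
    rw [Matrix.nonsing_inv_mul A hdet, Matrix.trace_one, Fintype.card_fin]
  rw [← h1]
  refine Finset.sum_congr rfl fun a _ ↦ ?_
  rw [Matrix.diag_apply, Matrix.mul_apply]
  exact Finset.sum_congr rfl fun b _ ↦ congrArg _ (hsymm _ _)

end MetricTrace

/-! ### Pointwise determination of the initial values. -/

section InitialData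

variable {m : ℕ} {H : Type*} [TopologicalSpace H]
  [ChartedSpace (EuclideanSpace ℝ (Fin (m + 1))) H] [IsManifold (𝓡 (m + 1)) ∞ H]
  {S : Type*} [TopologicalSpace S] [ChartedSpace (EuclideanSpace ℝ (Fin m)) S]
  [IsManifold (𝓡 m) ∞ S] {X : Π p : H, TangentSpace (𝓡 (m + 1)) p} {ι : S → H}

/-- Transversality is injectivity of a linear map between spaces of equal dimension `m + 1`. -/
theorem IsTransversal.exists_eq_smul_add (h : IsTransversal X ι) (x : S)
    (u : TangentSpace (𝓡 (m + 1)) (ι x)) :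
    ∃ (a : ℝ) (v : TangentSpace (𝓡 m) x), u = a • X (ι x) + mfderiv (𝓡 m) (𝓡 (m + 1)) ι x v := by
  let L : (ℝ × TangentSpace (𝓡 m) x) →ₗ[ℝ] TangentSpace (𝓡 (m + 1)) (ι x) :=
    (LinearMap.id.smulRight (X (ι x))).coprod
      (mfderiv (𝓡 m) (𝓡 (m + 1)) ι x).toLinearMap
  have hL : Function.Injective L := by
    rw [← LinearMap.ker_eq_bot, LinearMap.ker_eq_bot']
    rintro ⟨a, v⟩ h'
    obtain ⟨h1, h2⟩ := h x a v h'
    rw [h1, h2]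
    rfl
  have h1 : Module.finrank ℝ (TangentSpace (𝓡 m) x) = m :=
    finrank_euclideanSpace_fin (𝕜 := ℝ) (n := m)
  have h2 : Module.finrank ℝ (TangentSpace (𝓡 (m + 1)) (ι x)) = m + 1 :=
    finrank_euclideanSpace_fin (𝕜 := ℝ) (n := m + 1)
  obtain ⟨⟨a, v⟩, hav⟩ := (LinearMap.injective_iff_surjective_of_finrank_eq_finrank
    (by rw [Module.finrank_prod, Module.finrank_self, h1, h2, add_comm])).1 hL u
  exact ⟨a, v, hav.symm⟩

namespace MetricHypersurfaceData

variable {D : MetricHypersurfaceData (m + 1) H}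

theorem γ_n_left (hD : D.IsNull) (p : H) (v : TangentSpace (𝓡 (m + 1)) p) :
    D.γ p (D.n p) v = 0 := by
  rw [D.symm, D.γ_n hD]

/-- If `a n + dι(v) = 0`, then `dι(v)` is a multiple of `n`, which `γ` annihilates, so `h(v, ·) = 0`
and `v = 0`; then `a = 0` as `n` has no zeros. -/
theorem isTransversal_n (hD : D.IsNull)
    (hh : ∀ (x : S) (v : TangentSpace (𝓡 m) x), (∀ w, pullback ι D.γ x v w = 0) → v = 0) :
    IsTransversal D.n ι := by
  intro x a v h
  have hv : v = 0 := hh x v fun w ↦ by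
    rw [pullback, eq_neg_of_add_eq_zero_right h, map_neg, map_smul, neg_apply, smul_apply,
      γ_n_left hD, smul_zero, neg_zero]
  refine ⟨?_, hv⟩
  rw [hv, map_zero, add_zero, smul_eq_zero] at h
  exact h.resolve_right (n_ne_zero hD _)

variable {f : H → ℝ} {χ : S → ℝ} {β : OneForm m S} {T : TwoTensor m S}

/-- A form at a point of a cross-section is determined by its initial values. -/
theorem IsInitial.eq (hm : 1 ≤ m) (hD : D.IsNull) (htr : IsTransversal D.n ι) {x : S}
    {Y Y' : TwoForms (m + 1) (ι x)} (h : IsInitial D ι f χ β T x Y)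
    (h' : IsInitial D ι f χ β T x Y') : Y = Y' := by
  -- Tangential parts with equal trace-free parts differ by a multiple of `h`, here with factor the
  -- difference of the traces over `m`.
  obtain ⟨c, hc⟩ : ∃ c : ℝ, ∀ v w : TangentSpace (𝓡 m) x,
      Y (mfderiv (𝓡 m) (𝓡 (m + 1)) ι x v) (mfderiv (𝓡 m) (𝓡 (m + 1)) ι x w)
        = Y' (mfderiv (𝓡 m) (𝓡 (m + 1)) ι x v) (mfderiv (𝓡 m) (𝓡 (m + 1)) ι x w)
          + c * D.γ (ι x) (mfderiv (𝓡 m) (𝓡 (m + 1)) ι x v)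
            (mfderiv (𝓡 m) (𝓡 (m + 1)) ι x w) := by
    let t := fun Z : TwoForms (m + 1) (ι x) ↦ metricTrace (pullback ι D.γ x) fun v w ↦
      Z (mfderiv (𝓡 m) (𝓡 (m + 1)) ι x v) (mfderiv (𝓡 m) (𝓡 (m + 1)) ι x w)
    refine ⟨t Y / m - t Y' / m, fun v w ↦ ?_⟩
    have h1 := (h.traceFree v w).trans (h'.traceFree v w).symm
    simp only [NullData.traceFree, pullback] at h1
    simp only [t]
    linear_combination h1
  have hY : Y = Y' + c • D.γ (ι x) := by
    ext u u'
    obtain ⟨a, v, rfl⟩ := htr.exists_eq_smul_add x u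
    obtain ⟨b, w, rfl⟩ := htr.exists_eq_smul_add x u'
    have e1 := h.symm (mfderiv (𝓡 m) (𝓡 (m + 1)) ι x v) (D.n (ι x))
    have e2 := h'.symm (mfderiv (𝓡 m) (𝓡 (m + 1)) ι x v) (D.n (ι x))
    simp only [map_add, map_smul, add_apply, smul_apply, smul_eq_mul,
      e1, e2, h.n_n, h'.n_n, h.n_tangent, h'.n_tangent, hc, D.γ_n hD, γ_n_left hD]
    ring
  -- The relation `Y = Y' + cγ` extends to the full tangent space because `γ(n, ·) = 0`. Taking
  -- traces gives `c m = 0`, and `m ≥ 1`.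
  have h2 : D.trForm Y = D.trForm Y' + c * D.trForm (D.γ (ι x)) := by
    rw [hY, trForm_add, trForm_smul]
  rw [h.trace, h'.trace, trForm_γ hD, Nat.cast_add, Nat.cast_one, add_sub_cancel_right] at h2
  have hm' : (m : ℝ) ≠ 0 := by
    rw [Nat.cast_ne_zero]
    omega
  have hc0 : c = 0 := by
    have h3 : c * (m : ℝ) = 0 := by linarith
    exact (mul_eq_zero.1 h3).resolve_right hm'
  rw [hc0] at hY
  refine hY.trans ?_
  ext u u'
  simp

theorem metricTrace_pullback_γ
    (hh : ∀ (x : S) (v : TangentSpace (𝓡 m) x), (∀ w, pullback ι D.γ x v w = 0) → v = 0) (x : S) :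
    metricTrace (d := m) (p := x) (pullback ι D.γ x) (pullback ι D.γ x) = m := by
  let h : LinearMap.BilinForm ℝ (TangentSpace (𝓡 m) x) :=
    LinearMap.mk₂ ℝ (pullback ι D.γ x) (by simp [pullback]) (by simp [pullback])
      (by simp [pullback]) (by simp [pullback])
  have hs : ∀ v w, h v w = h w v := fun v w ↦ D.symm _ _ _
  refine metricTrace_self h hs ⟨fun v hv ↦ hh x v hv, fun v hv ↦ hh x v fun w ↦ ?_⟩
  exact (hs v w).trans (hv w)

end MetricHypersurfaceData

end InitialData

/-! ### Vector components as derivatives of coordinate functions. -/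

section Coordinates

variable {d : ℕ} {M : Type*} [TopologicalSpace M] [ChartedSpace (EuclideanSpace ℝ (Fin d)) M]
  [IsManifold (𝓡 d) ∞ M]

/-- Allows differentials of functions on `H` to reproduce, after pullback, the frame coefficients on
the section. -/
theorem coordCoeff_eq_dirDeriv (p₀ : M) {q : M}
    (hq : q ∈ (chartAt (EuclideanSpace ℝ (Fin d)) p₀).source) (i : Fin d)
    (v : TangentSpace (𝓡 d) q) :
    coordCoeff p₀ i q v = dirDeriv (fun z ↦ chartAt (EuclideanSpace ℝ (Fin d)) p₀ z i) q v := by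
  let c := chartAt (EuclideanSpace ℝ (Fin d)) p₀
  let L : EuclideanSpace ℝ (Fin d) →L[ℝ] ℝ := EuclideanSpace.proj i
  have hq' : q ∈ (trivializationAt (EuclideanSpace ℝ (Fin d)) (TangentSpace (𝓡 d)) p₀).baseSet := by
    rwa [TangentBundle.trivializationAt_baseSet]
  have h1 : coordCoeff p₀ i q v = L (mfderiv (𝓡 d) (𝓡 d) c q v) := by
    have h2 := TangentBundle.continuousLinearMapAt_trivializationAt (I := 𝓡 d) hq
    have h3 : mfderiv (𝓡 d) (𝓡 d) c q v = (trivializationAt (EuclideanSpace ℝ (Fin d))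
      (TangentSpace (𝓡 d)) p₀).continuousLinearMapAt ℝ q v := by
      rw [h2]
      rfl
    have h4 := Bundle.Trivialization.localFrameCoeff_apply_of_mem_baseSet (I := 𝓡 d)
      (trivializationAt (EuclideanSpace ℝ (Fin d)) (TangentSpace (𝓡 d)) p₀)
      (EuclideanSpace.basisFun (Fin d) ℝ).toBasis hq' (ext v) i
    rw [MetricHypersurfaceData.ext_self] at h4
    rw [h3]
    refine h4.trans ?_
    rw [Bundle.Trivialization.basisAt, Module.Basis.map_repr]
    rw [LinearEquiv.symm_symm, LinearEquiv.trans_apply]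
    change (Bundle.Trivialization.linearEquivAt ℝ _ _ hq' v : EuclideanSpace ℝ (Fin d)) i = _
    rw [Bundle.Trivialization.continuousLinearMapAt_apply, Bundle.Trivialization.linearMapAt_apply,
      if_pos hq']
    rfl
  have hc : MDifferentiableAt (𝓡 d) (𝓡 d) c q :=
    ((contMDiffOn_chart (I := 𝓡 d) (n := ∞)).contMDiffAt (c.open_source.mem_nhds hq)).mdifferentiableAt
      (by simp)
  have h := mvfderiv_comp_apply (I' := 𝓡 d) (I := 𝓡 d) (g := L)
    (f := c) q (L.differentiableAt (x := c q)).mdifferentiableAt hc v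
  rw [h1]
  refine Eq.trans ?_ h.symm
  have h2 : mvfderiv (𝓡 d) L (c q) = L := (L.hasFDerivAt (x := c q)).hasMFDerivAt.mfderiv
  rw [h2]
  rfl

theorem dirDeriv_comp {d' : ℕ} {N : Type*} [TopologicalSpace N]
    [ChartedSpace (EuclideanSpace ℝ (Fin d')) N] {g : N → M} {u : M → ℝ} {x : N}
    (hu : MDifferentiableAt (𝓡 d) 𝓘(ℝ, ℝ) u (g x)) (hg : MDifferentiableAt (𝓡 d') (𝓡 d) g x)
    (v : TangentSpace (𝓡 d') x) :
    dirDeriv (fun y ↦ u (g y)) x v = dirDeriv u (g x) (mfderiv (𝓡 d') (𝓡 d) g x v) :=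
  mvfderiv_comp_apply x hu hg v

end Coordinates

/-! ### Coordinates near the section adapted to the flow. -/

section SliceCoordinates

variable {m : ℕ} {H : Type*} [TopologicalSpace H]
  [ChartedSpace (EuclideanSpace ℝ (Fin (m + 1))) H] [IsManifold (𝓡 (m + 1)) ∞ H]
  {S : Type*} [TopologicalSpace S] [ChartedSpace (EuclideanSpace ℝ (Fin m)) S]
  [IsManifold (𝓡 m) ∞ S] {X : Π p : H, TangentSpace (𝓡 (m + 1)) p} {ι : S → H}

/-- Coordinates `τ`, `σ i` near a point of a cross-section, adapted to the vector field. -/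
theorem exists_slice_coordinates [T2Space H] (hX : ∀ p, SmoothVectorAt X p)
    (hι : IsCrossSection X ι) (htr : IsTransversal X ι) (x₀ : S) :
    ∃ (τ : H → ℝ) (σ : Fin m → H → ℝ) (π : H → S),
      (∀ᶠ q in 𝓝 (ι x₀), SmoothFnAt (m + 1) τ q ∧ (∀ i, SmoothFnAt (m + 1) (σ i) q) ∧
        ContMDiffAt (𝓡 (m + 1)) (𝓡 m) ∞ π q) ∧
      π (ι x₀) = x₀ ∧
      ∀ᶠ x in 𝓝 x₀, π (ι x) = x ∧ dirDeriv τ (ι x) (X (ι x)) = 1 ∧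
        (∀ i, dirDeriv (σ i) (ι x) (X (ι x)) = 0) ∧
        (∀ v, dirDeriv τ (ι x) (mfderiv (𝓡 m) (𝓡 (m + 1)) ι x v) = 0) ∧
        ∀ i v, dirDeriv (σ i) (ι x) (mfderiv (𝓡 m) (𝓡 (m + 1)) ι x v) = coordCoeff x₀ i x v := by
  let c := chartAt (EuclideanSpace ℝ (Fin m)) x₀
  have hx₀ : x₀ ∈ c.source := mem_chart_source _ x₀
  obtain ⟨ε, O, Ψ, hΨ, hy₀, -, hj, -⟩ := exists_isFlowBox (E := EuclideanSpace ℝ (Fin (m + 1)))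
    (K := EuclideanSpace ℝ (Fin m)) (F := ℝ) isOpen_univ (X := X) (fun p _ ↦ hX p)
    (G := fun _ ↦ 0) (fun _ _ _ ↦ contMDiffAt_const) 0 (j := ι ∘ c.symm) (y₀ := c x₀)
    (Q := fun y ↦ y ∈ c.target) (by
      filter_upwards [c.open_target.mem_nhds (c.map_source hx₀)] with y hy
      exact ⟨(hι.contMDiff _).comp y (contMDiffAt_chartAt_symm x₀ hy), hy⟩) (mem_univ _)
    (by simp) (fun a y h ↦ htr.comp_chart_symm hι x₀ a y h)
  have hs0 : (0 : ℝ) ∈ Ioo (-ε) ε := ⟨neg_lt_zero.2 hΨ.pos, hΨ.pos⟩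
  have hin : ∀ {s y}, s ∈ Ioo (-ε) ε → y ∈ O → (s, y) ∈ Ψ.source := fun hs hy ↦ by
    rw [hΨ.source_eq]
    exact ⟨hs, hy⟩
  have hleft : ∀ {s y}, s ∈ Ioo (-ε) ε → y ∈ O → Ψ.symm (Ψ (s, y)) = (s, y) := fun hs hy ↦
    Ψ.left_inv (hin hs hy)
  -- `τ` is the flow time from the section and `σ` the chart coordinates of the point of the section
  -- on the same curve; `π` is the projection to that point.
  let τ : H → ℝ := fun q ↦ (Ψ.symm q).1
  let σ : Fin m → H → ℝ := fun i q ↦ (Ψ.symm q).2 i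
  have hτ : ∀ q ∈ Ψ.target, SmoothFnAt (m + 1) τ q := fun q hq ↦
    (contDiff_fst.contDiffAt.contMDiffAt (n := ∞)).comp q (hΨ.smooth_symm q hq)
  have hσ : ∀ q ∈ Ψ.target, ∀ i, SmoothFnAt (m + 1) (σ i) q := fun q hq i ↦ by
    have h : ContDiff ℝ ∞ (fun z : ℝ × EuclideanSpace ℝ (Fin m) ↦ z.2 i) :=
      (EuclideanSpace.proj (𝕜 := ℝ) i : EuclideanSpace ℝ (Fin m) →L[ℝ] ℝ).contDiff.comp contDiff_snd
    exact (h.contDiffAt.contMDiffAt (n := ∞)).comp q (hΨ.smooth_symm q hq)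
  have hπ : ∀ q ∈ Ψ.target, ContMDiffAt (𝓡 (m + 1)) (𝓡 m) ∞ (fun q ↦ c.symm (Ψ.symm q).2) q := by
    intro q hq
    have h1 := Ψ.map_target hq
    rw [hΨ.source_eq] at h1
    have h2 : ContMDiffAt (𝓡 (m + 1)) (𝓡 m) ∞ (fun q ↦ (Ψ.symm q).2) q :=
      (contDiff_snd.contDiffAt.contMDiffAt (n := ∞)).comp q (hΨ.smooth_symm q hq)
    exact ContMDiffAt.comp (g := c.symm) q (contMDiffAt_chartAt_symm x₀ (hj _ h1.2).2) h2
  have hιx : ∀ {x}, x ∈ c.source → c x ∈ O → Ψ (0, c x) = ι x := fun hx hO ↦ by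
    rw [(hj _ hO).1, Function.comp_apply, c.left_inv hx]
  have hsymm : ∀ {x}, x ∈ c.source → c x ∈ O → Ψ.symm (ι x) = (0, c x) := fun hx hO ↦ by
    rw [← hιx hx hO, hleft hs0 hO]
  have hnear : ∀ᶠ x in 𝓝 x₀, x ∈ c.source ∧ c x ∈ O :=
    (eventually_mem_chartAt_source x₀).and
      ((c.continuousAt hx₀).eventually_mem (hΨ.isOpen.mem_nhds hy₀))
  have htarget : ∀ {x}, x ∈ c.source → c x ∈ O → ι x ∈ Ψ.target := fun hx hO ↦
    hιx hx hO ▸ Ψ.map_source (hin hs0 hO)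
  refine ⟨τ, σ, fun q ↦ c.symm (Ψ.symm q).2, ?_, ?_, ?_⟩
  · filter_upwards [Ψ.open_target.mem_nhds (htarget hx₀ hy₀)] with q hq
    exact ⟨hτ q hq, hσ q hq, hπ q hq⟩
  · simp only [hsymm hx₀ hy₀]
    exact c.left_inv hx₀
  · filter_upwards [hnear.eventually_nhds] with x hx
    obtain ⟨hxs, hxO⟩ := hx.self_of_nhds
    have ht := htarget hxs hxO
    have hιd : MDifferentiableAt (𝓡 m) (𝓡 (m + 1)) ι x :=
      (hι.contMDiff x).mdifferentiableAt (by simp)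
    have hflow : ∀ {u : H → ℝ} {u' : ℝ}, SmoothFnAt (m + 1) u (ι x) →
        HasDerivAt (fun s ↦ u (Ψ (s, c x))) u' 0 → dirDeriv u (ι x) (X (ι x)) = u' := by
      intro u u' hu hu'
      rw [← hιx hxs hxO] at hu ⊢
      exact (hasDerivAt_comp_integralCurve (hΨ.integral _ hxO) hs0
        (hu.mdifferentiableAt)).unique hu'
    refine ⟨?_, hflow (hτ _ ht) ?_, fun i ↦ hflow (hσ _ ht i) ?_, fun v ↦ ?_, fun i v ↦ ?_⟩
    · simp only [hsymm hxs hxO]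
      exact c.left_inv hxs
    · refine (hasDerivAt_id (0 : ℝ)).congr_of_eventuallyEq ?_
      filter_upwards [isOpen_Ioo.mem_nhds hs0] with s hs
      simp only [τ, hleft hs hxO, id]
    · refine (hasDerivAt_const (0 : ℝ) (c x i)).congr_of_eventuallyEq ?_
      filter_upwards [isOpen_Ioo.mem_nhds hs0] with s hs
      simp only [σ, hleft hs hxO]
    · rw [← dirDeriv_comp ((hτ _ ht).mdifferentiableAt) hιd,
        dirDeriv_congr (v := fun _ ↦ 0), dirDeriv_const]
      filter_upwards [hx] with z hz
      simp only [τ, hsymm hz.1 hz.2]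
    · rw [← dirDeriv_comp ((hσ _ ht i).mdifferentiableAt) hιd,
        coordCoeff_eq_dirDeriv x₀ hxs]
      refine dirDeriv_congr ?_ v
      filter_upwards [hx] with z hz
      simp only [σ, hsymm hz.1 hz.2]
      rfl

end SliceCoordinates

/-! ### Smooth local extension of the initial values. -/

section Extension

variable {m : ℕ} {H : Type*} [TopologicalSpace H]
  [ChartedSpace (EuclideanSpace ℝ (Fin (m + 1))) H] [IsManifold (𝓡 (m + 1)) ∞ H]
  {S : Type*} [TopologicalSpace S] [ChartedSpace (EuclideanSpace ℝ (Fin m)) S]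
  [IsManifold (𝓡 m) ∞ S] {ι : S → H}

/-- The form `a_{ij} dσ^i dσ^j + b_i (dτ dσ^i + dσ^i dτ) - g dτ dτ`. -/
noncomputable def adaptedForm (τ : H → ℝ) (σ : Fin m → H → ℝ) (a : Fin m → Fin m → H → ℝ)
    (b : Fin m → H → ℝ) (g : H → ℝ) (q : H) : TwoForms (m + 1) q :=
  toTwoForms (fun v w ↦ ∑ i, ∑ j, a i j q * (dirDeriv (σ i) q v * dirDeriv (σ j) q w)
      + ∑ i, b i q * (dirDeriv τ q v * dirDeriv (σ i) q w + dirDeriv (σ i) q v * dirDeriv τ q w)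
      - g q * (dirDeriv τ q v * dirDeriv τ q w))
    (fun v v' w ↦ by
      simp only [dirDeriv, map_add, add_mul, mul_add, Finset.sum_add_distrib]
      ring)
    (fun c v w ↦ by
      simp only [dirDeriv, map_smul, smul_eq_mul, mul_sub, mul_add, Finset.mul_sum]
      simp only [mul_left_comm, mul_assoc])
    (fun v w w' ↦ by
      simp only [dirDeriv, map_add, mul_add, Finset.sum_add_distrib]
      ring)
    (fun c v w ↦ by
      simp only [dirDeriv, map_smul, smul_eq_mul, mul_sub, mul_add, Finset.mul_sum]
      simp only [mul_left_comm])

theorem adaptedForm_apply (τ : H → ℝ) (σ : Fin m → H → ℝ) (a : Fin m → Fin m → H → ℝ)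
    (b : Fin m → H → ℝ) (g : H → ℝ) (q : H) (v w : TangentSpace (𝓡 (m + 1)) q) :
    adaptedForm τ σ a b g q v w
      = ∑ i, ∑ j, a i j q * (dirDeriv (σ i) q v * dirDeriv (σ j) q w)
      + ∑ i, b i q * (dirDeriv τ q v * dirDeriv (σ i) q w + dirDeriv (σ i) q v * dirDeriv τ q w)
      - g q * (dirDeriv τ q v * dirDeriv τ q w) := rfl

theorem smoothTwoAt_adaptedForm {τ : H → ℝ} {σ : Fin m → H → ℝ} {a : Fin m → Fin m → H → ℝ}
    {b : Fin m → H → ℝ} {g : H → ℝ} {q : H} (hτ : SmoothFnAt (m + 1) τ q)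
    (hσ : ∀ i, SmoothFnAt (m + 1) (σ i) q) (ha : ∀ i j, SmoothFnAt (m + 1) (a i j) q)
    (hb : ∀ i, SmoothFnAt (m + 1) (b i) q) (hg : SmoothFnAt (m + 1) g q) :
    SmoothTwoAt (adaptedForm τ σ a b g) q := by
  refine smoothTwoAt_of_apply fun V W hV hW ↦ ?_
  have h1 := hτ.dirDeriv hV
  have h2 := hτ.dirDeriv hW
  have h3 := fun i ↦ (hσ i).dirDeriv hV
  have h4 := fun i ↦ (hσ i).dirDeriv hW
  exact ((ContMDiffAt.sum fun i _ ↦ ContMDiffAt.sum fun j _ ↦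
    (ha i j).mul ((h3 i).mul (h4 j))).add (ContMDiffAt.sum fun i _ ↦
      (hb i).mul ((h1.mul (h4 i)).add ((h3 i).mul h2)))).sub (hg.mul (h1.mul h2))

namespace MetricHypersurfaceData

variable {D : MetricHypersurfaceData (m + 1) H} {f : H → ℝ} {χ : S → ℝ} {β : OneForm m S}
  {T : TwoTensor m S}

/-- Adding `cγ` raises the `P`-trace by `cm` and leaves contractions with `n` and the tangential
trace-free part unchanged. The trace can therefore be corrected last. -/
theorem isInitial_add_smul_γ (hm : 1 ≤ m) (hD : D.IsNull)
    (hh : ∀ (x : S) (v : TangentSpace (𝓡 m) x), (∀ w, pullback ι D.γ x v w = 0) → v = 0) {x : S}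
    (htr : metricTrace (pullback ι D.γ x) (fun v w ↦ T x v w) = 0)
    {Y : TwoForms (m + 1) (ι x)} (hs : ∀ v w, Y v w = Y w v)
    (hn : Y (D.n (ι x)) (D.n (ι x)) = -f (ι x))
    (hβ : ∀ v, Y (D.n (ι x)) (mfderiv (𝓡 m) (𝓡 (m + 1)) ι x v) = β x v)
    (hT : ∀ v w, Y (mfderiv (𝓡 m) (𝓡 (m + 1)) ι x v) (mfderiv (𝓡 m) (𝓡 (m + 1)) ι x w)
      = T x v w) :
    IsInitial D ι f χ β T x (Y + ((χ x - D.trForm Y) / m) • D.γ (ι x)) := by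
  have hm' : (m : ℝ) ≠ 0 := by
    rw [Nat.cast_ne_zero]
    omega
  refine ⟨fun v w ↦ ?_, ?_, fun v ↦ ?_, ?_, fun v w ↦ ?_⟩
  · simp only [add_apply, smul_apply, hs v w, D.symm (ι x) v w]
  · simp only [add_apply, smul_apply, hn, D.γ_n hD, smul_zero, add_zero]
  · simp only [add_apply, smul_apply, hβ, γ_n_left hD, smul_zero, add_zero]
  · rw [trForm_add, trForm_smul, trForm_γ hD, Nat.cast_add, Nat.cast_one, add_sub_cancel_right,
      div_mul_cancel₀ _ hm']
    ring
  · simp only [add_apply, smul_apply, smul_eq_mul, hT]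
    have h1 := metricTrace_add_mul (pullback ι D.γ x) (fun v w ↦ T x v w) (pullback ι D.γ x)
      ((χ x - D.trForm Y) / m)
    rw [htr, metricTrace_pullback_γ hh, zero_add, div_mul_cancel₀ _ hm'] at h1
    have h2 : NullData.traceFree (pullback ι D.γ x)
        (fun v w ↦ T x v w + (χ x - D.trForm Y) / m * pullback ι D.γ x v w) v w = T x v w := by
      rw [NullData.traceFree, h1]
      ring
    exact h2

/-- Near every point of a cross-section, the initial values extend smoothly. -/
theorem exists_isInitial_extension [T2Space H] (hm : 1 ≤ m) (hD : D.IsNull)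
    (hι : IsCrossSection D.n ι)
    (hh : ∀ (x : S) (v : TangentSpace (𝓡 m) x), (∀ w, pullback ι D.γ x v w = 0) → v = 0)
    (hf : ∀ p, SmoothFnAt (m + 1) f p) (hχ : ∀ x, SmoothFnAt m χ x)
    (hsymm : ∀ x v w, T x v w = T x w v)
    (htr : ∀ x, metricTrace (pullback ι D.γ x) (fun v w ↦ T x v w) = 0) (x₀ : S) :
    ∃ T₁ : Π q : H, TwoForms (m + 1) q, (∀ᶠ q in 𝓝 (ι x₀), SmoothTwoAt T₁ q) ∧
      ∀ᶠ x in 𝓝 x₀, IsInitial D ι f χ β T x (T₁ (ι x)) := by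
  obtain ⟨τ, σ, π, hsm, hπ₀, hx⟩ := exists_slice_coordinates D.smoothVectorAt_n hι
    (isTransversal_n hD hh) x₀
  -- On the section `dτ(n) = 1`, `dσ(n) = 0`, `dτ` vanishes on tangent vectors and `dσ` gives their
  -- frame coefficients; so this form has tangential part `T`, mixed part `β` and `(n, n)`-component
  -- `-f`.
  let A : Π q : H, TwoForms (m + 1) q := adaptedForm τ σ
    (fun i j q ↦ T (π q) (coordFrame x₀ i (π q)) (coordFrame x₀ j (π q)))
    (fun i q ↦ β (π q) (coordFrame x₀ i (π q))) f
  have hsrc : ∀ᶠ q in 𝓝 (ι x₀), π q ∈ (chartAt (EuclideanSpace ℝ (Fin m)) x₀).source :=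
    hsm.self_of_nhds.2.2.continuousAt.eventually (by
      rw [hπ₀]
      exact eventually_mem_chartAt_source x₀)
  refine ⟨fun q ↦ A q + ((χ (π q) - D.trForm (A q)) / m) • D.γ q, ?_, ?_⟩
  · filter_upwards [hsm, hsrc] with q hq hqs
    have hA : SmoothTwoAt A q := by
      refine smoothTwoAt_adaptedForm hq.1 hq.2.1 (fun i j ↦ ?_) (fun i ↦ ?_) (hf q)
      · have h := (TwoTensor.smoothTwoAt (d := m) T (π q)).apply (smoothVectorAt_coordFrame x₀ hqs i)
          (smoothVectorAt_coordFrame x₀ hqs j)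
        exact ContMDiffAt.comp q h hq.2.2
      · have h := (OneForm.smoothOneAt (d := m) β (π q)).apply (smoothVectorAt_coordFrame x₀ hqs i)
        exact ContMDiffAt.comp q h hq.2.2
    refine smoothTwoAt_of_apply fun V W hV hW ↦ ?_
    have h1 : SmoothFnAt (m + 1) (fun q ↦ χ (π q)) q := ContMDiffAt.comp q (hχ (π q)) hq.2.2
    exact (hA.apply hV hW).add (((h1.sub (D.smoothFnAt_trForm hA)).div_const (m : ℝ)).mul
      ((D.smoothTwoAt_γ q).apply hV hW))
  · filter_upwards [hx, eventually_mem_chartAt_source (d := m) x₀] with x hx hxs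
    obtain ⟨hπx, hτn, hσn, hτx, hσx⟩ := hx
    have hTx : ∀ i j, T (π (ι x)) (coordFrame x₀ i (π (ι x))) (coordFrame x₀ j (π (ι x)))
        = T x (coordFrame x₀ i x) (coordFrame x₀ j x) := fun i j ↦ by rw [hπx]
    have hβx : ∀ i, β (π (ι x)) (coordFrame x₀ i (π (ι x))) = β x (coordFrame x₀ i x) :=
      fun i ↦ by rw [hπx]
    have h := isInitial_add_smul_γ (f := f) (χ := χ) (β := β) (Y := A (ι x)) hm hD hh (htr x)
      (fun v w ↦ ?_) ?_ (fun v ↦ ?_) fun v w ↦ ?_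
    · simpa only [hπx] using h
    · simp only [A, adaptedForm_apply]
      rw [Finset.sum_comm]
      congr 1
      · congr 1
        · refine Finset.sum_congr rfl fun i _ ↦ Finset.sum_congr rfl fun j _ ↦ ?_
          rw [hsymm]
          ring
        · exact Finset.sum_congr rfl fun i _ ↦ by ring
      · ring
    · simp only [A, adaptedForm_apply, hτn, hσn]
      simp
    · simp only [A, adaptedForm_apply, hτn, hσn, hτx, hσx, hβx]
      conv_rhs => rw [eq_sum_coordCoeff x₀ hxs v]
      simp [mul_comm]
    · simp only [A, adaptedForm_apply, hτx, hσx, hTx]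
      conv_rhs => rw [eq_sum_coordCoeff x₀ hxs v, eq_sum_coordCoeff x₀ hxs w]
      simp only [map_sum, map_smul, sum_apply, smul_apply, smul_eq_mul, Finset.mul_sum]
      simp only [zero_mul, mul_zero, add_zero, Finset.sum_const_zero, sub_zero]
      rw [Finset.sum_comm]
      exact Finset.sum_congr rfl fun i _ ↦ Finset.sum_congr rfl fun j _ ↦ by ring

end MetricHypersurfaceData

end Extension

/-! ### Assembling the pointwise initial values. -/

section Initial

variable {m : ℕ} {H : Type*} [TopologicalSpace H]
  [ChartedSpace (EuclideanSpace ℝ (Fin (m + 1))) H] [IsManifold (𝓡 (m + 1)) ∞ H]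
  {S : Type*} [TopologicalSpace S] [ChartedSpace (EuclideanSpace ℝ (Fin m)) S]
  [IsManifold (𝓡 m) ∞ S] {ι : S → H}

theorem IsCrossSection.injective {X : Π p : H, TangentSpace (𝓡 (m + 1)) p}
    (hι : IsCrossSection X ι) : Function.Injective ι :=
  hι.isSmoothEmbedding.isEmbedding.injective

namespace MetricHypersurfaceData

variable {D : MetricHypersurfaceData (m + 1) H} {f : H → ℝ} {χ : S → ℝ} {β : OneForm m S}
  {T : TwoTensor m S}

/-- Injectivity of `ι` makes the choice of one form per point well defined on the image; values
elsewhere never matter. No smoothness is claimed here. -/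
theorem exists_initial_values (hι : Function.Injective ι)
    (h : ∀ x, ∃ Y : TwoForms (m + 1) (ι x), IsInitial D ι f χ β T x Y) :
    ∃ T₀ : Π q : H, TwoForms (m + 1) q, ∀ x, IsInitial D ι f χ β T x (T₀ (ι x)) := by
  classical
  choose Y hY using h
  refine ⟨fun q ↦ if hq : ∃ x, ι x = q then hq.choose_spec ▸ Y hq.choose else 0, fun x ↦ ?_⟩
  have hx : ∃ x', ι x' = ι x := ⟨x, rfl⟩
  have key : ∀ (x' : S) (e : ι x' = ι x), IsInitial D ι f χ β T x (e ▸ Y x') := by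
    intro x' e
    obtain rfl := hι e
    exact hY x'
  beta_reduce
  rw [dif_pos hx]
  exact key _ _

theorem isInitial_iff (Y : TwoTensor (m + 1) H) (hs : ∀ p v w, Y p v w = Y p w v)
    (hκ : ∀ p, D.κ Y p = f p) (x : S) :
    IsInitial D ι f χ β T x (Y (ι x)) ↔
      D.trP (fun q v w ↦ Y q v w) (ι x) = χ x ∧
      (∀ v : TangentSpace (𝓡 m) x, D.r Y (ι x) (mfderiv (𝓡 m) (𝓡 (m + 1)) ι x v) = β x v) ∧
      ∀ v w : TangentSpace (𝓡 m) x,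
        NullData.traceFree (pullback ι D.γ x) (pullback ι Y x) v w = T x v w :=
  ⟨fun h ↦ ⟨h.trace, h.n_tangent, h.traceFree⟩, fun h ↦
    ⟨hs _, by rw [← hκ, κ, neg_neg], h.2.1, h.1, h.2.2⟩⟩

end MetricHypersurfaceData

end Initial

end NullData

/-! ### Existence and uniqueness. -/

theorem mainTheorem8 {m : ℕ} (hm : 1 ≤ m)
    {H : Type*} [TopologicalSpace H] [T2Space H] [SecondCountableTopology H]
    [ChartedSpace (EuclideanSpace ℝ (Fin (m + 1))) H] [IsManifold (𝓡 (m + 1)) ∞ H]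
    {S : Type*} [TopologicalSpace S]
    [ChartedSpace (EuclideanSpace ℝ (Fin m)) S] [IsManifold (𝓡 m) ∞ S]
    (D : NullData.MetricHypersurfaceData (m + 1) H) (hD : D.IsNull)
    (ι : S → H) (hι : NullData.IsCrossSection D.n ι)
    (hh : ∀ (x : S) (v : TangentSpace (𝓡 m) x),
      (∀ w, NullData.pullback ι D.γ x v w = 0) → v = 0)
    (f : ContMDiffMap (𝓡 (m + 1)) 𝓘(ℝ, ℝ) H ℝ ∞) (hf : D.RaychaudhuriEq f) (Λ : ℝ)
    (χ : ContMDiffMap (𝓡 m) 𝓘(ℝ, ℝ) S ℝ ∞) (β : NullData.OneForm m S)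
    (T : NullData.TwoTensor m S)
    (hsymm : ∀ (x : S) (v w : TangentSpace (𝓡 m) x), T x v w = T x w v)
    (htr : ∀ x : S, NullData.metricTrace (NullData.pullback ι D.γ x) (fun v w ↦ T x v w) = 0) :
    ∃! Y : NullData.TwoTensor (m + 1) H,
      (∀ (p : H) (v w : TangentSpace (𝓡 (m + 1)) p), Y p v w = Y p w v) ∧
      (∀ x : S, D.trP (fun q v w ↦ Y q v w) (ι x) = χ x) ∧
      (∀ p : H, D.κ Y p = f p) ∧
      (∀ (x : S) (v : TangentSpace (𝓡 m) x),
        D.r Y (ι x) (mfderiv (𝓡 m) (𝓡 (m + 1)) ι x v) = β x v) ∧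
      (∀ (x : S) (v w : TangentSpace (𝓡 m) x),
        NullData.traceFree (NullData.pullback ι D.γ x) (NullData.pullback ι Y x) v w
          = T x v w) ∧
      (∀ (p : H) (v w : TangentSpace (𝓡 (m + 1)) p),
        D.constraintTensor Y p v w = Λ * D.γ p v w) := by
  have htrans := NullData.MetricHypersurfaceData.isTransversal_n hD hh
  have hext := NullData.MetricHypersurfaceData.exists_isInitial_extension (f := f) (χ := χ) (β := β) hm hD hι hh
    (fun p ↦ f.contMDiff p) (fun x ↦ χ.contMDiff x) hsymm htr
  obtain ⟨T₀, hT₀⟩ := NullData.MetricHypersurfaceData.exists_initial_values hι.injective fun x ↦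
    let ⟨T₁, _, h⟩ := hext x
    ⟨T₁ (ι x), h.self_of_nhds⟩
  obtain ⟨Y, hYs, hYκ, hYR, hY₀⟩ := NullData.MetricHypersurfaceData.exists_constraintTensor_eq hD hι htrans hf Λ T₀ (fun x ↦ by
    -- The chosen values coincide with the smooth local extensions along the section, because the
    -- initial conditions determine the form at each point.
    obtain ⟨T₁, h1, h2⟩ := hext x
    refine ⟨T₁, h1, ?_⟩
    filter_upwards [h2] with x' hx'
    exact hx'.eq hm hD htrans (hT₀ x')) (fun x ↦ (hT₀ x).symm) (fun x ↦ (hT₀ x).n_n)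
  have hY : ∀ x, D.IsInitial ι f χ β T x (Y (ι x)) := fun x ↦ by
    rw [hY₀]
    exact hT₀ x
  have hY' := fun x ↦ (NullData.MetricHypersurfaceData.isInitial_iff Y hYs hYκ x).1 (hY x)
  refine ⟨Y, ⟨hYs, fun x ↦ (hY' x).1, hYκ, fun x ↦ (hY' x).2.1, fun x ↦ (hY' x).2.2, hYR⟩, ?_⟩
  rintro Z ⟨hZs, hZ1, hZκ, hZ2, hZ3, hZR⟩
  exact NullData.MetricHypersurfaceData.constraintTensor_unique hD hι hZs hYs hZκ hYκ hZR hYR fun x ↦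
    ((NullData.MetricHypersurfaceData.isInitial_iff Z hZs hZκ x).2 ⟨hZ1 x, hZ2 x, hZ3 x⟩).eq hm hD htrans (hY x)
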